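/- All graphs are finite and simple. A graph is unicyclic if it is connected and has as many edges as vertices (equivalently, it is connected with exactly one cycle). For a graph $G$ with $n$ vertices let $D(G)$ be its diagonal degree matrix, $A(G)$ its adjacency matrix and $Q(G)=D(G)+A(G)$ its signless Laplacian matrix. The signless Laplacian coefficients $\varphi_0(G),\dots,\varphi_n(G)$ are defined by $\det(xI-Q(G))=\sum_{i=0}^n(-1)^i\varphi_i(G)x^{n-i}$. For $n$-vertex graphs write $G\preceq H$ if $\varphi_i(G)\le\varphi_i(H)$ for all $i=0,1,\dots,n$. Let $\mathcal G_{g_2}(n,m)$ be the set of all $n$-vertex unicyclic graphs whose cycle has even length and whose matching number (the largest number of edges in a matching) is $m$. We say that $G$ has minimal all signless Laplacian coefficients in $\mathcal G_{g_2}(n,m)$ if $G\in\mathcal G_{g_2}(n,m)$ and $G\preceq H$ for every $H\in\mathcal G_{g_2}(n,m)$. Let $G_4(s_1,t_1;s_2,t_2;s_3,t_3;s_4,t_4)$ denote the graph obtained from a cycle $u_1u_2u_3u_4u_1$ by attaching $s_i$ pendent paths of length $2$ and $t_i$ pendent edges at $u_i$ $(i=1,\dots,4)$. For $n\ge 2m$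 put $$G_4^1=G_4(0,0;0,0;0,0;m-2,n-2m)\quad(m\ge2),$$ $$G_4^2=G_4(0,0;0,0;0,1;m-3,n-2m+1)\quad(m\ge3),$$ $$G_4^4=G_4(0,1;0,1;0,1;m-4,n-2m+1)\quad(m\ge4).$$ Theorem 4.2. Let $n,m$ be integers with $m\ge 2$ and $n\ge 2m$. (1) If $m=2$, then $G_4^1$ has minimal all signless Laplacian coefficients in $\mathcal G_{g_2}(n,m)$. (2) If $m=3$, then $G_4^2$ has minimal all signless Laplacian coefficients in $\mathcal G_{g_2}(n,m)$. (3) If $m\ge4$ and $n=8$, then $G_4^4$ has minimal all signless Laplacian coefficients in $\mathcal G_{g_2}(n,m)$. (4) If $m\ge 4$, $n\ge 11$ and $n-m\ge 7$, or $m\ge5$, $n\ge11$ and $n-m\ge6$, or $m\ge7$, $n\ge11$ and $n-m\ge5$, then $G_4^2$ has minimal all signless Laplacian coefficients in $\mathcal G_{g_2}(n,m)$. (5) In all remaining cases with $m\ge4$, both $G_4^2$ and $G_4^4$ belong to $\mathcal G_{g_2}(n,m)$, every $H\in\mathcal G_{g_2}(n,m)$ satisfies $G_4^2\preceq H$ or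 $G_4^4\preceq H$, and $G_4^2$ and $G_4^4$ are incomparable: neither $G_4^2\preceq G_4^4$ nor $G_4^4\preceq G_4^2$. -/

import Mathlib

/-! Signless Laplacian coefficients of unicyclic graphs with given matching number. -/

/-- A unicyclic graph: a connected (simple) graph with as many edges as vertices. -/
def IsUnicyclic {V : Type*} [Fintype V] (G : SimpleGraph V) : Prop :=
  G.Connected ∧ G.edgeSet.ncard = Fintype.card V

/-- `G` has matching number `m`: the largest number of edges of a matching of `G` is `m`. -/
def HasMatchingNumber {V : Type*} (G : SimpleGraph V) (m : ℕ) : Prop :=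
  IsGreatest {k : ℕ | ∃ M : G.Subgraph, M.IsMatching ∧ M.edgeSet.ncard = k} m

/-- The class of unicyclic graphs with `n` vertices, matching number `m` and even girth. -/
structure IsEvenUnicyclic {V : Type*} [Fintype V] (n m : ℕ) (G : SimpleGraph V) : Prop where
  card_eq : Fintype.card V = n
  unicyclic : IsUnicyclic G
  matching : HasMatchingNumber G m
  even_girth : Even G.girth

/-- The signless Laplacian matrix `Q(G) = D(G) + A(G)`. -/
def signlessLaplacian {V : Type*} [Fintype V] [DecidableEq V] (G : SimpleGraph V)
    [DecidableRel G.Adj] : Matrix V V ℤ :=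
  G.degMatrix ℤ + G.adjMatrix ℤ

open Classical in
/-- The signless Laplacian coefficient `φ_i(G)`, `0 ≤ i ≤ n`, given by
`det (x I - Q(G)) = ∑ i, (-1) ^ i * φ_i(G) * x ^ (n - i)` where `n` is the number of vertices. -/
noncomputable def signlessCoeff {V : Type*} [Fintype V] (G : SimpleGraph V) (i : ℕ) : ℤ :=
  (-1) ^ i * (signlessLaplacian G).charpoly.coeff (Fintype.card V - i)

/-- `φ_i(G) ≤ φ_i(H)` for all `i = 0, 1, …, n` (for graphs `G`, `H` with `n` vertices). -/
def SignlessCoeffLE {V W : Type*} [Fintype V] [Fintype W] (n : ℕ)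
    (G : SimpleGraph V) (H : SimpleGraph W) : Prop :=
  ∀ i ≤ n, signlessCoeff G i ≤ signlessCoeff H i

/-- `G` belongs to the class of `n`-vertex unicyclic graphs of even girth with matching number `m`,
and each of its signless Laplacian coefficients is minimal in that class. -/
def MinimisesSignlessCoeffs.{u, v} {V : Type v} [Fintype V] (n m : ℕ) (G : SimpleGraph V) : Prop :=
  IsEvenUnicyclic n m G ∧
    ∀ (W : Type u) [Fintype W] (H : SimpleGraph W),
      IsEvenUnicyclic n m H → SignlessCoeffLE n G H

/-- Vertices of `G_g(s₁,t₁; …; s_g,t_g)`: the cycle vertices `u_i`, then for each `i` the two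
vertices (`0` next to `u_i`, `1` the pendent one) of each of the `s_i` pendent paths of length `2`
at `u_i`, then the `t_i` pendent vertices adjacent to `u_i`. -/
abbrev PendentVertex (g : ℕ) (s t : Fin g → ℕ) : Type :=
  Fin g ⊕ ((i : Fin g) × (Fin (s i) × Fin 2)) ⊕ ((i : Fin g) × Fin (t i))

/-- The edges of `G_g(s₁,t₁; …; s_g,t_g)`, the non-cycle ones listed in one direction. -/
def pendentRel (g : ℕ) (s t : Fin g → ℕ) : PendentVertex g s t → PendentVertex g s t → Prop
  | .inl i, .inl j => (SimpleGraph.cycleGraph g).Adj i j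
  | .inl i, .inr (.inl ⟨j, _, k⟩) => i = j ∧ k = 0
  | .inr (.inl ⟨i, a, k⟩), .inr (.inl ⟨j, b, l⟩) => i = j ∧ a.val = b.val ∧ k = 0 ∧ l = 1
  | .inl i, .inr (.inr ⟨j, _⟩) => i = j
  | _, _ => False

/-- `G_g(s₁,t₁; …; s_g,t_g)`: the graph obtained from a cycle `u₁ u₂ … u_g u₁` by attaching `s_i`
pendent paths of length `2` and `t_i` pendent edges at `u_i`, for `i = 1, …, g`. -/
def pendentGraph (g : ℕ) (s t : Fin g → ℕ) : SimpleGraph (PendentVertex g s t) :=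
  SimpleGraph.fromRel (pendentRel g s t)

/-- `G_4^1 = G_4(0,0; 0,0; 0,0; m-2,n-2m)`, for `m ≥ 2` and `n ≥ 2m`. -/
abbrev graphG41 (n m : ℕ) := pendentGraph 4 ![0, 0, 0, m - 2] ![0, 0, 0, n - 2 * m]

/-- `G_4^2 = G_4(0,0; 0,0; 0,1; m-3,n-2m+1)`, for `m ≥ 3` and `n ≥ 2m`. -/
abbrev graphG42 (n m : ℕ) := pendentGraph 4 ![0, 0, 0, m - 3] ![0, 0, 1, n - 2 * m + 1]

/-- `G_4^4 = G_4(0,1; 0,1; 0,1; m-4,n-2m+1)`, for `m ≥ 4` and `n ≥ 2m`. -/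
abbrev graphG44 (n m : ℕ) := pendentGraph 4 ![0, 0, 0, m - 4] ![1, 1, 1, n - 2 * m + 1]

universe u

section

open Polynomial
open scoped Classical

/-! A unicyclic graph of even girth is bipartite, and conjugating by the signs of a 2-colouring
turns the signless Laplacian into the Laplacian `L`. Hence `φ_i` is the coefficient of `X ^ i` in
`det (1 + X L)` (`signlessCoeff_eq_coeff_lapPoly`), and the order `≼` becomes coefficientwise
comparison of the polynomials `lapPoly`.

These polynomials are controlled together with their rooted versions `rootPoly`, in which the row of
one vertex is replaced by a unit row. Hanging a leaf or a path of length two at `u` acts linearly on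
the pair (`lapPoly`, `rootPoly` at `u`), by `addLeaf` and `addPath`. `Dominates` records a pair `(f,
r)` where `f` bounds `lapPoly` and `r` bounds `rootPoly` at every vertex of the graph, so the bound
survives an attachment at any vertex. Subdividing an edge, with or without a leaf on the new vertex,
increases the polynomials at least as much as these attachments do. All such inequalities reduce to
coefficientwise nonnegativity of determinants and cofactors of M-matrices over `ℤ[X]`
(`IsMMatrix.det_nonneg`, `IsMMatrix.rowDet_unitRow_nonneg`), proved by a rooting and contraction
expansion.

The lower bound `IsUnicyclicOn.hasExtremalBound` is an induction over triangle-free unicyclic graphs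
with a chosen matching of `m` edges. Unmatched leaves, pendent paths, unmatched vertices of a bare
cycle, matched edges of a bare cycle and cycle vertices matched to a leaf are removed as long as no
triangle arises. A degree count (`IsUnicyclicOn.degrees`) shows that when no leaf can be removed,
the graph is a cycle with at most one leaf at each vertex, so what finally resists is a four-cycle
with leaves. There the matching size forces two adjacent leafed vertices (`m = 3`) or four leafed
vertices (`m = 4`); `m = 2` is settled by reducing to the bare four-cycle. With `k = n - 2m`, every
graph is therefore bounded below by one of three base profiles extended by `m - 2`, `m - 3` or `m -
4` paths and `k` leaves.

`G_4^1`, `G_4^2` and `G_4^4` attain these bounds (`IsModel`), because all their attachments are made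
at a vertex where the rooted bound is sharp. What remains is explicit: the two-leaf profile is below
the cycle profile with a path added, and with `j = m - 4` the two-leaf profile beats the four-leaf
one as soon as `k + 2 * j ≥ 3`, that is `n ≥ 11`. For `n = 8` the four-leaf polynomial is smaller,
and for `n = 9, 10` the two are incomparable. -/

/-- All coefficients of an integer polynomial are nonnegative. -/
def CoeffNonneg (p : ℤ[X]) : Prop := ∀ i, 0 ≤ p.coeff i

/-! ### Coefficientwise nonnegative polynomials. -/

namespace CoeffNonneg

lemma zero : CoeffNonneg 0 := fun i => by simp

lemma one : CoeffNonneg 1 := fun i => by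
  rw [coeff_one]; split_ifs <;> simp

lemma X : CoeffNonneg (X : ℤ[X]) := fun i => by
  rw [coeff_X]; split_ifs <;> simp

lemma natCast (k : ℕ) : CoeffNonneg (k : ℤ[X]) := fun i => by
  rw [← C_eq_natCast, coeff_C]; split_ifs <;> simp

lemma ofNat (k : ℕ) [k.AtLeastTwo] : CoeffNonneg (OfNat.ofNat k : ℤ[X]) := natCast k

lemma add {p q : ℤ[X]} (hp : CoeffNonneg p) (hq : CoeffNonneg q) : CoeffNonneg (p + q) :=
  fun i => by rw [coeff_add]; exact add_nonneg (hp i) (hq i)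

lemma mul {p q : ℤ[X]} (hp : CoeffNonneg p) (hq : CoeffNonneg q) : CoeffNonneg (p * q) :=
  fun i => by rw [coeff_mul]; exact Finset.sum_nonneg fun x _ => mul_nonneg (hp _) (hq _)

lemma pow {p : ℤ[X]} (hp : CoeffNonneg p) (k : ℕ) : CoeffNonneg (p ^ k) := by
  induction k with
  | zero => simpa using one
  | succ k ih => rw [pow_succ]; exact ih.mul hp

lemma sum {ι : Type*} (s : Finset ι) (f : ι → ℤ[X]) (h : ∀ i ∈ s, CoeffNonneg (f i)) :
    CoeffNonneg (∑ i ∈ s, f i) := fun i => by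
  rw [finsetSum_coeff]; exact Finset.sum_nonneg fun x hx => h x hx i

lemma of_eq {p q : ℤ[X]} (hq : CoeffNonneg q) (h : p = q) : CoeffNonneg p := h ▸ hq

/-- If `f + k g` is coefficientwise nonnegative for all natural `k`, then so is `g`. -/
lemma of_forall_natCast {f g : ℤ[X]} (h : ∀ k : ℕ, CoeffNonneg (f + (k : ℤ[X]) * g)) :
    CoeffNonneg g := fun i => by
  by_contra hg
  -- A negative coefficient of `g` is at most `-1`, so this multiple of it outweighs the coefficient
  -- of `f`.
  have h1 := h ((f.coeff i).natAbs + 1) i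
  rw [← C_eq_natCast, coeff_add, coeff_C_mul] at h1
  push_cast at h1
  have h2 : f.coeff i ≤ |f.coeff i| := le_abs_self _
  have h3 : 0 ≤ |f.coeff i| := abs_nonneg _
  nlinarith

end CoeffNonneg

/-! ### M-matrices over `ℤ[X]`: nonnegativity of determinants and cofactors. -/

section MMatrix

variable {V : Type*}

/-- The unit row vector at `v`. -/
noncomputable def unitRow (v : V) : V → ℤ[X] := Pi.single v 1

lemma unitRow_self (v : V) : unitRow v v = 1 := by simp [unitRow]

lemma unitRow_ne {v j : V} (h : j ≠ v) : unitRow v j = 0 := by simp [unitRow, h]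

lemma updateRow_unit {M : Matrix V V ℤ[X]} {v i : V} (hi : M i = unitRow i) :
    M.updateRow v (unitRow v) i = unitRow i := by
  by_cases h : i = v
  · subst h; rw [Matrix.updateRow_self]
  · rw [Matrix.updateRow_ne h, hi]

/-- Contract `v` into `u`. -/
noncomputable def mergeInto (M : Matrix V V ℤ[X]) (v u : V) : Matrix V V ℤ[X] := fun i j =>
  if i = v then unitRow v j else if j = v then 0 else if j = u then M i u + M i v else M i j

lemma mergeInto_unit {M : Matrix V V ℤ[X]} {v u i : V} (hi : M i = unitRow i) :
    mergeInto M v u i = unitRow i := by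
  ext j : 1
  unfold mergeInto
  split_ifs with h1 h2 h3
  · rw [h1]
  · rw [unitRow_ne]; rintro rfl; exact h1 h2
  · subst h3
    rw [hi, unitRow_ne (Ne.symm h1), add_zero]
  · rw [hi]

variable [Fintype V]

/-- Off-diagonal entries nonpositive and row sums nonnegative, coefficientwise. -/
structure IsMMatrix (M : Matrix V V ℤ[X]) : Prop where
  off : ∀ i j, i ≠ j → CoeffNonneg (-M i j)
  row : ∀ i, CoeffNonneg (∑ j, M i j)

lemma sum_unitRow (v : V) : ∑ j, unitRow v j = 1 := by
  simp [unitRow, Pi.single_apply]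

/-- Admissible rows of an M-matrix. -/
def IsMRow (v : V) (r : V → ℤ[X]) : Prop :=
  (∀ j, v ≠ j → CoeffNonneg (-r j)) ∧ CoeffNonneg (∑ j, r j)

lemma IsMRow.unitRow (v : V) : IsMRow v (unitRow v) := by
  refine ⟨fun j hj => ?_, ?_⟩
  · rw [unitRow_ne (Ne.symm hj)]; simpa using CoeffNonneg.zero
  · rw [sum_unitRow]; exact .one

lemma IsMRow.unitRow_sub {v u : V} : IsMRow v (_root_.unitRow v - _root_.unitRow u) := by
  refine ⟨fun j hj => ?_, ?_⟩
  · rw [Pi.sub_apply, unitRow_ne (Ne.symm hj)]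
    by_cases h : j = u
    · subst h; rw [unitRow_self]; simpa using CoeffNonneg.one
    · rw [unitRow_ne h]; simpa using CoeffNonneg.zero
  · simp only [Pi.sub_apply, Finset.sum_sub_distrib, sum_unitRow]; simpa using CoeffNonneg.zero

lemma IsMRow.add {v : V} {r s : V → ℤ[X]} (hr : IsMRow v r) (hs : IsMRow v s) :
    IsMRow v (r + s) := by
  refine ⟨fun j hj => ?_, ?_⟩
  · exact ((hr.1 j hj).add (hs.1 j hj)).of_eq (by simp; ring)
  · exact (hr.2.add hs.2).of_eq (by simp [Finset.sum_add_distrib])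

lemma IsMRow.smul {v : V} {r : V → ℤ[X]} {c : ℤ[X]} (hc : CoeffNonneg c) (hr : IsMRow v r) :
    IsMRow v (c • r) := by
  refine ⟨fun j hj => ?_, ?_⟩
  · exact (hc.mul (hr.1 j hj)).of_eq (by simp)
  · exact (hc.mul hr.2).of_eq (by simp [Finset.mul_sum])

lemma IsMMatrix.updateRow {M : Matrix V V ℤ[X]} (hM : IsMMatrix M) {v : V} {r : V → ℤ[X]}
    (hr : IsMRow v r) : IsMMatrix (M.updateRow v r) := by
  constructor
  · intro i j hij
    by_cases h : i = v
    · subst h; rw [Matrix.updateRow_self]; exact hr.1 j hij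
    · rw [Matrix.updateRow_ne h]; exact hM.off i j hij
  · intro i
    by_cases h : i = v
    · subst h; simp only [Matrix.updateRow_self]; exact hr.2
    · simp only [Matrix.updateRow_ne h]; exact hM.row i

/-- The determinant as a linear function of row `v`. -/
noncomputable def rowDet (M : Matrix V V ℤ[X]) (v : V) : (V → ℤ[X]) →ₗ[ℤ[X]] ℤ[X] where
  toFun r := (M.updateRow v r).det
  map_add' r s := Matrix.det_updateRow_add M v r s
  map_smul' c r := by simp [Matrix.det_updateRow_smul]

lemma rowDet_apply (M : Matrix V V ℤ[X]) (v : V) (r : V → ℤ[X]) :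
    rowDet M v r = (M.updateRow v r).det := rfl

lemma rowDet_self (M : Matrix V V ℤ[X]) (v : V) : rowDet M v (M v) = M.det := by
  rw [rowDet_apply, Matrix.updateRow_eq_self]

/-- Writes an M-matrix row as a combination, with nonnegative coefficients, of the two row types
that can be interpreted: the unit row (rooting `v`) and `e_v - e_u` (contracting `v` into `u`). The
coefficient at `u = v` is harmless, since its vector is zero. -/
lemma row_eq_sum_sub (r : V → ℤ[X]) (v : V) :
    r = (∑ j, r j) • unitRow v + ∑ u, (-r u) • (unitRow v - unitRow u) := by
  ext j : 1
  simp only [Pi.add_apply, Pi.smul_apply, Finset.sum_apply, Pi.sub_apply, smul_eq_mul, mul_sub,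
    Finset.sum_sub_distrib, neg_mul, Finset.sum_neg_distrib, ← Finset.sum_mul]
  have : ∑ u, r u * unitRow u j = r j := by
    rw [Finset.sum_eq_single j]
    · rw [unitRow_self, mul_one]
    · intro b _ hb; rw [unitRow_ne (Ne.symm hb), mul_zero]
    · simp
  rw [this]; ring

lemma det_eq_row_expansion (M : Matrix V V ℤ[X]) (v : V) :
    M.det = (∑ j, M v j) * rowDet M v (unitRow v) +
      ∑ u, (-M v u) * rowDet M v (unitRow v - unitRow u) := by
  conv_lhs => rw [← rowDet_self M v, row_eq_sum_sub (M v) v]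
  simp only [map_add, map_smul, map_sum, smul_eq_mul]

/-- Adding column `v` to column `u` turns the row `e_v - e_u` into `e_v`; multiples of this row then
clear the rest of column `v`. -/
lemma det_mergeInto (M : Matrix V V ℤ[X]) {v u : V} (h : v ≠ u) :
    rowDet M v (unitRow v - unitRow u) = (mergeInto M v u).det := by
  rw [rowDet_apply, ← Matrix.det_updateCol_add_self _ h.symm]
  refine Matrix.det_eq_of_forall_row_eq_smul_add_const (fun i => if i = v then 0 else M i v) v
    (by simp) fun i j => ?_
  by_cases hi : i = v
  · subst hi
    by_cases hj : j = u
    · subst hj; simp [mergeInto, unitRow, h]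
    · by_cases hj' : j = i
      · subst hj'; simp [mergeInto, unitRow, h]
      · simp [mergeInto, unitRow, hj, hj']
  · by_cases hj : j = u
    · subst hj; simp [mergeInto, unitRow, hi, h.symm]
    · by_cases hj' : j = v
      · subst hj'; simp [mergeInto, unitRow, hi, h]
      · simp [mergeInto, unitRow, hi, hj, hj']

/-- Contraction only moves the entry in column `v` over to column `u`, so the other row sums do not
change. -/
lemma IsMMatrix.mergeInto {M : Matrix V V ℤ[X]} (hM : IsMMatrix M) {v u : V} (h : v ≠ u) :
    IsMMatrix (_root_.mergeInto M v u) := by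
  constructor
  · intro i j hij
    unfold _root_.mergeInto
    split_ifs with h1 h2 h3
    · subst h1; rw [unitRow_ne (Ne.symm hij)]; simpa using CoeffNonneg.zero
    · simpa using CoeffNonneg.zero
    · subst h3; exact ((hM.off i j hij).add (hM.off i v h1)).of_eq (by ring)
    · exact hM.off i j hij
  · intro i
    by_cases hi : i = v
    · simp only [_root_.mergeInto, hi, if_true, sum_unitRow]; exact .one
    · refine (hM.row i).of_eq ?_
      have : ∀ j, _root_.mergeInto M v u i j =
          M i j + (if j = u then M i v else 0) - (if j = v then M i v else 0) := by
        intro j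
        unfold _root_.mergeInto
        rw [if_neg hi]
        by_cases h2 : j = v
        · subst h2; simp [h]
        · by_cases h3 : j = u
          · subst h3; simp [h2]
          · simp [h2, h3]
      simp only [this, Finset.sum_sub_distrib, Finset.sum_add_distrib]
      simp

/-- The rows which are not unit rows. -/
noncomputable def freeRows (M : Matrix V V ℤ[X]) : Finset V :=
  Finset.univ.filter fun i => M i ≠ unitRow i

/-- The termination measure of the expansion: rooting and contracting both create a new unit row and
keep the old ones. -/
lemma card_freeRows_lt {M N : Matrix V V ℤ[X]} {v : V} (hv : M v ≠ unitRow v)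
    (hNv : N v = unitRow v) (hN : ∀ i, M i = unitRow i → N i = unitRow i) :
    (freeRows N).card < (freeRows M).card := by
  refine Finset.card_lt_card ⟨fun i hi => ?_, fun hsub => ?_⟩
  · simp only [freeRows, Finset.mem_filter, Finset.mem_univ, true_and] at hi ⊢
    exact fun h => hi (hN i h)
  · have : v ∈ freeRows N := hsub (by simpa [freeRows] using hv)
    simp [freeRows, hNv] at this

/-- M-matrices have coefficientwise nonnegative determinants. -/
theorem IsMMatrix.det_nonneg {M : Matrix V V ℤ[X]} (hM : IsMMatrix M) : CoeffNonneg M.det := by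
  induction hN : (freeRows M).card using Nat.strong_induction_on generalizing M with
  | _ N ih =>
  subst hN
  by_cases hall : ∀ v, M v = unitRow v
  · have : M = 1 := by
      ext i j : 2
      rw [hall i, Matrix.one_apply, unitRow, Pi.single_apply]
      simp [eq_comm]
    rw [this, Matrix.det_one]; exact .one
  · push Not at hall
    obtain ⟨v, hv⟩ := hall
    -- Every summand is a nonnegative coefficient times the determinant of a rooted or contracted
    -- M-matrix with fewer free rows.
    rw [det_eq_row_expansion M v]
    refine ((hM.row v).mul ?_).add (.sum _ _ fun u _ => ?_)
    · exact ih _ (card_freeRows_lt hv (Matrix.updateRow_self ..) fun i => updateRow_unit)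
        (hM.updateRow (.unitRow v)) rfl
    · by_cases h : v = u
      · subst h; simpa using CoeffNonneg.zero
      · rw [det_mergeInto M h]
        refine (hM.off v u h).mul (ih _ (card_freeRows_lt hv ?_ fun i => mergeInto_unit)
          (hM.mergeInto h) rfl)
        exact funext fun j => if_pos rfl

lemma rowDet_eq_zero (M : Matrix V V ℤ[X]) {i j : V} (h : i ≠ j) : rowDet M j (M i) = 0 :=
  Matrix.det_updateRow_eq_zero h

lemma rowDet_updateRow (M : Matrix V V ℤ[X]) {i j : V} (h : i ≠ j) (r s : V → ℤ[X]) :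
    rowDet (M.updateRow i r) j s = rowDet (M.updateRow j s) i r := by
  rw [rowDet_apply, rowDet_apply, Matrix.updateRow_comm _ h]

/-- Polarisation: the determinant vanishes when the two rows agree, in particular when both are `r +
s`. -/
lemma rowDet_swap (M : Matrix V V ℤ[X]) {i j : V} (h : i ≠ j) (r s : V → ℤ[X]) :
    rowDet (M.updateRow i r) j s = - rowDet (M.updateRow i s) j r := by
  have key : ∀ t, rowDet (M.updateRow i t) j t = 0 := fun t => by
    have := rowDet_eq_zero (M.updateRow i t) h
    rwa [Matrix.updateRow_self] at this
  have h1 := key (r + s)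
  rw [rowDet_updateRow M h, map_add, ← rowDet_updateRow M h, ← rowDet_updateRow M h, map_add,
    map_add, key, key] at h1
  linear_combination h1

/-- M-matrices have coefficientwise nonnegative adjugates. -/
theorem IsMMatrix.rowDet_unitRow_nonneg {M : Matrix V V ℤ[X]} (hM : IsMMatrix M) (i j : V) :
    CoeffNonneg (rowDet M j (unitRow i)) := by
  induction hN : (freeRows M).card using Nat.strong_induction_on generalizing M i with
  | _ N ih =>
  subst hN
  by_cases hij : i = j
  · subst hij; exact (hM.updateRow (.unitRow i)).det_nonneg
  by_cases hi : M i = unitRow i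
  · rw [← hi, rowDet_eq_zero M hij]; exact .zero
  · have h1 : rowDet M j (unitRow i) = rowDet (M.updateRow j (unitRow i)) i (M i) := by
      rw [← rowDet_updateRow _ hij, Matrix.updateRow_eq_self]
    have h0 : rowDet (M.updateRow j (unitRow i)) i (unitRow i) = 0 := by
      have := rowDet_eq_zero (M.updateRow j (unitRow i)) (Ne.symm hij)
      rwa [Matrix.updateRow_self] at this
    rw [h1, row_eq_sum_sub (M i) i]
    simp only [map_add, map_smul, map_sum, map_sub, h0, smul_zero, zero_add, zero_sub]
    refine .sum _ _ fun u _ => ?_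
    by_cases hu : i = u
    · subst hu; rw [h0]; simpa using CoeffNonneg.zero
    · rw [rowDet_swap _ (Ne.symm hij), neg_neg, smul_eq_mul, ← rowDet_updateRow _ hij]
      exact (hM.off i u hu).mul (ih _ (card_freeRows_lt hi (Matrix.updateRow_self ..)
        fun i => updateRow_unit) (hM.updateRow (.unitRow i)) u rfl)

end MMatrix

/-! ### Determinants under rooting and edge addition. -/

section EdgeCalculus

variable {V : Type*}

/-- The effect on `1 + X L` of a new edge between `u` and `v`. -/
noncomputable def addEdge (M : Matrix V V ℤ[X]) (u v : V) : Matrix V V ℤ[X] :=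
  (M.updateRow u (M u + (X : ℤ[X]) • (unitRow u - unitRow v))).updateRow v
    (M v + (X : ℤ[X]) • (unitRow v - unitRow u))

/-- Make `w` a root: replace its row by a unit row. -/
noncomputable def root (M : Matrix V V ℤ[X]) (w : V) : Matrix V V ℤ[X] := M.updateRow w (unitRow w)

/-- The vertex `v` carries no edge and no extra weight. -/
structure IsIsolated (M : Matrix V V ℤ[X]) (v : V) : Prop where
  row : M v = unitRow v
  col : ∀ i, i ≠ v → M i v = 0

lemma addEdge_apply_left {M : Matrix V V ℤ[X]} {u v : V} (h : u ≠ v) :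
    addEdge M u v u = M u + (X : ℤ[X]) • (unitRow u - unitRow v) := by
  rw [addEdge, Matrix.updateRow_ne h, Matrix.updateRow_self]

lemma addEdge_apply_right {M : Matrix V V ℤ[X]} {u v : V} :
    addEdge M u v v = M v + (X : ℤ[X]) • (unitRow v - unitRow u) := by
  rw [addEdge, Matrix.updateRow_self]

lemma addEdge_apply_ne {M : Matrix V V ℤ[X]} {u v i : V} (hu : i ≠ u) (hv : i ≠ v) :
    addEdge M u v i = M i := by
  rw [addEdge, Matrix.updateRow_ne hv, Matrix.updateRow_ne hu]

lemma addEdge_comm {M : Matrix V V ℤ[X]} {u v : V} (h : u ≠ v) : addEdge M u v = addEdge M v u :=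
  Matrix.updateRow_comm _ h _ _

lemma root_comm (M : Matrix V V ℤ[X]) (u v : V) : root (root M u) v = root (root M v) u := by
  by_cases h : u = v
  · rw [h]
  · exact Matrix.updateRow_comm _ h _ _

lemma root_self (M : Matrix V V ℤ[X]) (u : V) : root M u u = unitRow u := Matrix.updateRow_self ..

lemma root_ne {M : Matrix V V ℤ[X]} {u i : V} (h : i ≠ u) : root M u i = M i :=
  Matrix.updateRow_ne h

lemma root_of_row_eq {M : Matrix V V ℤ[X]} {u : V} (h : M u = unitRow u) : root M u = M := by
  rw [root, ← h, Matrix.updateRow_eq_self]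

lemma root_addEdge_of_ne {M : Matrix V V ℤ[X]} {u v w : V} (hu : w ≠ u) (hv : w ≠ v) :
    root (addEdge M u v) w = addEdge (root M w) u v := by
  rw [root, addEdge, addEdge, Matrix.updateRow_comm _ hv.symm, Matrix.updateRow_comm _ hu.symm,
    root_ne hu.symm, root_ne hv.symm, root]

lemma IsIsolated.addEdge {M : Matrix V V ℤ[X]} {u v w : V} (h : IsIsolated M w) (hu : w ≠ u)
    (hv : w ≠ v) : IsIsolated (addEdge M u v) w := by
  refine ⟨by rw [addEdge_apply_ne hu hv, h.row], fun i hi => ?_⟩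
  by_cases h1 : i = v
  · subst h1
    simp [addEdge_apply_right, h.col i hi, unitRow_ne hv, unitRow_ne hu]
  · by_cases h2 : i = u
    · subst h2; simp [addEdge_apply_left h1, h.col i hi, unitRow_ne hv, unitRow_ne hu]
    · rw [addEdge_apply_ne h2 h1, h.col i hi]

lemma IsIsolated.root {M : Matrix V V ℤ[X]} {v w : V} (h : IsIsolated M v) (hw : v ≠ w) :
    IsIsolated (root M w) v := by
  refine ⟨by rw [root_ne hw, h.row], fun i hi => ?_⟩
  by_cases h1 : i = w
  · subst h1; rw [root_self, unitRow_ne hw]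
  · rw [root_ne h1, h.col i hi]

/-- All row sums are at least one. -/
def IsStrong [Fintype V] (M : Matrix V V ℤ[X]) : Prop := ∀ i, IsMRow i (M i - unitRow i)

variable [Fintype V]

lemma IsStrong.isMMatrix {M : Matrix V V ℤ[X]} (h : IsStrong M) : IsMMatrix M := by
  have key : ∀ i, IsMRow i (M i) := fun i => by
    have := (h i).add (.unitRow i)
    rwa [sub_add_cancel] at this
  exact ⟨fun i => (key i).1, fun i => (key i).2⟩

lemma IsStrong.root {M : Matrix V V ℤ[X]} (h : IsStrong M) (w : V) : IsStrong (root M w) := by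
  intro i
  by_cases hi : i = w
  · subst hi
    rw [root_self, sub_self]
    simpa using IsMRow.smul .zero (.unitRow i)
  · rw [root_ne hi]; exact h i

lemma IsStrong.addEdge {M : Matrix V V ℤ[X]} (h : IsStrong M) {u v : V} (huv : u ≠ v) :
    IsStrong (addEdge M u v) := by
  intro i
  by_cases h1 : i = v
  · subst h1
    rw [addEdge_apply_right, add_sub_right_comm]
    exact (h i).add (.smul .X .unitRow_sub)
  · by_cases h2 : i = u
    · subst h2
      rw [addEdge_apply_left h1, add_sub_right_comm]
      exact (h i).add (.smul .X .unitRow_sub)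
    · rw [addEdge_apply_ne h2 h1]; exact h i

lemma IsStrong.det_nonneg {M : Matrix V V ℤ[X]} (h : IsStrong M) : CoeffNonneg M.det :=
  h.isMMatrix.det_nonneg

/-- By linearity in row `w` the difference is the determinant with that row replaced by `M w - e_w`.
Row sums at least one are exactly what keeps this an M-matrix. -/
lemma IsStrong.det_sub_root {M : Matrix V V ℤ[X]} (h : IsStrong M) (w : V) :
    CoeffNonneg (M.det - (_root_.root M w).det) := by
  rw [← rowDet_self M w, _root_.root, ← rowDet_apply, ← map_sub]
  exact (h.isMMatrix.updateRow (h w)).det_nonneg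

lemma rowDet_unitRow (M : Matrix V V ℤ[X]) (w : V) : rowDet M w (unitRow w) = (root M w).det := rfl

lemma rowDet_unitRow_of_unit {M : Matrix V V ℤ[X]} {u v : V} (huv : u ≠ v)
    (hv : M v = unitRow v) : rowDet M u (unitRow v) = 0 := by
  rw [← hv, rowDet_eq_zero M huv.symm]

lemma IsIsolated.rowDet_eq_zero {M : Matrix V V ℤ[X]} {v : V} (h : IsIsolated M v)
    {r : V → ℤ[X]} (hr : r v = 0) : rowDet M v r = 0 := by
  refine Matrix.det_eq_zero_of_column_eq_zero v fun i => ?_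
  by_cases hi : i = v
  · subst hi; rw [Matrix.updateRow_self, hr]
  · rw [Matrix.updateRow_ne hi, h.col i hi]

/-- Merging `a` into `b` loses at most as much as making both roots. -/
lemma IsStrong.rowDet_sub_sub {M : Matrix V V ℤ[X]} (h : IsStrong M) {a b : V} (hab : a ≠ b) :
    CoeffNonneg ((_root_.root M a).det - rowDet M a (unitRow b) -
      (_root_.root (_root_.root M a) b).det) := by
  -- Both quantities are determinants with row `a` equal to `e_a - e_b`, differing only in row `b`;
  -- their difference has row `M b - e_b` there.
  have h1 : (_root_.root M a).det - rowDet M a (unitRow b) =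
      rowDet (M.updateRow a (unitRow a - unitRow b)) b (M b) := by
    rw [← rowDet_unitRow, ← map_sub, rowDet_updateRow _ hab, Matrix.updateRow_eq_self]
  have h2 : (_root_.root (_root_.root M a) b).det =
      rowDet (M.updateRow a (unitRow a - unitRow b)) b (unitRow b) := by
    rw [rowDet_updateRow _ hab, map_sub, rowDet_unitRow_of_unit hab (Matrix.updateRow_self ..),
      sub_zero, root_comm]
    rfl
  rw [h1, h2, ← map_sub]
  exact ((h.isMMatrix.updateRow .unitRow_sub).updateRow (h b)).det_nonneg

/-- Bilinearity in the rows `u` and `v`. There is no `X ^ 2` term because the two added rows are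
negatives of each other. -/
lemma det_addEdge (M : Matrix V V ℤ[X]) {u v : V} (h : u ≠ v) :
    (addEdge M u v).det = M.det + X * ((root M u).det - rowDet M u (unitRow v) +
      (root M v).det - rowDet M v (unitRow u)) := by
  have h1 : ∀ r s, rowDet (M.updateRow u r) v s = rowDet (M.updateRow v s) u r :=
    fun r s => rowDet_updateRow M h r s
  have h0 : rowDet (M.updateRow v (unitRow v - unitRow u)) u (unitRow u - unitRow v) = 0 := by
    have := rowDet_eq_zero (M.updateRow v (unitRow v - unitRow u)) h.symm
    rw [Matrix.updateRow_self] at this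
    rw [← neg_sub (unitRow v), map_neg, this, neg_zero]
  change rowDet (M.updateRow u (M u + (X : ℤ[X]) • (unitRow u - unitRow v))) v
    (M v + (X : ℤ[X]) • (unitRow v - unitRow u)) = _
  rw [map_add, map_smul, h1, h1, Matrix.updateRow_eq_self, map_add, rowDet_self, map_add,
    map_smul, map_smul, h0, ← h1, Matrix.updateRow_eq_self, map_sub, map_sub, ← rowDet_unitRow,
    ← rowDet_unitRow]
  simp only [smul_eq_mul]
  ring

/-- Attaching the isolated vertex `v` to `u`. -/
lemma det_addEdge_leaf {M : Matrix V V ℤ[X]} {u v : V} (h : u ≠ v) (hv : IsIsolated M v) :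
    (addEdge M u v).det = (1 + X) * M.det + X * (root M u).det := by
  rw [det_addEdge M h, rowDet_unitRow_of_unit h hv.row, hv.rowDet_eq_zero (unitRow_ne h.symm),
    root_of_row_eq hv.row]
  ring

/-- With `u` rooted, the new edge only adds weight `X` at `v`: the `e_u` part of row `v` contributes
nothing. -/
lemma det_root_addEdge (M : Matrix V V ℤ[X]) {u v : V} (h : u ≠ v) :
    (root (addEdge M u v) u).det = (root M u).det + X * (root (root M u) v).det := by
  have h1 : root (addEdge M u v) u =
      (root M u).updateRow v (M v + (X : ℤ[X]) • (unitRow v - unitRow u)) := by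
    rw [root, addEdge, ← Matrix.updateRow_comm _ h, Matrix.updateRow_idem, root]
  rw [h1, ← rowDet_apply, map_add, map_smul, map_sub,
    rowDet_unitRow_of_unit h.symm (root_self M u), ← root_ne (M := M) h.symm, rowDet_self,
    rowDet_unitRow, sub_zero, smul_eq_mul]

lemma det_root_addEdge_right (M : Matrix V V ℤ[X]) {u v : V} (h : u ≠ v) :
    (root (addEdge M u v) v).det = (root M v).det + X * (root (root M u) v).det := by
  rw [addEdge_comm h, det_root_addEdge M h.symm, root_comm]

lemma det_root_addEdge_leaf_left {M : Matrix V V ℤ[X]} {u v : V} (h : u ≠ v)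
    (hv : IsIsolated M v) : (root (addEdge M u v) u).det = (1 + X) * (root M u).det := by
  rw [det_root_addEdge M h, root_of_row_eq (hv.root h.symm).row]
  ring

lemma det_root_addEdge_leaf_right {M : Matrix V V ℤ[X]} {u v : V} (h : u ≠ v)
    (hv : IsIsolated M v) : (root (addEdge M u v) v).det = M.det + X * (root M u).det := by
  rw [det_root_addEdge_right M h, root_of_row_eq (hv.root h.symm).row, root_of_row_eq hv.row]

lemma det_root_addEdge_leaf_ne {M : Matrix V V ℤ[X]} {u v w : V} (h : u ≠ v) (hwu : w ≠ u)
    (hwv : w ≠ v) (hv : IsIsolated M v) :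
    (root (addEdge M u v) w).det = (1 + X) * (root M w).det + X * (root (root M w) u).det := by
  rw [root_addEdge_of_ne hwu hwv, det_addEdge_leaf h (hv.root hwv.symm)]

/-! ### Subdividing an edge once or twice, and subdividing with a leaf. -/

section Insert

variable {M : Matrix V V ℤ[X]} {a b v : V}

/-- Joining the isolated vertex `v` to both `a` and `b`. -/
noncomputable def insertVertex (M : Matrix V V ℤ[X]) (a v b : V) : Matrix V V ℤ[X] :=
  addEdge (addEdge M a v) v b

/-- The vertex `v` is connected to the rest only through `a`, so a cofactor between `v` and `b` is
one between `a` and `b`, times the weight `X` of the edge `av`. The next lemma is the transposed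
case. -/
lemma rowDet_addEdge_leaf_left (hv : IsIsolated M v) (ha : a ≠ v) (hb : b ≠ v) :
    rowDet (addEdge M a v) v (unitRow b) = X * rowDet M a (unitRow b) := by
  have h1 : rowDet (addEdge M a v) v (unitRow b) = rowDet (M.updateRow v (unitRow b)) a
      (M a + (X : ℤ[X]) • (unitRow a - unitRow v)) := by
    rw [← rowDet_updateRow _ ha, rowDet_apply, rowDet_apply, addEdge, Matrix.updateRow_idem]
  have h2 : rowDet (M.updateRow v (unitRow b)) a (unitRow a) = 0 := by
    rw [← rowDet_updateRow _ ha]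
    exact (hv.root ha.symm).rowDet_eq_zero (unitRow_ne hb.symm)
  have h3 : rowDet (M.updateRow v (unitRow b)) a (unitRow v) = - rowDet M a (unitRow b) := by
    rw [← rowDet_updateRow _ ha, rowDet_swap _ ha, rowDet_updateRow _ ha, ← hv.row,
      Matrix.updateRow_eq_self]
  have h4 : rowDet (M.updateRow v (unitRow b)) a (M a) = 0 := by
    rw [← rowDet_updateRow _ ha, Matrix.updateRow_eq_self]
    exact hv.rowDet_eq_zero (unitRow_ne hb.symm)
  rw [h1, map_add, map_smul, map_sub, h2, h3, h4, smul_eq_mul]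
  ring

lemma rowDet_addEdge_leaf_right (hv : IsIsolated M v) (ha : a ≠ v) (hb : b ≠ v) (hab : a ≠ b) :
    rowDet (addEdge M a v) b (unitRow v) = X * rowDet M b (unitRow a) := by
  set M' := M.updateRow a (M a + (X : ℤ[X]) • (unitRow a - unitRow v)) with hM'
  have e1 : M' v = unitRow v := by rw [hM', Matrix.updateRow_ne ha.symm, hv.row]
  have h1 : rowDet (addEdge M a v) b (unitRow v) = rowDet (M'.updateRow b (unitRow v)) v
      (unitRow v + (X : ℤ[X]) • (unitRow v - unitRow a)) := by
    rw [rowDet_updateRow _ hb, addEdge, hv.row]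
  have h2 : rowDet (M'.updateRow b (unitRow v)) v (unitRow v) = 0 := by
    have := rowDet_eq_zero (M'.updateRow b (unitRow v)) hb
    rwa [Matrix.updateRow_self] at this
  have h3 : rowDet (M'.updateRow b (unitRow v)) v (unitRow a) = - rowDet M b (unitRow a) := by
    rw [rowDet_swap _ hb, rowDet_updateRow _ hb, ← e1, Matrix.updateRow_eq_self, hM',
      rowDet_updateRow _ hab, map_add, map_smul, map_sub,
      rowDet_unitRow_of_unit ha (by rw [Matrix.updateRow_ne hb.symm, hv.row]),
      ← rowDet_updateRow _ hab, ← rowDet_updateRow _ hab, Matrix.updateRow_eq_self]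
    have := rowDet_eq_zero (M.updateRow a (unitRow a)) hab
    rw [Matrix.updateRow_self] at this
    rw [this]
    simp
  rw [h1, map_add, map_smul, map_sub, h2, h3, smul_eq_mul]
  ring

/-- Two applications of the edge formula. The cofactors between `a` and `b` enter with factor `-X ^
2`, whereas a direct edge `ab` has them with `-X`; this gain makes subdivision favourable. -/
lemma det_insertVertex (hv : IsIsolated M v) (ha : a ≠ v) (hb : b ≠ v) (hab : a ≠ b) :
    (insertVertex M a v b).det = (1 + 2 * X) * M.det +
      (X + X ^ 2) * ((root M a).det + (root M b).det) + X ^ 2 * (root (root M a) b).det -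
      X ^ 2 * (rowDet M a (unitRow b) + rowDet M b (unitRow a)) := by
  rw [insertVertex, det_addEdge _ hb.symm, rowDet_addEdge_leaf_left hv ha hb,
    rowDet_addEdge_leaf_right hv ha hb hab, det_addEdge_leaf ha hv,
    det_root_addEdge_leaf_right ha hv, det_root_addEdge_leaf_ne ha hab.symm hb hv, root_comm M b a]
  ring

lemma det_root_insertVertex (hv : IsIsolated M v) (ha : a ≠ v) (hb : b ≠ v) (hab : a ≠ b) :
    (root (insertVertex M a v b) v).det = M.det + X * ((root M a).det + (root M b).det) +
      X ^ 2 * (root (root M a) b).det := by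
  rw [insertVertex, det_root_addEdge _ hb.symm, root_comm (addEdge M a v) v b,
    root_addEdge_of_ne hab.symm hb, det_root_addEdge_leaf_right ha hv,
    det_root_addEdge_leaf_right ha (hv.root hb.symm), root_comm M b a]
  ring

/-- Subdividing an edge once. -/
lemma det_insertVertex_ge (hM : IsStrong M) (hv : IsIsolated M v) (ha : a ≠ v) (hb : b ≠ v)
    (hab : a ≠ b) :
    CoeffNonneg ((insertVertex M a v b).det - (1 + X) * (addEdge M a b).det -
      X * (root (addEdge M a b) a).det) := by
  have hN := hM.isMMatrix.rowDet_unitRow_nonneg b a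
  have hN' := hM.isMMatrix.rowDet_unitRow_nonneg a b
  -- The excess is exactly `X` times the loss from rooting `a` plus `X` times the two cofactors
  -- between `a` and `b`.
  refine ((CoeffNonneg.X.mul (hM.det_sub_root a)).add (.mul .X (hN.add hN'))).of_eq ?_
  rw [det_insertVertex hv ha hb hab, det_addEdge M hab, det_root_addEdge M hab]
  ring

lemma det_root_insertVertex_ge (hM : IsStrong M) (hv : IsIsolated M v) (ha : a ≠ v) (hb : b ≠ v)
    (hab : a ≠ b) :
    CoeffNonneg ((root (insertVertex M a v b) v).det -
      (1 + X) * (root (addEdge M a b) a).det) := by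
  have h1 := (hM.root b).det_sub_root a
  rw [root_comm] at h1
  refine ((hM.det_sub_root a).add (CoeffNonneg.X.mul h1)).of_eq ?_
  rw [det_root_insertVertex hv ha hb hab, det_root_addEdge M hab]
  ring

/-- Subdividing an edge twice. -/
lemma det_insertTwo_ge {w : V} (hM : IsStrong M) (hv : IsIsolated M v) (hw : IsIsolated M w)
    (ha : a ≠ v) (hb : b ≠ v) (hab : a ≠ b) (haw : a ≠ w) (hbw : b ≠ w) (hvw : v ≠ w) :
    CoeffNonneg ((insertVertex (addEdge M b w) a v w).det -
      (1 + 3 * X + X ^ 2) * (addEdge M a b).det -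
      X * (1 + 2 * X) * (root (addEdge M a b) a).det) := by
  have hN := hM.isMMatrix.rowDet_unitRow_nonneg b a
  have hN' := hM.isMMatrix.rowDet_unitRow_nonneg a b
  -- The path `a - v - w - b` is built by hanging `w` at `b` and inserting `v` between `a` and `w`,
  -- so the cofactors that occur are those between `a` and the leaf `w`.
  have e1 : rowDet (addEdge M b w) a (unitRow w) = X * rowDet M a (unitRow b) :=
    rowDet_addEdge_leaf_right hw hbw haw hab.symm
  have e2 : rowDet (addEdge M b w) w (unitRow a) = X * rowDet M b (unitRow a) :=
    rowDet_addEdge_leaf_left hw hbw haw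
  have e3 : (root (root (addEdge M b w) a) w).det =
      (root M a).det + X * (root (root M a) b).det := by
    rw [root_addEdge_of_ne hab haw, det_root_addEdge_leaf_right hbw (hw.root haw.symm)]
  have h2 : CoeffNonneg (X + 2 * X ^ 2 : ℤ[X]) := .add .X (.mul (.ofNat 2) (.pow .X 2))
  have h3 : CoeffNonneg (X + 3 * X ^ 2 : ℤ[X]) := .add .X (.mul (.ofNat 3) (.pow .X 2))
  refine ((h2.mul (hM.det_sub_root a)).add (h3.mul (hN.add hN'))).of_eq ?_
  rw [det_insertVertex (hv.addEdge hb.symm hvw) ha hvw.symm haw, det_addEdge M hab,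
    det_root_addEdge M hab, e1, e2, e3, det_addEdge_leaf hbw hw, det_root_addEdge_leaf_right hbw hw,
    det_root_addEdge_leaf_ne hbw hab haw hw]
  ring

lemma det_root_insertTwo_ge {w : V} (hM : IsStrong M) (hv : IsIsolated M v) (hw : IsIsolated M w)
    (ha : a ≠ v) (hb : b ≠ v) (hab : a ≠ b) (haw : a ≠ w) (hbw : b ≠ w) (hvw : v ≠ w) :
    CoeffNonneg ((root (insertVertex (addEdge M b w) a v w) v).det -
      (1 + 3 * X + X ^ 2) * (root (addEdge M a b) a).det) := by
  have e3 : (root (root (addEdge M b w) a) w).det =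
      (root M a).det + X * (root (root M a) b).det := by
    rw [root_addEdge_of_ne hab haw, det_root_addEdge_leaf_right hbw (hw.root haw.symm)]
  have h1 := (hM.root b).det_sub_root a
  have h2 := (hM.root a).det_sub_root b
  rw [root_comm] at h1
  have c1 : CoeffNonneg (1 + 2 * X : ℤ[X]) := .add .one (.mul (.ofNat 2) .X)
  have c2 : CoeffNonneg (X + X ^ 2 : ℤ[X]) := .add .X (.pow .X 2)
  refine ((c1.mul (hM.det_sub_root a)).add ((c2.mul h1).add
    ((CoeffNonneg.pow .X 2).mul h2))).of_eq ?_
  rw [det_root_insertVertex (hv.addEdge hb.symm hvw) ha hvw.symm haw, det_root_addEdge M hab, e3,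
    det_addEdge_leaf hbw hw, det_root_addEdge_leaf_right hbw hw,
    det_root_addEdge_leaf_ne hbw hab haw hw]
  ring

/-- Subdividing an edge and attaching a leaf to the new vertex, without the root term. -/
lemma det_insertLeafed_ge {w : V} (hM : IsStrong M) (hv : IsIsolated M v) (hw : IsIsolated M w)
    (ha : a ≠ v) (hb : b ≠ v) (hab : a ≠ b) (haw : a ≠ w) (hbw : b ≠ w) (hvw : v ≠ w) :
    CoeffNonneg ((addEdge (insertVertex M a v b) v w).det -
      (1 + 3 * X + X ^ 2) * (addEdge M a b).det) := by
  have hN := hM.isMMatrix.rowDet_unitRow_nonneg b a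
  have hN' := hM.isMMatrix.rowDet_unitRow_nonneg a b
  have c1 : CoeffNonneg (X + X ^ 2 : ℤ[X]) := .add .X (.pow .X 2)
  have c2 : CoeffNonneg (X ^ 2 + 2 * X ^ 3 : ℤ[X]) := .add (.pow .X 2) (.mul (.ofNat 2) (.pow .X 3))
  have c3 : CoeffNonneg (X + 2 * X ^ 2 : ℤ[X]) := .add .X (.mul (.ofNat 2) (.pow .X 2))
  refine ((c1.mul hM.det_nonneg).add ((c2.mul ((hM.root a).root b).det_nonneg).add
    (c3.mul (hN.add hN')))).of_eq ?_
  have hw' : IsIsolated (insertVertex M a v b) w :=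
    (hw.addEdge haw.symm hvw.symm).addEdge hvw.symm hbw.symm
  rw [det_addEdge_leaf hvw hw', det_insertVertex hv ha hb hab, det_root_insertVertex hv ha hb hab,
    det_addEdge M hab]
  ring

/-- The vertex `u` has a neighbour, in the form in which this is used. -/
def IsAttached (M : Matrix V V ℤ[X]) (u : V) : Prop :=
  CoeffNonneg ((1 + X) * (M.det - (root M u).det) - X * (root M u).det)

/-- For a first edge the defining expression equals `X ^ 2` times the loss from rooting the
neighbour. -/
lemma isAttached_addEdge_of_isIsolated {u y : V} (hM : IsStrong M) (hu : IsIsolated M u)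
    (huy : u ≠ y) : IsAttached (addEdge M u y) u := by
  refine ((CoeffNonneg.pow .X 2).mul (hM.det_sub_root y)).of_eq ?_
  rw [addEdge_comm huy, det_addEdge_leaf huy.symm hu, det_root_addEdge_leaf_right huy.symm hu]
  ring

/-- The increment splits into the two bounds of `IsStrong.rowDet_sub_sub`, one for each direction of
the edge, and a doubly rooted determinant. -/
lemma IsAttached.addEdge {u y : V} (h : IsAttached M u) (hM : IsStrong M) (huy : u ≠ y) :
    IsAttached (addEdge M u y) u := by
  have h1 := hM.rowDet_sub_sub huy
  have h2 := hM.rowDet_sub_sub huy.symm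
  have h3 := ((hM.root u).root y).det_nonneg
  rw [root_comm] at h2
  have c : CoeffNonneg (X * (1 + X) : ℤ[X]) := .mul .X (.add .one .X)
  refine (h.add ((c.mul (h1.add h2)).add (CoeffNonneg.X.mul h3))).of_eq ?_
  rw [det_addEdge M huy, det_root_addEdge M huy]
  ring

/-- Attachment of `a` before the edge `ab` is added pays for the additional root term, which
`det_insertLeafed_ge` has to do without. -/
lemma det_insertLeafed_ge_of_isAttached {w : V} (hM : IsStrong M) (hv : IsIsolated M v)
    (hw : IsIsolated M w) (ha : a ≠ v) (hb : b ≠ v) (hab : a ≠ b) (haw : a ≠ w) (hbw : b ≠ w)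
    (hvw : v ≠ w) (hat : IsAttached M a) :
    CoeffNonneg ((addEdge (insertVertex M a v b) v w).det -
      (1 + 3 * X + X ^ 2) * (addEdge M a b).det -
      X * (1 + 2 * X) * (root (addEdge M a b) a).det) := by
  have hN := hM.isMMatrix.rowDet_unitRow_nonneg b a
  have hN' := hM.isMMatrix.rowDet_unitRow_nonneg a b
  have c3 : CoeffNonneg (X + 2 * X ^ 2 : ℤ[X]) := .add .X (.mul (.ofNat 2) (.pow .X 2))
  refine ((CoeffNonneg.X.mul hat).add (c3.mul (hN.add hN'))).of_eq ?_
  have hw' : IsIsolated (insertVertex M a v b) w :=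
    (hw.addEdge haw.symm hvw.symm).addEdge hvw.symm hbw.symm
  rw [det_addEdge_leaf hvw hw', det_insertVertex hv ha hb hab, det_root_insertVertex hv ha hb hab,
    det_addEdge M hab, det_root_addEdge M hab]
  ring

/-- The excess is exactly the attachment expression of `a` plus `X` times the same expression with
`b` rooted. -/
lemma det_root_insertLeafed_ge {w : V} (hv : IsIsolated M v)
    (hw : IsIsolated M w) (ha : a ≠ v) (hb : b ≠ v) (hab : a ≠ b) (haw : a ≠ w) (hbw : b ≠ w)
    (hvw : v ≠ w) (hat : IsAttached M a) (hat' : IsAttached (root M b) a) :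
    CoeffNonneg ((root (addEdge (insertVertex M a v b) v w) v).det -
      (1 + 3 * X + X ^ 2) * (root (addEdge M a b) a).det) := by
  refine (hat.add (CoeffNonneg.X.mul hat')).of_eq ?_
  have hw' : IsIsolated (insertVertex M a v b) w :=
    (hw.addEdge haw.symm hvw.symm).addEdge hvw.symm hbw.symm
  rw [det_root_addEdge_leaf_left hvw hw', det_root_insertVertex hv ha hb hab,
    det_root_addEdge M hab, root_comm M b a]
  ring

end Insert

end EdgeCalculus

/-! ### Diagonal weights: deducing rooted inequalities from unrooted ones. -/

section Weight

variable {V : Type*}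

/-- Add the weight `k` to the diagonal entry at `w`. -/
noncomputable def addWeight (M : Matrix V V ℤ[X]) (w : V) (k : ℕ) : Matrix V V ℤ[X] :=
  M.updateRow w (M w + (k : ℤ[X]) • unitRow w)

lemma addWeight_self (M : Matrix V V ℤ[X]) (w : V) (k : ℕ) :
    addWeight M w k w = M w + (k : ℤ[X]) • unitRow w := Matrix.updateRow_self ..

lemma addWeight_ne {M : Matrix V V ℤ[X]} {w i : V} (k : ℕ) (h : i ≠ w) :
    addWeight M w k i = M i := Matrix.updateRow_ne h

lemma addEdge_addWeight (M : Matrix V V ℤ[X]) {u v : V} (h : u ≠ v) (w : V) (k : ℕ) :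
    addEdge (addWeight M w k) u v = addWeight (addEdge M u v) w k := by
  refine funext fun i => ?_
  by_cases hv : i = v
  · subst hv
    by_cases hw : i = w
    · subst hw
      rw [addEdge_apply_right, addWeight_self, addWeight_self, addEdge_apply_right, add_right_comm]
    · rw [addEdge_apply_right, addWeight_ne _ hw, addWeight_ne _ hw, addEdge_apply_right]
  · by_cases hu : i = u
    · subst hu
      by_cases hw : i = w
      · subst hw
        rw [addEdge_apply_left h, addWeight_self, addWeight_self, addEdge_apply_left h,
          add_right_comm]
      · rw [addEdge_apply_left h, addWeight_ne _ hw, addWeight_ne _ hw, addEdge_apply_left h]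
    · by_cases hw : i = w
      · subst hw
        rw [addEdge_apply_ne hu hv, addWeight_self, addWeight_self, addEdge_apply_ne hu hv]
      · rw [addEdge_apply_ne hu hv, addWeight_ne _ hw, addWeight_ne _ hw, addEdge_apply_ne hu hv]

lemma root_addWeight_of_ne (M : Matrix V V ℤ[X]) {u w : V} (h : u ≠ w) (k : ℕ) :
    root (addWeight M w k) u = addWeight (root M u) w k := by
  rw [root, addWeight, Matrix.updateRow_comm _ h.symm, addWeight, root_ne h.symm, root]

lemma root_root_addEdge {M : Matrix V V ℤ[X]} {u v : V} (h : u ≠ v) :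
    root (root (addEdge M u v) u) v = root (root M u) v := by
  rw [root, root, addEdge, Matrix.updateRow_comm _ h.symm, Matrix.updateRow_idem,
    Matrix.updateRow_idem]
  rfl

lemma IsIsolated.addWeight {M : Matrix V V ℤ[X]} {v w : V} (hv : IsIsolated M v) (h : v ≠ w)
    (k : ℕ) : IsIsolated (addWeight M w k) v := by
  refine ⟨by rw [addWeight_ne _ h, hv.row], fun i hi => ?_⟩
  by_cases hw : i = w
  · subst hw; simp [addWeight_self, hv.col i hi, unitRow_ne h]
  · rw [addWeight_ne _ hw, hv.col i hi]

variable [Fintype V]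

lemma IsStrong.addWeight {M : Matrix V V ℤ[X]} (hM : IsStrong M) (w : V) (k : ℕ) :
    IsStrong (addWeight M w k) := by
  intro i
  by_cases hw : i = w
  · subst hw
    rw [addWeight_self, add_sub_right_comm]
    exact (hM i).add (.smul (.natCast k) (.unitRow i))
  · rw [addWeight_ne _ hw]; exact hM i

/-- The determinant is affine in the weight, with the rooted determinant as slope. An inequality
valid for all weights therefore holds for the rooted determinants as well, by
`CoeffNonneg.of_forall_natCast`. -/
lemma det_addWeight (M : Matrix V V ℤ[X]) (w : V) (k : ℕ) :
    (addWeight M w k).det = M.det + k * (root M w).det := by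
  rw [addWeight, ← rowDet_apply, map_add, map_smul, rowDet_self, rowDet_unitRow, smul_eq_mul]

/-- The unrooted bound is applied with every weight `k` at `w`; its root term is nonnegative and is
dropped, and the slope in `k` is the claim. -/
lemma det_insertVertex_root_ge {M : Matrix V V ℤ[X]} {a b v w : V} (hM : IsStrong M)
    (hv : IsIsolated M v) (ha : a ≠ v) (hb : b ≠ v) (hab : a ≠ b) (hw : w ≠ v) :
    CoeffNonneg ((root (insertVertex M a v b) w).det -
      (1 + X) * (root (addEdge M a b) w).det) := by
  refine .of_forall_natCast (f := (insertVertex M a v b).det - (1 + X) * (addEdge M a b).det)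
    fun k => ?_
  have h1 := det_insertVertex_ge (hM.addWeight w k) (hv.addWeight hw.symm k) ha hb hab
  have h2 := (((hM.addWeight w k).addEdge hab).root a).det_nonneg
  refine (h1.add (CoeffNonneg.X.mul h2)).of_eq ?_
  simp only [insertVertex, addEdge_addWeight _ ha, addEdge_addWeight _ hb.symm,
    addEdge_addWeight _ hab, det_addWeight]
  ring

lemma det_insertTwo_root_ge {M : Matrix V V ℤ[X]} {a b v w z : V} (hM : IsStrong M)
    (hv : IsIsolated M v) (hw : IsIsolated M w)
    (ha : a ≠ v) (hb : b ≠ v) (hab : a ≠ b) (haw : a ≠ w) (hbw : b ≠ w) (hvw : v ≠ w)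
    (hzv : z ≠ v) (hzw : z ≠ w) :
    CoeffNonneg ((root (insertVertex (addEdge M b w) a v w) z).det -
      (1 + 3 * X + X ^ 2) * (root (addEdge M a b) z).det) := by
  refine .of_forall_natCast (f := (insertVertex (addEdge M b w) a v w).det -
    (1 + 3 * X + X ^ 2) * (addEdge M a b).det) fun k => ?_
  have h1 := det_insertTwo_ge (hM.addWeight z k) (hv.addWeight hzv.symm k)
    (hw.addWeight hzw.symm k) ha hb hab haw hbw hvw
  have h2 := (((hM.addWeight z k).addEdge hab).root a).det_nonneg
  have c : CoeffNonneg (X * (1 + 2 * X) : ℤ[X]) := .mul .X (.add .one (.mul (.ofNat 2) .X))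
  refine (h1.add (c.mul h2)).of_eq ?_
  simp only [insertVertex, addEdge_addWeight _ hbw, addEdge_addWeight _ ha,
    addEdge_addWeight _ hvw, addEdge_addWeight _ hab, det_addWeight]
  ring

lemma det_insertLeafed_root_ge {M : Matrix V V ℤ[X]} {a b v w z : V} (hM : IsStrong M)
    (hv : IsIsolated M v) (hw : IsIsolated M w)
    (ha : a ≠ v) (hb : b ≠ v) (hab : a ≠ b) (haw : a ≠ w) (hbw : b ≠ w) (hvw : v ≠ w)
    (hzv : z ≠ v) (hzw : z ≠ w) :
    CoeffNonneg ((root (addEdge (insertVertex M a v b) v w) z).det -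
      (1 + 3 * X + X ^ 2) * (root (addEdge M a b) z).det) := by
  refine .of_forall_natCast (f := (addEdge (insertVertex M a v b) v w).det -
    (1 + 3 * X + X ^ 2) * (addEdge M a b).det) fun k => ?_
  refine (det_insertLeafed_ge (hM.addWeight z k) (hv.addWeight hzv.symm k)
    (hw.addWeight hzw.symm k) ha hb hab haw hbw hvw).of_eq ?_
  simp only [insertVertex, addEdge_addWeight _ ha, addEdge_addWeight _ hb.symm,
    addEdge_addWeight _ hvw, addEdge_addWeight _ hab, det_addWeight]
  ring

/-- Attachment is linear in the two determinants involved, so the weight argument applies to it too.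
This is why attachment is proved below for weighted graph matrices. -/
lemma IsAttached.root_of_addWeight {M : Matrix V V ℤ[X]} {u w : V} (h : u ≠ w)
    (hat : ∀ k, IsAttached (addWeight M w k) u) : IsAttached (root M w) u := by
  refine .of_forall_natCast
    (f := (1 + X) * (M.det - (root M u).det) - X * (root M u).det) fun k => ?_
  refine (hat k).of_eq ?_
  rw [root_addWeight_of_ne _ h, det_addWeight, det_addWeight, root_comm M w u]
  ring

end Weight

/-! ### Graph matrices and lower bounds under graph operations. -/

section Graph

variable {V : Type*}

lemma sdiff_edge_sup_edge {H : SimpleGraph V} {u y : V} (h : H.Adj u y) :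
    (H \ SimpleGraph.edge u y) ⊔ SimpleGraph.edge u y = H := by
  refine sdiff_sup_cancel ?_
  rw [SimpleGraph.edge_le_iff]
  exact Or.inr h

variable [Fintype V]

/-- The matrix `1 + X L`, where `L` is the Laplacian of `H`. -/
noncomputable def graphMatrix (H : SimpleGraph V) : Matrix V V ℤ[X] := fun i =>
  unitRow i + (X : ℤ[X]) • ∑ j, (if H.Adj i j then unitRow i - unitRow j else 0)

lemma IsMRow.sum {v : V} {ι : Type*} (s : Finset ι) (f : ι → V → ℤ[X])
    (h : ∀ i ∈ s, IsMRow v (f i)) : IsMRow v (∑ i ∈ s, f i) := by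
  induction s using Finset.induction_on with
  | empty => simpa using IsMRow.smul .zero (.unitRow v)
  | insert a s ha ih =>
    rw [Finset.sum_insert ha]
    exact (h a (Finset.mem_insert_self a s)).add
      (ih fun i hi => h i (Finset.mem_insert_of_mem hi))

lemma isStrong_graphMatrix (H : SimpleGraph V) : IsStrong (graphMatrix H) := by
  intro i
  rw [graphMatrix, add_sub_cancel_left]
  refine .smul .X (.sum _ _ fun j _ => ?_)
  split_ifs
  · exact .unitRow_sub
  · simpa using IsMRow.smul .zero (.unitRow i)

/-- The vertex type stays fixed throughout: deleted or not yet attached vertices are isolated ones,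
invisible to the determinant. -/
lemma isIsolated_graphMatrix {H : SimpleGraph V} {v : V} (h : ∀ j, ¬ H.Adj v j) :
    IsIsolated (graphMatrix H) v := by
  refine ⟨by simp [graphMatrix, h], fun i hi => ?_⟩
  simp only [graphMatrix, Pi.add_apply, Pi.smul_apply, Finset.sum_apply]
  rw [unitRow_ne hi.symm, Finset.sum_eq_zero, smul_zero, add_zero]
  intro j _
  split_ifs with hj
  · have : j ≠ v := fun e => h i (e ▸ hj.symm)
    rw [Pi.sub_apply, unitRow_ne hi.symm, unitRow_ne this.symm, sub_zero]
  · rfl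

lemma graphMatrix_sup_edge {H : SimpleGraph V} {u v : V} (huv : u ≠ v) (h : ¬ H.Adj u v) :
    graphMatrix (H ⊔ SimpleGraph.edge u v) = addEdge (graphMatrix H) u v := by
  have h' : ¬ H.Adj v u := fun e => h e.symm
  refine funext fun i => ?_
  have key : ∀ t : V, i ≠ t → ¬ H.Adj i t → (∀ j, (H ⊔ SimpleGraph.edge u v).Adj i j ↔
      H.Adj i j ∨ j = t) → graphMatrix (H ⊔ SimpleGraph.edge u v) i =
        graphMatrix H i + (X : ℤ[X]) • (unitRow i - unitRow t) := by
    intro t hit hn ht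
    simp only [graphMatrix, ht]
    rw [add_assoc, ← smul_add]
    congr 2
    have : unitRow i - unitRow t = ∑ j, if j = t then unitRow i - unitRow j else 0 := by simp
    rw [this, ← Finset.sum_add_distrib]
    refine Finset.sum_congr rfl fun j _ => ?_
    by_cases hj : j = t
    · subst hj; simp [hn]
    · simp [hj]
  by_cases hv : i = v
  · subst hv
    rw [addEdge_apply_right]
    exact key u huv.symm h' fun j => by
      rw [SimpleGraph.sup_adj, SimpleGraph.edge_adj]; grind
  · by_cases hu : i = u
    · subst hu
      rw [addEdge_apply_left huv]
      exact key v huv h fun j => by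
        rw [SimpleGraph.sup_adj, SimpleGraph.edge_adj]; grind
    · rw [addEdge_apply_ne hu hv]
      simp only [graphMatrix, SimpleGraph.sup_adj, SimpleGraph.edge_adj, hu, hv, false_and,
        or_false]

/-- `det (1 + X L)`. -/
noncomputable def lapPoly (H : SimpleGraph V) : ℤ[X] := (graphMatrix H).det

/-- `det (1 + X L)` with the vertex `w` rooted. -/
noncomputable def rootPoly (H : SimpleGraph V) (w : V) : ℤ[X] := (root (graphMatrix H) w).det

/-- A vertex with a neighbour is attached, whatever the weight elsewhere. -/
lemma isAttached_addWeight {H : SimpleGraph V} {u y w : V} (h : H.Adj u y) (hw : u ≠ w) (k : ℕ) :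
    IsAttached (addWeight (graphMatrix H) w k) u := by
  induction hd : (Finset.univ.filter fun j => H.Adj u j).card using Nat.strong_induction_on
    generalizing H y with
  | _ d ih =>
  subst hd
  set H' := H \ SimpleGraph.edge u y with hH'
  have huy : u ≠ y := h.ne
  have hn : ¬ H'.Adj u y := by
    rw [hH', SimpleGraph.sdiff_adj, SimpleGraph.edge_adj]; grind
  have hle : ∀ j, H'.Adj u j → H.Adj u j := fun j hj => (SimpleGraph.sdiff_adj _ _ _ _ |>.1 hj).1
  -- One edge at `u` is split off. Either another one remains, and the degree has dropped, or `u`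
  -- has become isolated.
  rw [← sdiff_edge_sup_edge h, ← hH', graphMatrix_sup_edge huy hn,
    ← addEdge_addWeight _ huy]
  by_cases hex : ∃ z, H'.Adj u z
  · obtain ⟨z, hz⟩ := hex
    refine (ih _ (Finset.card_lt_card ⟨fun j hj => ?_, fun hsub => ?_⟩) hz rfl).addEdge
      ((isStrong_graphMatrix H').addWeight w k) huy
    · simp only [Finset.mem_filter, Finset.mem_univ, true_and] at hj ⊢
      exact hle j hj
    · have := hsub (Finset.mem_filter.2 ⟨Finset.mem_univ y, h⟩)
      simp [hn] at this
  · push Not at hex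
    exact isAttached_addEdge_of_isIsolated ((isStrong_graphMatrix H').addWeight w k)
      ((isIsolated_graphMatrix hex).addWeight hw k) huy

lemma isAttached_graphMatrix {H : SimpleGraph V} {u y : V} (h : H.Adj u y) :
    IsAttached (graphMatrix H) u := by
  have := isAttached_addWeight h h.ne 0
  rwa [addWeight, Nat.cast_zero, zero_smul, add_zero, Matrix.updateRow_eq_self] at this

lemma isAttached_root_graphMatrix {H : SimpleGraph V} {u y w : V} (h : H.Adj u y) (hw : u ≠ w) :
    IsAttached (root (graphMatrix H) w) u :=
  .root_of_addWeight hw fun k => isAttached_addWeight h hw k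

/-- `f` bounds `det (1 + X L)` from below, and `r` all its rooted versions. -/
structure Dominates (H : SimpleGraph V) (U : Finset V) (f r : ℤ[X]) : Prop where
  poly : CoeffNonneg (lapPoly H - f)
  rooted : ∀ w ∈ U, CoeffNonneg (rootPoly H w - r)

lemma coeffNonneg_one_add_X : CoeffNonneg (1 + X : ℤ[X]) := .add .one .X

lemma coeffNonneg_pathFactor : CoeffNonneg (1 + 3 * X + X ^ 2 : ℤ[X]) :=
  .add (.add .one (.mul (.ofNat 3) .X)) (.pow .X 2)

lemma coeffNonneg_pathRoot : CoeffNonneg (X * (1 + 2 * X) : ℤ[X]) :=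
  .mul .X (.add .one (.mul (.ofNat 2) .X))

/-- The bound on `lapPoly` is the exact recursion. For the rooted part, rooting the new leaf costs
less than rooting `u`, and rooting another vertex leaves a nonnegative doubly rooted term over. -/
lemma Dominates.leaf {H : SimpleGraph V} {U : Finset V} {f r : ℤ[X]} (hd : Dominates H U f r)
    {u v : V} (huv : u ≠ v) (hu : u ∈ U) (hv : ∀ j, ¬ H.Adj v j) :
    Dominates (H ⊔ SimpleGraph.edge u v) (insert v U) ((1 + X) * f + X * r) ((1 + X) * r) := by
  have hm := graphMatrix_sup_edge huv fun h => hv u h.symm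
  have hi := isIsolated_graphMatrix hv
  have hs := isStrong_graphMatrix H
  have hru := hd.rooted u hu
  rw [rootPoly] at hru
  constructor
  · refine ((coeffNonneg_one_add_X.mul hd.poly).add (CoeffNonneg.X.mul hru)).of_eq ?_
    rw [lapPoly, hm, det_addEdge_leaf huv hi, lapPoly]
    ring
  · intro w hw
    rw [rootPoly, hm]
    by_cases hwv : w = v
    · subst hwv
      rw [det_root_addEdge_leaf_right huv hi]
      exact ((hs.det_sub_root u).add (coeffNonneg_one_add_X.mul hru)).of_eq (by ring)
    · have hwU : w ∈ U := (Finset.mem_insert.1 hw).resolve_left hwv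
      by_cases hwu : w = u
      · subst hwu
        rw [det_root_addEdge_leaf_left huv hi]
        exact (coeffNonneg_one_add_X.mul hru).of_eq (by ring)
      · rw [det_root_addEdge_leaf_ne huv hwu hwv hi]
        have hrw := hd.rooted w hwU
        rw [rootPoly] at hrw
        exact ((coeffNonneg_one_add_X.mul hrw).add
          (CoeffNonneg.X.mul ((hs.root w).root u).det_nonneg)).of_eq (by ring)

/-- The neighbour `y` of `u` is needed for the root at the middle vertex `p`, where the excess is
the attachment expression of `u`. -/
lemma Dominates.pendentPath {H : SimpleGraph V} {U : Finset V} {f r : ℤ[X]}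
    (hd : Dominates H U f r) {u p v y : V} (hup : u ≠ p) (huv : u ≠ v) (hpv : p ≠ v) (hu : u ∈ U)
    (hp : ∀ j, ¬ H.Adj p j) (hv : ∀ j, ¬ H.Adj v j) (hy : H.Adj u y) :
    Dominates ((H ⊔ SimpleGraph.edge u p) ⊔ SimpleGraph.edge p v) (insert v (insert p U))
      ((1 + 3 * X + X ^ 2) * f + X * (1 + 2 * X) * r) ((1 + 3 * X + X ^ 2) * r) := by
  have hm1 := graphMatrix_sup_edge hup fun h => hp u h.symm
  have hm := graphMatrix_sup_edge (H := H ⊔ SimpleGraph.edge u p) hpv (by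
    rw [SimpleGraph.sup_adj, SimpleGraph.edge_adj]
    rintro (h | h)
    · exact hp v h
    · grind)
  have hip := isIsolated_graphMatrix hp
  have hiv := isIsolated_graphMatrix hv
  have hiv' : IsIsolated (graphMatrix (H ⊔ SimpleGraph.edge u p)) v := by
    rw [hm1]; exact hiv.addEdge huv.symm hpv.symm
  have hs := isStrong_graphMatrix H
  have hru := hd.rooted u hu
  rw [rootPoly] at hru
  have e1 := det_addEdge_leaf hup hip
  have e2 := det_root_addEdge_leaf_right hup hip
  constructor
  · refine ((coeffNonneg_pathFactor.mul hd.poly).add (coeffNonneg_pathRoot.mul hru)).of_eq ?_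
    rw [lapPoly, hm, det_addEdge_leaf hpv hiv', hm1, e1, e2, lapPoly]
    ring
  · intro w hw
    rw [rootPoly, hm]
    by_cases hwv : w = v
    · subst hwv
      rw [det_root_addEdge_leaf_right hpv hiv', hm1, e1, e2]
      have c : CoeffNonneg (1 + 2 * X : ℤ[X]) := .add .one (.mul (.ofNat 2) .X)
      exact ((c.mul (hs.det_sub_root u)).add (coeffNonneg_pathFactor.mul hru)).of_eq (by ring)
    by_cases hwp : w = p
    · subst hwp
      rw [det_root_addEdge_leaf_left hpv hiv', hm1, e2]
      exact ((isAttached_graphMatrix hy).add (coeffNonneg_pathFactor.mul hru)).of_eq (by ring)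
    · have hwU : w ∈ U := by
        have := Finset.mem_insert.1 hw
        exact (Finset.mem_insert.1 (this.resolve_left hwv)).resolve_left hwp
      rw [det_root_addEdge_leaf_ne hpv hwp hwv hiv', hm1]
      have hrw := hd.rooted w hwU
      rw [rootPoly] at hrw
      by_cases hwu : w = u
      · subst hwu
        rw [det_root_addEdge_leaf_left hup hip, root_root_addEdge hup,
          root_of_row_eq (hip.root hup.symm).row]
        exact (coeffNonneg_pathFactor.mul hrw).of_eq (by ring)
      · rw [root_addEdge_of_ne hwu hwp, det_addEdge_leaf hup (hip.root (Ne.symm hwp)),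
          det_root_addEdge_leaf_right hup (hip.root (Ne.symm hwp))]
        have c : CoeffNonneg (X * (1 + X) + X ^ 2 : ℤ[X]) :=
          .add (.mul .X coeffNonneg_one_add_X) (.pow .X 2)
        exact ((coeffNonneg_pathFactor.mul hrw).add
          (c.mul ((hs.root w).root u).det_nonneg)).of_eq (by ring)

/-- Subdividing an edge raises a profile at least as much as a new leaf does. -/
lemma Dominates.smooth {G : SimpleGraph V} {U : Finset V} {f r : ℤ[X]} {a b v : V}
    (hd : Dominates (G ⊔ SimpleGraph.edge a b) U f r) (hv : ∀ j, ¬ G.Adj v j)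
    (hG : ¬ G.Adj a b) (ha : a ≠ v) (hb : b ≠ v) (hab : a ≠ b) (haU : a ∈ U) :
    Dominates ((G ⊔ SimpleGraph.edge a v) ⊔ SimpleGraph.edge v b) (insert v U)
      ((1 + X) * f + X * r) ((1 + X) * r) := by
  have hi := isIsolated_graphMatrix hv
  have hs := isStrong_graphMatrix G
  have hm := graphMatrix_sup_edge hab hG
  have hm2 : graphMatrix ((G ⊔ SimpleGraph.edge a v) ⊔ SimpleGraph.edge v b) =
      insertVertex (graphMatrix G) a v b := by
    rw [insertVertex, ← graphMatrix_sup_edge ha fun h => hv a h.symm, graphMatrix_sup_edge hb.symm]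
    rw [SimpleGraph.sup_adj, SimpleGraph.edge_adj]
    rintro (h | h)
    · exact hv b h
    · grind
  have hP := hd.poly
  have hR := hd.rooted
  simp only [lapPoly, rootPoly, hm] at hP hR
  constructor
  · rw [lapPoly, hm2]
    exact ((det_insertVertex_ge hs hi ha hb hab).add ((coeffNonneg_one_add_X.mul hP).add
      (CoeffNonneg.X.mul (hR a haU)))).of_eq (by ring)
  · intro w hw
    rw [rootPoly, hm2]
    by_cases hwv : w = v
    · subst hwv
      exact ((det_root_insertVertex_ge hs hi ha hb hab).add
        (coeffNonneg_one_add_X.mul (hR a haU))).of_eq (by ring)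
    · exact ((det_insertVertex_root_ge hs hi ha hb hab hwv).add (coeffNonneg_one_add_X.mul
        (hR w ((Finset.mem_insert.1 hw).resolve_left hwv)))).of_eq (by ring)

/-- Subdividing an edge twice raises a profile at least as much as a new pendent path. -/
lemma Dominates.smoothTwo {G : SimpleGraph V} {U : Finset V} {f r : ℤ[X]} {a b v w : V}
    (hd : Dominates (G ⊔ SimpleGraph.edge a b) U f r) (hv : ∀ j, ¬ G.Adj v j)
    (hw : ∀ j, ¬ G.Adj w j) (hG : ¬ G.Adj a b) (ha : a ≠ v) (hb : b ≠ v) (hab : a ≠ b)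
    (haw : a ≠ w) (hbw : b ≠ w) (hvw : v ≠ w) (haU : a ∈ U) (hbU : b ∈ U) :
    Dominates (((G ⊔ SimpleGraph.edge b w) ⊔ SimpleGraph.edge a v) ⊔ SimpleGraph.edge v w)
      (insert v (insert w U))
      ((1 + 3 * X + X ^ 2) * f + X * (1 + 2 * X) * r) ((1 + 3 * X + X ^ 2) * r) := by
  have hiv := isIsolated_graphMatrix hv
  have hiw := isIsolated_graphMatrix hw
  have hs := isStrong_graphMatrix G
  have hm := graphMatrix_sup_edge hab hG
  have hm' := graphMatrix_sup_edge hab.symm fun h => hG h.symm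
  have hm2 : graphMatrix (((G ⊔ SimpleGraph.edge b w) ⊔ SimpleGraph.edge a v) ⊔
      SimpleGraph.edge v w) = insertVertex (addEdge (graphMatrix G) b w) a v w := by
    rw [insertVertex, ← graphMatrix_sup_edge hbw fun h => hw b h.symm,
      ← graphMatrix_sup_edge ha, graphMatrix_sup_edge hvw]
    all_goals
      simp only [SimpleGraph.sup_adj, SimpleGraph.edge_adj]
      have := hv w
      have := hv a
      have := G.adj_comm a v
      grind
  -- The same graph read from the other end: the rooted bound is available only at the vertex
  -- inserted last, and here this has to be `w`.
  have hm3 : graphMatrix (((G ⊔ SimpleGraph.edge b w) ⊔ SimpleGraph.edge a v) ⊔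
      SimpleGraph.edge v w) = insertVertex (addEdge (graphMatrix G) a v) b w v := by
    have : ((G ⊔ SimpleGraph.edge b w) ⊔ SimpleGraph.edge a v) ⊔ SimpleGraph.edge v w =
        ((G ⊔ SimpleGraph.edge a v) ⊔ SimpleGraph.edge b w) ⊔ SimpleGraph.edge w v := by
      rw [sup_right_comm G, SimpleGraph.edge_comm v w]
    rw [this, insertVertex, ← graphMatrix_sup_edge ha fun h => hv a h.symm,
      ← graphMatrix_sup_edge hbw, graphMatrix_sup_edge hvw.symm]
    all_goals
      simp only [SimpleGraph.sup_adj, SimpleGraph.edge_adj]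
      have := hw v
      have := hw b
      have := G.adj_comm b w
      grind
  have hP := hd.poly
  have hR := hd.rooted
  simp only [lapPoly, rootPoly, hm] at hP hR
  constructor
  · rw [lapPoly, hm2]
    exact ((det_insertTwo_ge hs hiv hiw ha hb hab haw hbw hvw).add
      ((coeffNonneg_pathFactor.mul hP).add (coeffNonneg_pathRoot.mul (hR a haU)))).of_eq (by ring)
  · intro z hz
    rw [rootPoly]
    by_cases hzv : z = v
    · subst hzv
      rw [hm2]
      exact ((det_root_insertTwo_ge hs hiv hiw ha hb hab haw hbw hvw).add
        (coeffNonneg_pathFactor.mul (hR a haU))).of_eq (by ring)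
    by_cases hzw : z = w
    · subst hzw
      rw [hm3]
      have hb' := hR b hbU
      rw [addEdge_comm hab] at hb'
      exact ((det_root_insertTwo_ge hs hiw hiv hbw haw hab.symm hb ha hvw.symm).add
        (coeffNonneg_pathFactor.mul hb')).of_eq (by ring)
    · rw [hm2]
      exact ((det_insertTwo_root_ge hs hiv hiw ha hb hab haw hbw hvw hzv hzw).add
        (coeffNonneg_pathFactor.mul (hR z (by simpa [hzv, hzw] using hz)))).of_eq (by ring)

/-- Subdividing an edge and hanging a leaf on the new vertex also raises a profile at least as much
as a pendent path, provided that `a` has a neighbour besides `b` and `v`. -/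
lemma Dominates.smoothLeafed {G : SimpleGraph V} {U : Finset V} {f r : ℤ[X]} {a b v w y : V}
    (hd : Dominates (G ⊔ SimpleGraph.edge a b) U f r) (hv : ∀ j, ¬ G.Adj v j)
    (hw : ∀ j, ¬ G.Adj w j) (hG : ¬ G.Adj a b) (ha : a ≠ v) (hb : b ≠ v) (hab : a ≠ b)
    (haw : a ≠ w) (hbw : b ≠ w) (hvw : v ≠ w) (haU : a ∈ U) (hy : G.Adj a y) :
    Dominates (((G ⊔ SimpleGraph.edge a v) ⊔ SimpleGraph.edge v b) ⊔ SimpleGraph.edge v w)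
      (insert v (insert w U))
      ((1 + 3 * X + X ^ 2) * f + X * (1 + 2 * X) * r) ((1 + 3 * X + X ^ 2) * r) := by
  have hiv := isIsolated_graphMatrix hv
  have hiw := isIsolated_graphMatrix hw
  have hs := isStrong_graphMatrix G
  have hm := graphMatrix_sup_edge hab hG
  have hm2 : graphMatrix (((G ⊔ SimpleGraph.edge a v) ⊔ SimpleGraph.edge v b) ⊔
      SimpleGraph.edge v w) = addEdge (insertVertex (graphMatrix G) a v b) v w := by
    rw [insertVertex, ← graphMatrix_sup_edge ha fun h => hv a h.symm,
      ← graphMatrix_sup_edge hb.symm, graphMatrix_sup_edge hvw]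
    all_goals
      simp only [SimpleGraph.sup_adj, SimpleGraph.edge_adj]
      have := hv w
      have := hv b
      grind
  have hiw' : IsIsolated (insertVertex (graphMatrix G) a v b) w :=
    (hiw.addEdge haw.symm hvw.symm).addEdge hvw.symm hbw.symm
  have hP := hd.poly
  have hR := hd.rooted
  simp only [lapPoly, rootPoly, hm] at hP hR
  have hrv : CoeffNonneg ((root (addEdge (insertVertex (graphMatrix G) a v b) v w) v).det -
      (1 + 3 * X + X ^ 2) * r) :=
    ((det_root_insertLeafed_ge hiv hiw ha hb hab haw hbw hvw (isAttached_graphMatrix hy)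
      (isAttached_root_graphMatrix hy hab)).add (coeffNonneg_pathFactor.mul (hR a haU))).of_eq
      (by ring)
  constructor
  · rw [lapPoly, hm2]
    exact ((det_insertLeafed_ge_of_isAttached hs hiv hiw ha hb hab haw hbw hvw
      (isAttached_graphMatrix hy)).add
      ((coeffNonneg_pathFactor.mul hP).add (coeffNonneg_pathRoot.mul (hR a haU)))).of_eq (by ring)
  · intro z hz
    rw [rootPoly, hm2]
    by_cases hzv : z = v
    · subst hzv
      exact hrv
    by_cases hzw : z = w
    · subst hzw
      rw [det_root_addEdge_leaf_left hvw hiw'] at hrv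
      rw [det_root_addEdge_leaf_right hvw hiw']
      have hs' : IsStrong (insertVertex (graphMatrix G) a v b) := (hs.addEdge ha).addEdge hb.symm
      exact ((hs'.det_sub_root v).add hrv).of_eq (by ring)
    · exact ((det_insertLeafed_root_ge hs hiv hiw ha hb hab haw hbw hvw hzv hzw).add
        (coeffNonneg_pathFactor.mul (hR z (by simpa [hzv, hzw] using hz)))).of_eq (by ring)

end Graph

/-! ### Four-cycles with leaves: exact polynomials. -/

section FourCycle

variable {V : Type*}

/-- The edges of `H` are those of the four-cycle `c 0, c 1, c 2, c 3`. -/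
def IsFourCycle (H : SimpleGraph V) (c : Fin 4 → V) : Prop :=
  ∀ x y, H.Adj x y ↔ ∃ i k, x = c i ∧ y = c k ∧ (SimpleGraph.cycleGraph 4).Adj i k

lemma IsFourCycle.not_adj {H : SimpleGraph V} {c : Fin 4 → V} (h : IsFourCycle H c) {v : V}
    (hv : ∀ k, v ≠ c k) (j : V) : ¬ H.Adj v j := fun hj => by
  obtain ⟨i, -, e, -⟩ := (h _ _).1 hj
  exact hv i e

/-- Attach the leaf `l k` to `c k` for each `k`. -/
noncomputable def attachLeaves (H : SimpleGraph V) (c l : Fin 4 → V) : SimpleGraph V :=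
  (((H ⊔ SimpleGraph.edge (c 0) (l 0)) ⊔ SimpleGraph.edge (c 1) (l 1)) ⊔
    SimpleGraph.edge (c 2) (l 2)) ⊔ SimpleGraph.edge (c 3) (l 3)

lemma attachLeaves_adj_leaf {H : SimpleGraph V} {c l : Fin 4 → V} (h : IsFourCycle H c)
    (hl : Function.Injective l) (hcl : ∀ i k, l i ≠ c k) (k : Fin 4) (j : V) : (attachLeaves H c l).Adj (l k) j ↔ j = c k := by
  have h1 : ∀ i, l k = l i ↔ k = i := fun i => hl.eq_iff
  simp only [attachLeaves, SimpleGraph.sup_adj, SimpleGraph.edge_adj, h.not_adj (hcl k), hcl k, h1]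
  have := hcl k
  fin_cases k <;> simp <;> grind

/-- Root all the vertices `c k` with `k ∈ S`. -/
noncomputable def rootAll {ι : Type*} (M : Matrix V V ℤ[X]) (c : ι → V) (S : Finset ι) :
    Matrix V V ℤ[X] :=
  fun i => if ∃ k ∈ S, i = c k then unitRow i else M i

lemma rootAll_empty {ι : Type*} (M : Matrix V V ℤ[X]) (c : ι → V) : rootAll M c ∅ = M := by
  funext i; simp [rootAll]

lemma rootAll_insert {ι : Type*} [DecidableEq ι] (M : Matrix V V ℤ[X]) (c : ι → V) (S : Finset ι)
    (k : ι) : rootAll M c (insert k S) = root (rootAll M c S) (c k) := by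
  funext i
  by_cases hi : i = c k
  · subst hi
    rw [root_self, rootAll, if_pos ⟨k, Finset.mem_insert_self .., rfl⟩]
  · rw [root_ne hi]
    simp [rootAll, hi]

lemma rootAll_singleton {ι : Type*} (M : Matrix V V ℤ[X]) (c : ι → V)
    (k : ι) : rootAll M c {k} = root M (c k) := by
  rw [← insert_empty_eq, rootAll_insert, rootAll_empty]

lemma rootAll_addEdge {ι : Type*} [DecidableEq ι] (M : Matrix V V ℤ[X]) (c : ι → V) (S : Finset ι)
    {u v : V} (hu : ∀ k ∈ S, u ≠ c k) (hv : ∀ k ∈ S, v ≠ c k) :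
    rootAll (addEdge M u v) c S = addEdge (rootAll M c S) u v := by
  induction S using Finset.induction_on with
  | empty => simp [rootAll_empty]
  | insert k S hk ih =>
    rw [rootAll_insert, rootAll_insert, ih (fun j hj => hu j (Finset.mem_insert_of_mem hj))
      (fun j hj => hv j (Finset.mem_insert_of_mem hj)),
      root_addEdge_of_ne (hu k (Finset.mem_insert_self ..)).symm
        (hv k (Finset.mem_insert_self ..)).symm]

lemma isIsolated_rootAll {ι : Type*} [DecidableEq ι] {M : Matrix V V ℤ[X]} (c : ι → V)
    (S : Finset ι) {v : V} (hv : ∀ k, v ≠ c k) (h : IsIsolated M v) :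
    IsIsolated (rootAll M c S) v := by
  induction S using Finset.induction_on with
  | empty => simpa [rootAll_empty] using h
  | insert k S hk ih =>
    rw [rootAll_insert]
    exact ih.root (hv k)

variable [Fintype V]

/-- The determinant of `1 + X L(H)` with the vertices `c k`, `k ∈ S`, rooted. -/
noncomputable def rootedPoly (H : SimpleGraph V) (c : Fin 4 → V) (S : Finset (Fin 4)) : ℤ[X] :=
  (rootAll (graphMatrix H) c S).det

lemma rootedPoly_empty (H : SimpleGraph V) (c : Fin 4 → V) : rootedPoly H c ∅ = lapPoly H := by
  rw [rootedPoly, rootAll_empty, lapPoly]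

lemma rootedPoly_singleton (H : SimpleGraph V) (c : Fin 4 → V) (k : Fin 4) :
    rootedPoly H c {k} = rootPoly H (c k) := by
  rw [rootedPoly, rootAll_singleton, rootPoly]

/-- The effect of a new leaf at `c k` on the rooted polynomials. -/
noncomputable def leafStep (k : Fin 4) (E : Finset (Fin 4) → ℤ[X]) (S : Finset (Fin 4)) : ℤ[X] :=
  if k ∈ S then (1 + X) * E S else (1 + X) * E S + X * E (insert k S)

/-- Rooting whole sets of cycle vertices makes the leaf recursion closed: a leaf at `c k` calls for
one more root, and nothing else. -/
lemma rootedPoly_leaf {H : SimpleGraph V} {c : Fin 4 → V} (hc : Function.Injective c) {k : Fin 4}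
    {v : V} (hvc : ∀ k, v ≠ c k) (hv : ∀ j, ¬ H.Adj v j) :
    rootedPoly (H ⊔ SimpleGraph.edge (c k) v) c = leafStep k (rootedPoly H c) := by
  have hi := isIsolated_graphMatrix hv
  have hm := graphMatrix_sup_edge (hvc k).symm fun h => hv (c k) h.symm
  have key : ∀ S, k ∉ S → rootAll (addEdge (graphMatrix H) (c k) v) c S =
      addEdge (rootAll (graphMatrix H) c S) (c k) v := fun S hk =>
    rootAll_addEdge _ _ _ (fun j hj e => hk (hc e ▸ hj)) fun j _ => hvc j
  funext S
  rw [leafStep]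
  split_ifs with hk
  · rw [rootedPoly, hm, ← Finset.insert_erase hk, rootAll_insert, key _ (Finset.notMem_erase k S),
      det_root_addEdge_leaf_left (hvc k).symm (isIsolated_rootAll c _ hvc hi), rootedPoly,
      ← rootAll_insert]
  · rw [rootedPoly, hm, key S hk,
      det_addEdge_leaf (hvc k).symm (isIsolated_rootAll c _ hvc hi), rootedPoly, rootedPoly,
      rootAll_insert]

/-- Unit rows outside the image of `c` make the matrix block triangular with an identity block. -/
lemma det_eq_det_submatrix {ι : Type*} [Fintype ι] [DecidableEq ι] {N : Matrix V V ℤ[X]}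
    {c : ι → V} (hc : Function.Injective c) (h : ∀ i, (∀ k, i ≠ c k) → N i = unitRow i) :
    N.det = (N.submatrix c c).det := by
  have h0 : ∀ i, ¬ (∃ k, c k = i) → N i = unitRow i := fun i hi =>
    h i fun k e => hi ⟨k, e.symm⟩
  rw [Matrix.twoBlockTriangular_det N (fun i => ∃ k, c k = i)]
  · have h1 : N.toSquareBlockProp (fun i => ¬ ∃ k, c k = i) = 1 := by
      ext ⟨i, hi⟩ ⟨j, hj⟩ : 2
      rw [Matrix.toSquareBlockProp_def]
      simp only [Matrix.of_apply, h0 i hi, Matrix.one_apply, unitRow, Pi.single_apply,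
        Subtype.mk.injEq]
      simp [eq_comm]
    let e : ι ≃ {i // ∃ k, c k = i} := Equiv.ofInjective c hc
    rw [h1, Matrix.det_one, mul_one, ← Matrix.det_submatrix_equiv_self e]
    rfl
  · intro i hi j hj
    rw [h0 i hi, unitRow_ne]
    rintro rfl
    exact hi hj

lemma cycleGraph_four_adj (i k : Fin 4) :
    (SimpleGraph.cycleGraph 4).Adj i k ↔ i = k + 1 ∨ k = i + 1 := by
  revert i k
  decide

/-- The rooted polynomials of the four-cycle. -/
noncomputable def fourCyclePoly (S : Finset (Fin 4)) : ℤ[X] :=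
  Matrix.det (Matrix.of fun i j : Fin 4 => if i ∈ S then (if i = j then 1 else 0) else
    if i = j then 1 + 2 * X else if i = j + 1 ∨ j = i + 1 then - X else (0 : ℤ[X]))

lemma rootedPoly_of_isFourCycle {H : SimpleGraph V} {c : Fin 4 → V} (hc : Function.Injective c)
    (h : IsFourCycle H c) : rootedPoly H c = fourCyclePoly := by
  funext S
  rw [rootedPoly, det_eq_det_submatrix hc, fourCyclePoly]
  · congr 1
    funext i j
    have hu : ∀ k, unitRow (c k) (c j) = if k = j then (1 : ℤ[X]) else 0 := by
      intro k
      by_cases hk : k = j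
      · subst hk; simp [unitRow_self]
      · rw [if_neg hk, unitRow_ne]; exact fun e => hk (hc e).symm
    rw [Matrix.submatrix_apply, rootAll]
    have hS : (∃ k ∈ S, c i = c k) ↔ i ∈ S :=
      ⟨fun ⟨k, hk, e⟩ => hc e ▸ hk, fun hi => ⟨i, hi, rfl⟩⟩
    rw [Matrix.of_apply]
    by_cases hi : i ∈ S
    · rw [if_pos (hS.2 hi), if_pos hi, hu]
    · rw [if_neg fun e => hi (hS.1 e), if_neg hi, graphMatrix]
      have h1 : ∑ y, (if H.Adj (c i) y then unitRow (c i) - unitRow y else 0) =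
          ∑ k : Fin 4, (if (SimpleGraph.cycleGraph 4).Adj i k then
            unitRow (c i) - unitRow (c k) else 0) := by
        have hinj : ∀ k, H.Adj (c i) (c k) ↔ (SimpleGraph.cycleGraph 4).Adj i k := fun k => by
          rw [h]
          constructor
          · rintro ⟨i', k', e1, e2, e3⟩
            rwa [hc e1, hc e2]
          · exact fun e => ⟨i, k, rfl, rfl, e⟩
        simp only [← hinj]
        rw [← Finset.sum_image (f := fun y => if H.Adj (c i) y then unitRow (c i) - unitRow y
          else 0) (g := c) (s := Finset.univ) (fun a _ b _ e => hc e)]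
        refine (Finset.sum_subset (Finset.subset_univ _) fun y _ hy => if_neg fun hadj => hy ?_).symm
        obtain ⟨i', k', e1, e2, e3⟩ := (h _ _).1 hadj
        exact Finset.mem_image.2 ⟨k', Finset.mem_univ _, e2.symm⟩
      rw [h1]
      simp only [Pi.add_apply, Pi.smul_apply, apply_ite (fun f : V → ℤ[X] =>
        f (c j)), Pi.sub_apply, hu, Pi.zero_apply, Fin.sum_univ_four, smul_eq_mul,
        cycleGraph_four_adj]
      fin_cases i <;> fin_cases j <;> simp <;> try ring
  · intro i hi
    rw [rootAll, if_neg (fun ⟨k, _, e⟩ => hi k e), graphMatrix]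
    have : ∀ y, ¬ H.Adj i y := fun y hy => by
      obtain ⟨i', k', e1, -⟩ := (h _ _).1 hy
      exact hi i' e1
    simp [this]

/-- Expansion over principal minors of the Laplacian on the unrooted vertices: `2` for a vertex, `3`
for an adjacent pair, `4` for an opposite pair, `4` for a triple and `0` for the whole cycle. -/
lemma fourCyclePoly_eq (S : Finset (Fin 4)) (t : Fin 4 → ℤ[X])
    (ht : ∀ i, t i = if i ∈ S then 0 else 1) :
    fourCyclePoly S = 1 + 2 * X * (t 0 + t 1 + t 2 + t 3) +
      X ^ 2 * (3 * (t 0 * t 1 + t 1 * t 2 + t 2 * t 3 + t 3 * t 0) + 4 * (t 0 * t 2 + t 1 * t 3)) +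
      4 * X ^ 3 * (t 0 * t 1 * t 2 + t 1 * t 2 * t 3 + t 2 * t 3 * t 0 + t 3 * t 0 * t 1) := by
  rw [fourCyclePoly, Matrix.det_succ_row_zero]
  simp only [Matrix.det_fin_three, Fin.sum_univ_four, Matrix.submatrix_apply, Matrix.of_apply, ht]
  by_cases h0 : 0 ∈ S <;> by_cases h1 : 1 ∈ S <;> by_cases h2 : 2 ∈ S <;> by_cases h3 : 3 ∈ S <;>
    simp [Fin.succAbove, h0, h1, h2, h3] <;> ring

/-- A leaf is at least as good a root as its neighbour. -/
lemma rootPoly_leaf_ge {H : SimpleGraph V} {u v : V} (h : ∀ j, H.Adj v j ↔ j = u) :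
    CoeffNonneg (rootPoly H v - rootPoly H u) := by
  have huv : H.Adj u v := ((h u).2 rfl).symm
  have hv : ∀ j, ¬ (H \ SimpleGraph.edge u v).Adj v j := fun j => by
    rw [SimpleGraph.sdiff_adj, SimpleGraph.edge_adj, h]
    rintro ⟨rfl, h2⟩
    exact h2 ⟨Or.inr ⟨rfl, rfl⟩, huv.ne.symm⟩
  rw [← sdiff_edge_sup_edge huv, rootPoly, rootPoly,
    graphMatrix_sup_edge huv.ne fun e => hv u e.symm,
    det_root_addEdge_leaf_right huv.ne (isIsolated_graphMatrix hv),
    det_root_addEdge_leaf_left huv.ne (isIsolated_graphMatrix hv)]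
  exact ((isStrong_graphMatrix _).det_sub_root u).of_eq (by ring)

/-- Lower bounds for `det (1 + X L)` and its rooted versions: the four-cycle. -/
noncomputable def cycleProfile : ℤ[X] × ℤ[X] :=
  (1 + 8 * X + 20 * X ^ 2 + 16 * X ^ 3, 1 + 6 * X + 10 * X ^ 2 + 4 * X ^ 3)

/-- The four-cycle with leaves at two adjacent vertices. -/
noncomputable def twoLeafProfile : ℤ[X] × ℤ[X] :=
  (1 + 12 * X + 52 * X ^ 2 + 100 * X ^ 3 + 83 * X ^ 4 + 24 * X ^ 5,
    1 + 9 * X + 28 * X ^ 2 + 37 * X ^ 3 + 21 * X ^ 4 + 4 * X ^ 5)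

/-- The four-cycle with leaves at all vertices. -/
noncomputable def fourLeafProfile : ℤ[X] × ℤ[X] :=
  (1 + 16 * X + 100 * X ^ 2 + 312 * X ^ 3 + 516 * X ^ 4 + 448 * X ^ 5 + 192 * X ^ 6 + 32 * X ^ 7,
    1 + 13 * X + 64 * X ^ 2 + 152 * X ^ 3 + 186 * X ^ 4 + 118 * X ^ 5 + 36 * X ^ 6 + 4 * X ^ 7)

lemma rootedPoly_cycle {H : SimpleGraph V} {c : Fin 4 → V} (hc : Function.Injective c)
    (h : IsFourCycle H c) :
    lapPoly H = cycleProfile.1 ∧ ∀ k, rootPoly H (c k) = cycleProfile.2 := by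
  refine ⟨?_, fun k => ?_⟩
  · rw [← rootedPoly_empty H c, rootedPoly_of_isFourCycle hc h, fourCyclePoly_eq _ _ fun _ => rfl,
      cycleProfile]
    simp
    ring
  · rw [← rootedPoly_singleton H c, rootedPoly_of_isFourCycle hc h,
      fourCyclePoly_eq _ _ fun _ => rfl, cycleProfile]
    fin_cases k <;> simp <;> ring

lemma dominates_cycle {H : SimpleGraph V} {c : Fin 4 → V} (hc : Function.Injective c)
    (h : IsFourCycle H c) :
    Dominates H (Finset.univ.image c) cycleProfile.1 cycleProfile.2 := by
  obtain ⟨h1, h2⟩ := rootedPoly_cycle hc h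
  constructor
  · rw [h1, sub_self]; exact .zero
  · intro w hw
    obtain ⟨k, -, rfl⟩ := Finset.mem_image.1 hw
    rw [h2, sub_self]; exact .zero

section TwoLeaf

variable {H : SimpleGraph V} {c : Fin 4 → V} {l₀ l₁ : V}

lemma rootedPoly_twoLeaf (hc : Function.Injective c) (h : IsFourCycle H c) (h0 : ∀ k, l₀ ≠ c k)
    (h1 : ∀ k, l₁ ≠ c k) (h01 : l₀ ≠ l₁) :
    rootedPoly ((H ⊔ SimpleGraph.edge (c 0) l₀) ⊔ SimpleGraph.edge (c 1) l₁) c =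
      leafStep 1 (leafStep 0 fourCyclePoly) := by
  rw [rootedPoly_leaf hc h1, rootedPoly_leaf hc h0 (h.not_adj h0), rootedPoly_of_isFourCycle hc h]
  intro j
  rw [SimpleGraph.sup_adj, SimpleGraph.edge_adj]
  rintro (e | ⟨e | e, -⟩)
  · exact h.not_adj h1 _ e
  · exact h1 _ e.1
  · exact h01 e.1.symm

lemma rootedPoly_twoLeaf_values (hc : Function.Injective c) (h : IsFourCycle H c)
    (h0 : ∀ k, l₀ ≠ c k) (h1 : ∀ k, l₁ ≠ c k) (h01 : l₀ ≠ l₁) :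
    lapPoly ((H ⊔ SimpleGraph.edge (c 0) l₀) ⊔ SimpleGraph.edge (c 1) l₁) = twoLeafProfile.1 ∧
    rootPoly ((H ⊔ SimpleGraph.edge (c 0) l₀) ⊔ SimpleGraph.edge (c 1) l₁) (c 0) =
      twoLeafProfile.2 ∧
    ∀ k, CoeffNonneg (rootPoly ((H ⊔ SimpleGraph.edge (c 0) l₀) ⊔ SimpleGraph.edge (c 1) l₁) (c k) -
      twoLeafProfile.2) := by
  simp only [← rootedPoly_empty _ c, ← rootedPoly_singleton, rootedPoly_twoLeaf hc h h0 h1 h01]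
  refine ⟨?_, ?_, fun k => ?_⟩
  · simp [leafStep, fourCyclePoly_eq _ _ fun _ => rfl, twoLeafProfile]
    ring
  · simp [leafStep, fourCyclePoly_eq _ _ fun _ => rfl, twoLeafProfile]
    ring
  -- The excess of the rooted polynomial at `c 2` and `c 3`, which carry no leaf, over the one at
  -- the leafed vertices.
  · have hd : CoeffNonneg (X + 6 * X ^ 2 + 10 * X ^ 3 + 4 * X ^ 4 : ℤ[X]) :=
      .add (.add (.add .X (.mul (.ofNat 6) (.pow .X 2))) (.mul (.ofNat 10) (.pow .X 3)))
        (.mul (.ofNat 4) (.pow .X 4))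
    fin_cases k
    · refine CoeffNonneg.zero.of_eq ?_
      simp [leafStep, fourCyclePoly_eq _ _ fun _ => rfl, twoLeafProfile]
      ring
    · refine CoeffNonneg.zero.of_eq ?_
      simp [leafStep, fourCyclePoly_eq _ _ fun _ => rfl, twoLeafProfile]
      ring
    all_goals
      refine hd.of_eq ?_
      simp [leafStep, fourCyclePoly_eq _ _ fun _ => rfl, twoLeafProfile]
      ring

lemma dominates_twoLeaf (hc : Function.Injective c) (h : IsFourCycle H c)
    (h0 : ∀ k, l₀ ≠ c k) (h1 : ∀ k, l₁ ≠ c k) (h01 : l₀ ≠ l₁) :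
    Dominates ((H ⊔ SimpleGraph.edge (c 0) l₀) ⊔ SimpleGraph.edge (c 1) l₁)
      (insert l₁ (insert l₀ (Finset.univ.image c))) twoLeafProfile.1 twoLeafProfile.2 := by
  obtain ⟨e1, -, e2⟩ := rootedPoly_twoLeaf_values hc h h0 h1 h01
  constructor
  · rw [e1, sub_self]; exact .zero
  · intro w hw
    simp only [Finset.mem_insert, Finset.mem_image, Finset.mem_univ, true_and] at hw
    rcases hw with rfl | rfl | ⟨k, rfl⟩
    · refine ((rootPoly_leaf_ge (u := c 1) fun j => ?_).add (e2 1)).of_eq (by ring)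
      simp only [SimpleGraph.sup_adj, SimpleGraph.edge_adj, h.not_adj h1]
      have := h0 1; have := h1 0; have := h1 1
      grind
    · refine ((rootPoly_leaf_ge (u := c 0) fun j => ?_).add (e2 0)).of_eq (by ring)
      simp only [SimpleGraph.sup_adj, SimpleGraph.edge_adj, h.not_adj h0]
      have := h0 1; have := h1 0; have := h0 0
      grind
    · exact e2 k

end TwoLeaf

section FourLeaf

variable {H : SimpleGraph V} {c l : Fin 4 → V}

lemma rootedPoly_fourLeaf (hc : Function.Injective c) (h : IsFourCycle H c)
    (hl : Function.Injective l) (hcl : ∀ i k, l i ≠ c k) :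
    rootedPoly (attachLeaves H c l) c =
      leafStep 3 (leafStep 2 (leafStep 1 (leafStep 0 fourCyclePoly))) := by
  have h1 : ∀ k i, l k = l i ↔ k = i := fun k i => hl.eq_iff
  rw [attachLeaves, rootedPoly_leaf hc (hcl 3), rootedPoly_leaf hc (hcl 2),
    rootedPoly_leaf hc (hcl 1), rootedPoly_leaf hc (hcl 0) (h.not_adj (hcl 0)),
    rootedPoly_of_isFourCycle hc h]
  all_goals
    intro j
    simp only [SimpleGraph.sup_adj, SimpleGraph.edge_adj, h.not_adj (hcl _), hcl _ _, h1]
    simp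

lemma rootedPoly_fourLeaf_values (hc : Function.Injective c) (h : IsFourCycle H c)
    (hl : Function.Injective l) (hcl : ∀ i k, l i ≠ c k) :
    lapPoly (attachLeaves H c l) = fourLeafProfile.1 ∧
    ∀ k, rootPoly (attachLeaves H c l) (c k) = fourLeafProfile.2 := by
  simp only [← rootedPoly_empty _ c, ← rootedPoly_singleton, rootedPoly_fourLeaf hc h hl hcl]
  refine ⟨?_, fun k => ?_⟩
  · simp [leafStep, fourCyclePoly_eq _ _ fun _ => rfl, fourLeafProfile]
    ring
  · fin_cases k <;> simp [leafStep, fourCyclePoly_eq _ _ fun _ => rfl, fourLeafProfile] <;> ring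

lemma dominates_fourLeaf (hc : Function.Injective c) (h : IsFourCycle H c)
    (hl : Function.Injective l) (hcl : ∀ i k, l i ≠ c k) :
    Dominates (attachLeaves H c l) (Finset.univ.image l ∪ Finset.univ.image c)
      fourLeafProfile.1 fourLeafProfile.2 := by
  obtain ⟨e1, e2⟩ := rootedPoly_fourLeaf_values hc h hl hcl
  constructor
  · rw [e1, sub_self]; exact .zero
  · intro w hw
    simp only [Finset.mem_union, Finset.mem_image, Finset.mem_univ, true_and] at hw
    rcases hw with ⟨k, rfl⟩ | ⟨k, rfl⟩
    · have := rootPoly_leaf_ge (attachLeaves_adj_leaf h hl hcl k)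
      rwa [e2 k] at this
    · rw [e2, sub_self]; exact .zero

end FourLeaf
end FourCycle

/-! ### Unicyclic graphs on vertex subsets, and the degree count. -/

section Reduction

variable {V : Type*}

/-- Delete all edges at `v`. -/
def removeVertex (H : SimpleGraph V) (v : V) : SimpleGraph V where
  Adj a b := H.Adj a b ∧ a ≠ v ∧ b ≠ v
  symm := ⟨fun _ _ h => ⟨h.1.symm, h.2.2, h.2.1⟩⟩
  loopless := ⟨fun _ h => h.1.ne rfl⟩

lemma removeVertex_adj {H : SimpleGraph V} {v a b : V} :
    (removeVertex H v).Adj a b ↔ H.Adj a b ∧ a ≠ v ∧ b ≠ v := Iff.rfl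

lemma not_removeVertex_adj {H : SimpleGraph V} {v : V} (j : V) : ¬ (removeVertex H v).Adj v j :=
  fun h => h.2.1 rfl

lemma removeVertex_sup_leaf {H : SimpleGraph V} {u v : V} (h : ∀ j, H.Adj v j ↔ j = u) :
    removeVertex H v ⊔ SimpleGraph.edge u v = H := by
  ext a b
  rw [SimpleGraph.sup_adj, removeVertex_adj, SimpleGraph.edge_adj]
  have h1 := h a
  have h2 := h b
  have h3 := H.adj_comm a b
  have h4 := h v
  have := H.irrefl (v := v)
  grind

lemma removeVertex_sup_two {H : SimpleGraph V} {a b v : V} (h : ∀ j, H.Adj v j ↔ j = a ∨ j = b) :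
    (removeVertex H v ⊔ SimpleGraph.edge a v) ⊔ SimpleGraph.edge v b = H := by
  ext x y
  rw [SimpleGraph.sup_adj, SimpleGraph.sup_adj, removeVertex_adj, SimpleGraph.edge_adj,
    SimpleGraph.edge_adj]
  have h1 := h x
  have h2 := h y
  have h3 := H.adj_comm x y
  have h4 := h v
  have := H.irrefl (v := v)
  grind

lemma ncard_edgeSet_sup_edge [Fintype V] {H : SimpleGraph V} {u v : V} (huv : u ≠ v)
    (h : ¬ H.Adj u v) :
    (H ⊔ SimpleGraph.edge u v).edgeSet.ncard = H.edgeSet.ncard + 1 := by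
  rw [SimpleGraph.edgeSet_sup, SimpleGraph.edgeSet_edge_of_ne huv, Set.union_singleton,
    Set.ncard_insert_of_notMem (by simpa using h)]

/-- `H` is a triangle-free unicyclic graph on the vertex set `U`, without edges elsewhere. -/
structure IsUnicyclicOn (H : SimpleGraph V) (U : Finset V) : Prop where
  supp : ∀ u v, H.Adj u v → u ∈ U
  cut : ∀ A ⊆ U, A.Nonempty → A ≠ U → ∃ a ∈ A, ∃ b, b ∉ A ∧ H.Adj a b
  edges : H.edgeSet.ncard = U.card
  tri : ∀ a b c, H.Adj a b → H.Adj b c → ¬ H.Adj a c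

variable {H : SimpleGraph V} {U : Finset V}

lemma IsUnicyclicOn.exists_adj (hH : IsUnicyclicOn H U) {u : V} (hu : u ∈ U) :
    ∃ y, H.Adj u y := by
  by_cases h : {u} = U
  · have h1 := hH.edges
    rw [← h, Finset.card_singleton] at h1
    obtain ⟨e, he⟩ := Set.ncard_eq_one.1 h1
    have : e ∈ H.edgeSet := he ▸ rfl
    induction e with
    | _ x y =>
      have hx := hH.supp x y this
      rw [← h, Finset.mem_singleton] at hx
      exact ⟨y, hx ▸ this⟩
  · obtain ⟨a, ha, b, -, hab⟩ := hH.cut {u} (by simpa using hu) ⟨u, by simp⟩ h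
    exact ⟨b, Finset.mem_singleton.1 ha ▸ hab⟩

variable [Fintype V]

/-- A cut of the smaller graph lifts to one of `H` by putting `v` on the same side as `u`; the
crossing edge then avoids `v`. -/
lemma IsUnicyclicOn.removeLeaf (hH : IsUnicyclicOn H U) {u v : V} (h : ∀ j, H.Adj v j ↔ j = u) :
    IsUnicyclicOn (removeVertex H v) (U.erase v) := by
  have hvu : H.Adj v u := (h u).2 rfl
  have hvU := hH.supp v u hvu
  refine ⟨fun x y hxy => Finset.mem_erase.2 ⟨hxy.2.1, hH.supp x y hxy.1⟩, fun A hA hne hAU => ?_,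
    ?_, fun a b c h1 h2 h3 => hH.tri a b c h1.1 h2.1 h3.1⟩
  · have hvA : v ∉ A := fun e => (Finset.mem_erase.1 (hA e)).1 rfl
    have hAU' : A ⊆ U := hA.trans (Finset.erase_subset _ _)
    by_cases hu : u ∈ A
    · obtain ⟨a, ha, b, hb, hab⟩ := hH.cut (insert v A) (Finset.insert_subset hvU hAU')
        (Finset.insert_nonempty _ _) (fun e => hAU (by rw [← e, Finset.erase_insert hvA]))
      rw [Finset.mem_insert, not_or] at hb
      rcases Finset.mem_insert.1 ha with rfl | ha
      · exact absurd ((h b).1 hab ▸ hu) hb.2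
      · exact ⟨a, ha, b, hb.2, hab, fun e => hvA (e ▸ ha), hb.1⟩
    · obtain ⟨a, ha, b, hb, hab⟩ := hH.cut A hAU' hne (fun e => hvA (e ▸ hvU))
      refine ⟨a, ha, b, hb, hab, fun e => hvA (e ▸ ha), fun e => hu ?_⟩
      subst e
      rwa [← (h a).1 hab.symm]
  · have := ncard_edgeSet_sup_edge (H := removeVertex H v) hvu.ne.symm
      fun e => not_removeVertex_adj _ e.symm
    rw [removeVertex_sup_leaf h, hH.edges] at this
    rw [Finset.card_erase_of_mem hvU]
    omega

/-- Triangle-freeness of `H` makes `ab` a genuinely new edge, so the edge count drops by one only;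
`hz` ensures that this edge closes no triangle. -/
lemma IsUnicyclicOn.smooth (hH : IsUnicyclicOn H U) {a b v : V}
    (h : ∀ j, H.Adj v j ↔ j = a ∨ j = b) (hab : a ≠ b)
    (hz : ∀ z, H.Adj z a → H.Adj z b → z = v) :
    IsUnicyclicOn (removeVertex H v ⊔ SimpleGraph.edge a b) (U.erase v) := by
  have hva : H.Adj v a := (h a).2 (Or.inl rfl)
  have hvb : H.Adj v b := (h b).2 (Or.inr rfl)
  have hvU := hH.supp v a hva
  have haU := hH.supp a v hva.symm
  have hbU := hH.supp b v hvb.symm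
  have nab : ¬ H.Adj a b := hH.tri a v b hva.symm hvb
  refine ⟨fun x y hxy => ?_, fun A hA hne hAU => ?_, ?_, fun p q r h1 h2 h3 => ?_⟩
  · rw [SimpleGraph.sup_adj, SimpleGraph.edge_adj] at hxy
    rcases hxy with hxy | ⟨⟨rfl, -⟩ | ⟨rfl, -⟩, -⟩
    · exact Finset.mem_erase.2 ⟨hxy.2.1, hH.supp x y hxy.1⟩
    · exact Finset.mem_erase.2 ⟨hva.ne.symm, haU⟩
    · exact Finset.mem_erase.2 ⟨hvb.ne.symm, hbU⟩
  · have hvA : v ∉ A := fun e => (Finset.mem_erase.1 (hA e)).1 rfl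
    have hAU' : A ⊆ U := hA.trans (Finset.erase_subset _ _)
    simp only [SimpleGraph.sup_adj, SimpleGraph.edge_adj, removeVertex_adj]
    by_cases ha : a ∈ A
    · obtain ⟨x, hx, y, hy, hxy⟩ := hH.cut (insert v A) (Finset.insert_subset hvU hAU')
        (Finset.insert_nonempty _ _) (fun e => hAU (by rw [← e, Finset.erase_insert hvA]))
      rw [Finset.mem_insert, not_or] at hy
      rcases Finset.mem_insert.1 hx with rfl | hx
      · rcases (h y).1 hxy with rfl | rfl
        · exact absurd ha hy.2
        · exact ⟨a, ha, y, hy.2, Or.inr ⟨Or.inl ⟨rfl, rfl⟩, hab⟩⟩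
      · exact ⟨x, hx, y, hy.2, Or.inl ⟨hxy, fun e => hvA (e ▸ hx), hy.1⟩⟩
    · obtain ⟨x, hx, y, hy, hxy⟩ := hH.cut A hAU' hne (fun e => hvA (e ▸ hvU))
      by_cases hyv : y = v
      · subst hyv
        rcases (h x).1 hxy.symm with rfl | rfl
        · exact absurd hx ha
        · exact ⟨x, hx, a, ha, Or.inr ⟨Or.inr ⟨rfl, rfl⟩, hab.symm⟩⟩
      · exact ⟨x, hx, y, hy, Or.inl ⟨hxy, fun e => hvA (e ▸ hx), hyv⟩⟩
  · have e1 := ncard_edgeSet_sup_edge (H := removeVertex H v) hab fun e => nab e.1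
    have e2 := ncard_edgeSet_sup_edge (H := removeVertex H v) hva.ne.symm
      fun e => not_removeVertex_adj _ e.symm
    have e3 := ncard_edgeSet_sup_edge (H := removeVertex H v ⊔ SimpleGraph.edge a v) hvb.ne (by
      rw [SimpleGraph.sup_adj, SimpleGraph.edge_adj]
      rintro (e | e)
      · exact not_removeVertex_adj _ e
      · grind)
    rw [removeVertex_sup_two h, hH.edges] at e3
    rw [Finset.card_erase_of_mem hvU]
    omega
  · rw [SimpleGraph.sup_adj, SimpleGraph.edge_adj, removeVertex_adj] at h1 h2 h3
    have t := hH.tri p q r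
    have z1 := hz p
    have z2 := hz q
    have z3 := hz r
    have s1 := H.adj_comm p q
    have s2 := H.adj_comm q r
    have s3 := H.adj_comm p r
    have i1 := H.irrefl (v := p)
    have i2 := H.irrefl (v := q)
    have i3 := H.irrefl (v := r)
    rcases h1 with h1 | ⟨h1, h1'⟩ <;> rcases h2 with h2 | ⟨h2, h2'⟩ <;>
      rcases h3 with h3 | ⟨h3, h3'⟩ <;> grind

/-- The neighbours of `v`. -/
noncomputable def nbrs (H : SimpleGraph V) (v : V) : Finset V := Finset.univ.filter (H.Adj v)

lemma mem_nbrs {v j : V} : j ∈ nbrs H v ↔ H.Adj v j := by simp [nbrs]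

lemma sum_card_nbrs (H : SimpleGraph V) : ∑ v, (nbrs H v).card = 2 * H.edgeSet.ncard := by
  have h1 := H.sum_degrees_eq_twice_card_edges
  rw [← SimpleGraph.coe_edgeFinset, Set.ncard_coe_finset, ← h1]
  refine Finset.sum_congr rfl fun v _ => ?_
  rw [← SimpleGraph.card_neighborFinset_eq_degree]
  congr 1
  ext j
  simp [nbrs]

lemma adj_iff_of_card_eq_one {v u : V} (h : (nbrs H v).card = 1) (hu : H.Adj v u) (j : V) :
    H.Adj v j ↔ j = u := by
  obtain ⟨w, hw⟩ := Finset.card_eq_one.1 h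
  rw [← mem_nbrs, hw, Finset.mem_singleton] at hu ⊢
  rw [hu]

lemma exists_adj_iff_of_card_eq_one {v : V} (h : (nbrs H v).card = 1) :
    ∃ u, ∀ j, H.Adj v j ↔ j = u := by
  obtain ⟨w, hw⟩ := Finset.card_eq_one.1 h
  exact ⟨w, fun j => by rw [← mem_nbrs, hw, Finset.mem_singleton]⟩

lemma card_nbrs_eq_one {v u : V} (h : ∀ j, H.Adj v j ↔ j = u) : (nbrs H v).card = 1 :=
  Finset.card_eq_one.2 ⟨u, by ext j; rw [mem_nbrs, h, Finset.mem_singleton]⟩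

/-- Two adjacent leaves would form the whole graph by connectedness, with two vertices but at most
one edge. -/
lemma IsUnicyclicOn.leaf_nbr (hH : IsUnicyclicOn H U) {v p : V} (hv : (nbrs H v).card = 1)
    (hvp : H.Adj v p) : (nbrs H p).card ≠ 1 := by
  intro hp
  have h1 := adj_iff_of_card_eq_one hv hvp
  have h2 := adj_iff_of_card_eq_one hp hvp.symm
  have hvU := hH.supp v p hvp
  have hpU := hH.supp p v hvp.symm
  have hU : {v, p} = U := by
    by_contra hne
    obtain ⟨a, ha, b, hb, hab⟩ := hH.cut {v, p} (by
      intro x hx; simp only [Finset.mem_insert, Finset.mem_singleton] at hx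
      rcases hx with rfl | rfl <;> assumption) ⟨v, by simp⟩ hne
    simp only [Finset.mem_insert, Finset.mem_singleton, not_or] at ha hb
    rcases ha with rfl | rfl
    · exact hb.2 ((h1 b).1 hab)
    · exact hb.1 ((h2 b).1 hab)
  have hE : H.edgeSet ⊆ {s(v, p)} := by
    intro e he
    induction e with
    | _ x y =>
      rw [SimpleGraph.mem_edgeSet] at he
      have hx := hH.supp x y he
      rw [← hU, Finset.mem_insert, Finset.mem_singleton] at hx
      rcases hx with rfl | rfl
      · rw [(h1 y).1 he]; rfl
      · rw [(h2 y).1 he]; exact Sym2.eq_swap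
  have h3 := Set.ncard_le_ncard hE
  rw [hH.edges, ← hU, Finset.card_pair hvp.ne, Set.ncard_singleton] at h3
  omega

/-- `mt` maps each vertex to its partner in a matching of `H`, or to itself. -/
structure IsMatchingMap (H : SimpleGraph V) (mt : V → V) : Prop where
  invol : ∀ v, mt (mt v) = v
  adj : ∀ v, mt v ≠ v → H.Adj v (mt v)

/-- If all leaves are matched and no leaf is adjacent to a vertex of degree two, then every vertex
is a leaf, or has degree two, or has degree three and is matched to a leaf. -/
lemma IsUnicyclicOn.degrees (hH : IsUnicyclicOn H U) {mt : V → V} (hm : IsMatchingMap H mt)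
    (hl : ∀ v, (nbrs H v).card = 1 → mt v ≠ v)
    (hp : ∀ v p, (nbrs H v).card = 1 → H.Adj v p → (nbrs H p).card ≠ 2) :
    ∀ v ∈ U, (nbrs H v).card = 1 ∨ ((nbrs H v).card = 2 ∧ (nbrs H (mt v)).card ≠ 1) ∨
      ((nbrs H v).card = 3 ∧ (nbrs H (mt v)).card = 1) := by
  have h0 : ∀ v, v ∉ U → (nbrs H v).card = 0 := fun v hv => by
    rw [Finset.card_eq_zero, Finset.eq_empty_iff_forall_notMem]
    exact fun j hj => hv (hH.supp v j (mem_nbrs.1 hj))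
  have hmt0 : ∀ v, v ∉ U → mt v = v := fun v hv => by
    by_contra h
    exact hv (hH.supp _ _ (hm.adj v h))
  have hpos : ∀ v ∈ U, (nbrs H v).card ≠ 0 := fun v hv h => by
    obtain ⟨y, hy⟩ := hH.exists_adj hv
    rw [Finset.card_eq_zero] at h
    have := mem_nbrs.2 hy
    simp [h] at this
  -- A discharge of `deg - 2`: every leaf receives one unit from its partner. The hypotheses make
  -- all values nonnegative, while their sum is zero because edges equal vertices and the partner
  -- map permutes the vertices. Hence every value is zero.
  set t : V → ℤ := fun v => (nbrs H v).card - 2 + (if (nbrs H v).card = 1 then 1 else 0) -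
    (if (nbrs H (mt v)).card = 1 then 1 else 0) with ht
  have hnn : ∀ v ∈ U, 0 ≤ t v := by
    intro v hv
    have hp1 := hpos v hv
    have hne : (nbrs H (mt v)).card = 1 → mt v ≠ v := fun h1 => by
      have := hl _ h1
      rw [hm.invol] at this
      exact this.symm
    by_cases h1 : (nbrs H v).card = 1
    · have h2 : (nbrs H (mt v)).card ≠ 1 := hH.leaf_nbr h1 (hm.adj v (hl v h1))
      simp [ht, h1, h2]
    · by_cases h2 : (nbrs H (mt v)).card = 1
      · have h3 := hp _ v h2 (hm.adj v (hne h2)).symm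
        simp only [ht, h1, h2, if_true, if_false]
        omega
      · simp only [ht, h1, h2, if_false]
        omega
  have hsum : ∑ v ∈ U, t v = 0 := by
    have e1 : ∑ v ∈ U, ((nbrs H v).card : ℤ) = 2 * U.card := by
      rw [Finset.sum_subset (Finset.subset_univ U) fun v _ hv => by simp [h0 v hv]]
      exact_mod_cast (sum_card_nbrs H).trans (by rw [hH.edges])
    have e2 : ∑ v ∈ U, (if (nbrs H (mt v)).card = 1 then (1 : ℤ) else 0) =
        ∑ v ∈ U, (if (nbrs H v).card = 1 then (1 : ℤ) else 0) := by
      rw [Finset.sum_subset (Finset.subset_univ U) fun v _ hv => by simp [hmt0 v hv, h0 v hv],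
        Finset.sum_subset (Finset.subset_univ U) fun v _ hv => by simp [h0 v hv]]
      exact Equiv.sum_comp (Function.Involutive.toPerm mt hm.invol)
        fun v => if (nbrs H v).card = 1 then (1 : ℤ) else 0
    simp only [ht, Finset.sum_sub_distrib, Finset.sum_add_distrib, e1, e2]
    simp
    ring
  intro v hv
  have h1 := (Finset.sum_eq_zero_iff_of_nonneg hnn).1 hsum v hv
  have hp1 := hpos v hv
  by_cases h2 : (nbrs H v).card = 1
  · exact Or.inl h2
  · by_cases h3 : (nbrs H (mt v)).card = 1
    · simp only [ht, h2, h3, if_true, if_false] at h1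
      exact Or.inr (Or.inr ⟨by omega, h3⟩)
    · simp only [ht, h2, h3, if_false] at h1
      exact Or.inr (Or.inl ⟨by omega, h3⟩)

end Reduction

/-! ### Profiles and their extension by leaves and paths. -/

section Profiles

/-- The effect of a new leaf on a profile. -/
noncomputable def addLeaf (p : ℤ[X] × ℤ[X]) : ℤ[X] × ℤ[X] :=
  ((1 + X) * p.1 + X * p.2, (1 + X) * p.2)

/-- The effect of a new pendent path of length two on a profile. -/
noncomputable def addPath (p : ℤ[X] × ℤ[X]) : ℤ[X] × ℤ[X] :=
  ((1 + 3 * X + X ^ 2) * p.1 + X * (1 + 2 * X) * p.2, (1 + 3 * X + X ^ 2) * p.2)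

lemma commute_addLeaf_addPath : Function.Commute addLeaf addPath := fun p => by
  simp only [addLeaf, addPath, Prod.mk.injEq]
  constructor <;> ring

lemma addPath_iterate_addLeaf (k : ℕ) (p : ℤ[X] × ℤ[X]) :
    addPath (addLeaf^[k] p) = addLeaf^[k] (addPath p) :=
  ((commute_addLeaf_addPath.iterate_left k) p).symm

variable {V : Type*} [Fintype V]

/-- `H` is bounded from below by one of the three extremal profiles. -/
def HasExtremalBound (H : SimpleGraph V) (U : Finset V) (m : ℕ) : Prop :=
  ∃ k, U.card = 2 * m + k ∧
    ∃ p, Dominates H U (addLeaf^[k] p).1 (addLeaf^[k] p).2 ∧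
      ((∃ j, m = j + 2 ∧ p = addPath^[j] cycleProfile) ∨
        (∃ j, m = j + 3 ∧ p = addPath^[j] twoLeafProfile) ∨
        ∃ j, m = j + 4 ∧ p = addPath^[j] fourLeafProfile)

variable {H H' : SimpleGraph V} {U U' : Finset V} {m : ℕ}

lemma HasExtremalBound.leaf (h : HasExtremalBound H' U' m) (hU : U.card = U'.card + 1)
    (hd : ∀ p, Dominates H' U' p.1 p.2 → Dominates H U (addLeaf p).1 (addLeaf p).2) :
    HasExtremalBound H U m := by
  obtain ⟨k, hk, p, hp, hj⟩ := h
  refine ⟨k + 1, by omega, p, ?_, hj⟩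
  rw [Function.iterate_succ_apply']
  exact hd _ hp

/-- A path added last can be moved inside all the leaves, since the two operations commute; this
keeps the profile in normal form. -/
lemma HasExtremalBound.path (h : HasExtremalBound H' U' m) (hU : U.card = U'.card + 2)
    (hd : ∀ p, Dominates H' U' p.1 p.2 → Dominates H U (addPath p).1 (addPath p).2) :
    HasExtremalBound H U (m + 1) := by
  obtain ⟨k, hk, p, hp, hj⟩ := h
  refine ⟨k, by omega, addPath p, ?_, ?_⟩
  · rw [← addPath_iterate_addLeaf]
    exact hd _ hp
  · rcases hj with ⟨j, hj, rfl⟩ | ⟨j, hj, rfl⟩ | ⟨j, hj, rfl⟩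
    · exact Or.inl ⟨j + 1, by omega, (Function.iterate_succ_apply' ..).symm⟩
    · exact Or.inr (Or.inl ⟨j + 1, by omega, (Function.iterate_succ_apply' ..).symm⟩)
    · exact Or.inr (Or.inr ⟨j + 1, by omega, (Function.iterate_succ_apply' ..).symm⟩)

end Profiles

/-! ### Four-cycles with at most one leaf per vertex. -/

section Sun

variable {V : Type*}

/-- The four-cycle on `c`. -/
def cycleOn (c : Fin 4 → V) : SimpleGraph V :=
  SimpleGraph.fromRel fun x y => ∃ i, x = c i ∧ y = c (i + 1)

lemma isFourCycle_cycleOn {c : Fin 4 → V} (hc : Function.Injective c) :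
    IsFourCycle (cycleOn c) c := fun x y => by
  rw [cycleOn, SimpleGraph.fromRel_adj]
  constructor
  · rintro ⟨-, ⟨i, h1, h2⟩ | ⟨i, h1, h2⟩⟩
    · exact ⟨i, i + 1, h1, h2, (cycleGraph_four_adj _ _).2 (Or.inr rfl)⟩
    · exact ⟨i + 1, i, h2, h1, (cycleGraph_four_adj _ _).2 (Or.inl rfl)⟩
  · rintro ⟨i, k, rfl, rfl, h⟩
    refine ⟨fun e => h.ne (hc e), ?_⟩
    rcases (cycleGraph_four_adj _ _).1 h with rfl | rfl
    · exact Or.inr ⟨k, rfl, rfl⟩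
    · exact Or.inl ⟨i, rfl, rfl⟩

/-- The four-cycle on `c` with the leaf `l i` attached to `c i` for `i ∈ S`. -/
noncomputable def sunGraph (c l : Fin 4 → V) (S : Finset (Fin 4)) : SimpleGraph V :=
  cycleOn c ⊔ ⨆ i ∈ S, SimpleGraph.edge (c i) (l i)

/-- The vertices of the sun graph. -/
noncomputable def sunVerts (c l : Fin 4 → V) (S : Finset (Fin 4)) : Finset V :=
  Finset.univ.image c ∪ S.image l

lemma sunGraph_insert (c l : Fin 4 → V) (S : Finset (Fin 4)) (k : Fin 4) :
    sunGraph c l (insert k S) = sunGraph c l S ⊔ SimpleGraph.edge (c k) (l k) := by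
  rw [sunGraph, sunGraph, Finset.iSup_insert, sup_assoc, sup_comm (SimpleGraph.edge _ _)]

lemma sunGraph_empty (c l : Fin 4 → V) : sunGraph c l ∅ = cycleOn c := by
  simp [sunGraph]

lemma sunVerts_insert (c l : Fin 4 → V) (S : Finset (Fin 4)) (k : Fin 4) :
    sunVerts c l (insert k S) = insert (l k) (sunVerts c l S) := by
  rw [sunVerts, sunVerts, Finset.image_insert, Finset.union_insert]

lemma sunVerts_empty (c l : Fin 4 → V) : sunVerts c l ∅ = Finset.univ.image c := by
  simp [sunVerts]

lemma mem_sunVerts {c l : Fin 4 → V} {S : Finset (Fin 4)} {x : V} :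
    x ∈ sunVerts c l S ↔ (∃ i, x = c i) ∨ ∃ i ∈ S, x = l i := by
  simp [sunVerts, eq_comm]

lemma sunGraph_adj {c l : Fin 4 → V} (hc : Function.Injective c) {S : Finset (Fin 4)} {x y : V} :
    (sunGraph c l S).Adj x y ↔
      (∃ i k, x = c i ∧ y = c k ∧ (SimpleGraph.cycleGraph 4).Adj i k) ∨
        ∃ i ∈ S, (x = c i ∧ y = l i ∨ x = l i ∧ y = c i) ∧ x ≠ y := by
  rw [sunGraph, SimpleGraph.sup_adj, isFourCycle_cycleOn hc]
  simp only [SimpleGraph.iSup_adj, SimpleGraph.edge_adj, exists_prop]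

lemma sunGraph_supp {c l : Fin 4 → V} (hc : Function.Injective c) {S : Finset (Fin 4)} {x y : V}
    (h : (sunGraph c l S).Adj x y) : x ∈ sunVerts c l S := by
  rw [mem_sunVerts]
  rcases (sunGraph_adj hc).1 h with ⟨i, k, h, -⟩ | ⟨i, hi, ⟨h, -⟩ | ⟨h, -⟩, -⟩
  · exact Or.inl ⟨i, h⟩
  · exact Or.inl ⟨i, h⟩
  · exact Or.inr ⟨i, hi, h⟩

lemma card_sunVerts {c l : Fin 4 → V} (hc : Function.Injective c) (hl : Function.Injective l)
    {S : Finset (Fin 4)} (hS : ∀ i ∈ S, ∀ k, l i ≠ c k) :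
    (sunVerts c l S).card = 4 + S.card := by
  rw [sunVerts, Finset.card_union_of_disjoint, Finset.card_image_of_injective _ hc,
    Finset.card_image_of_injective _ hl, Finset.card_univ, Fintype.card_fin]
  rw [Finset.disjoint_left]
  intro x hx hx'
  obtain ⟨i, -, rfl⟩ := Finset.mem_image.1 hx
  obtain ⟨k, hk, h⟩ := Finset.mem_image.1 hx'
  exact hS k hk i h

variable [Fintype V]

/-- Leaves beyond those in the base profile are counted only through the general leaf bound,
wherever on the cycle they are. -/
lemma dominates_sunGraph_union {c l : Fin 4 → V} (hc : Function.Injective c)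
    (hl : Function.Injective l) {S : Finset (Fin 4)} {p : ℤ[X] × ℤ[X]}
    (hd : Dominates (sunGraph c l S) (sunVerts c l S) p.1 p.2) (T : Finset (Fin 4))
    (hST : Disjoint S T) (hT : ∀ i ∈ T, ∀ k, l i ≠ c k) :
    Dominates (sunGraph c l (T ∪ S)) (sunVerts c l (T ∪ S)) (addLeaf^[T.card] p).1
      (addLeaf^[T.card] p).2 := by
  induction T using Finset.induction_on with
  | empty => simpa using hd
  | insert k T hk ih =>
    rw [Finset.disjoint_insert_right] at hST
    have := ih hST.2 fun i hi => hT i (Finset.mem_insert_of_mem hi)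
    rw [Finset.card_insert_of_notMem hk, Function.iterate_succ_apply', Finset.insert_union,
      sunGraph_insert, sunVerts_insert]
    refine this.leaf (hT k (Finset.mem_insert_self ..) k).symm (mem_sunVerts.2 (Or.inl ⟨k, rfl⟩))
      fun j hj => ?_
    rcases mem_sunVerts.1 (sunGraph_supp hc hj) with ⟨i, h⟩ | ⟨i, hi, h⟩
    · exact hT k (Finset.mem_insert_self ..) i h
    · rw [hl h] at hk hST
      rcases Finset.mem_union.1 hi with hi | hi
      · exact hk hi
      · exact hST.1 hi

lemma dominates_sunGraph_two {c l : Fin 4 → V} (hc : Function.Injective c)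
    (hl : Function.Injective l) {S : Finset (Fin 4)} (hS : ∀ i ∈ S, ∀ k, l i ≠ c k)
    (h0 : 0 ∈ S) (h1 : 1 ∈ S) :
    ∃ k, S.card = k + 2 ∧ Dominates (sunGraph c l S) (sunVerts c l S)
      (addLeaf^[k] twoLeafProfile).1 (addLeaf^[k] twoLeafProfile).2 := by
  have hd := dominates_twoLeaf hc (isFourCycle_cycleOn hc) (hS 0 h0) (hS 1 h1)
    (hl.ne (by decide))
  rw [← sunGraph_empty c l, ← sunGraph_insert, ← sunGraph_insert, ← sunVerts_empty c l,
    ← sunVerts_insert, ← sunVerts_insert] at hd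
  have hsub : insert 1 (insert 0 ∅) ⊆ S := by
    simp [Finset.insert_subset_iff, h0, h1]
  have := dominates_sunGraph_union hc hl hd (S \ insert 1 (insert 0 ∅)) Finset.disjoint_sdiff
    fun i hi => hS i (Finset.mem_sdiff.1 hi).1
  rw [Finset.sdiff_union_of_subset hsub] at this
  refine ⟨_, ?_, this⟩
  have h2 := Finset.card_sdiff_add_card_eq_card hsub
  rw [← h2]
  rfl

lemma dominates_sunGraph_univ {c l : Fin 4 → V} (hc : Function.Injective c)
    (hl : Function.Injective l) (hS : ∀ i k, l i ≠ c k) :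
    Dominates (sunGraph c l Finset.univ) (sunVerts c l Finset.univ)
      fourLeafProfile.1 fourLeafProfile.2 := by
  have hd := dominates_fourLeaf hc (isFourCycle_cycleOn hc) hl hS
  rw [attachLeaves, ← sunGraph_empty c l, ← sunGraph_insert, ← sunGraph_insert, ← sunGraph_insert,
    ← sunGraph_insert] at hd
  have hu : (insert 3 (insert 2 (insert 1 (insert 0 ∅))) : Finset (Fin 4)) = Finset.univ := by
    decide
  rw [hu] at hd
  rwa [sunVerts, Finset.union_comm]

/-- Every vertex is a leaf, or has degree two, or has degree three and is matched to a leaf. -/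
def IsSunLike (H : SimpleGraph V) (U : Finset V) (mt : V → V) : Prop :=
  ∀ v ∈ U, (nbrs H v).card = 1 ∨ ((nbrs H v).card = 2 ∧ (nbrs H (mt v)).card ≠ 1) ∨
      ((nbrs H v).card = 3 ∧ (nbrs H (mt v)).card = 1)

/-- A sun-like unicyclic graph with a four-cycle is a sun. -/
lemma IsUnicyclicOn.eq_sunGraph {H : SimpleGraph V} {U : Finset V} (hH : IsUnicyclicOn H U)
    {mt : V → V} (hm : IsMatchingMap H mt) (hs : IsSunLike H U mt) {c : Fin 4 → V}
    (hc : Function.Injective c) (hadj : ∀ i, H.Adj (c i) (c (i + 1))) :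
    ∃ S : Finset (Fin 4), (∀ i ∈ S, ∀ k, mt (c i) ≠ c k) ∧ H = sunGraph c (mt ∘ c) S ∧
      U = sunVerts c (mt ∘ c) S ∧
        ∀ i, i ∉ S → ∀ y, H.Adj (c i) y → y = c (i + 1) ∨ y = c (i - 1) := by
  have hadj' : ∀ i, H.Adj (c i) (c (i - 1)) := fun i => by
    have := hadj (i - 1)
    rw [sub_add_cancel] at this
    exact this.symm
  have hne : ∀ i : Fin 4, i + 1 ≠ i - 1 := by decide
  have hpair : ∀ i, ({c (i + 1), c (i - 1)} : Finset V) ⊆ nbrs H (c i) := fun i => by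
    simp [Finset.insert_subset_iff, mem_nbrs, hadj, hadj']
  have hcard : ∀ i, ({c (i + 1), c (i - 1)} : Finset V).card = 2 := fun i =>
    Finset.card_pair (hc.ne (hne i))
  have hdeg : ∀ i, 2 ≤ (nbrs H (c i)).card := fun i => by
    rw [← hcard i]; exact Finset.card_le_card (hpair i)
  have hcU : ∀ i, c i ∈ U := fun i => hH.supp _ _ (hadj i)
  set S : Finset (Fin 4) := Finset.univ.filter fun i => (nbrs H (mt (c i))).card = 1 with hS
  have hSmem : ∀ i, i ∈ S ↔ (nbrs H (mt (c i))).card = 1 := fun i => by simp [hS]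
  have hlc : ∀ i ∈ S, ∀ k, mt (c i) ≠ c k := fun i hi k e => by
    rw [hSmem, e] at hi
    have := hdeg k
    omega
  have hla : ∀ i ∈ S, H.Adj (c i) (mt (c i)) := fun i hi => hm.adj _ (hlc i hi i)
  have hleaf : ∀ i ∈ S, ∀ y, H.Adj (mt (c i)) y ↔ y = c i := fun i hi =>
    adj_iff_of_card_eq_one ((hSmem i).1 hi) (hla i hi).symm
  have hout : ∀ i, i ∉ S → ∀ y, H.Adj (c i) y → y = c (i + 1) ∨ y = c (i - 1) := fun i hi y hy => by
    rw [hSmem] at hi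
    have h2 : (nbrs H (c i)).card = 2 := by
      have := hdeg i
      rcases hs _ (hcU i) with h | h | h <;> omega
    have := Finset.eq_of_subset_of_card_le (hpair i) (by rw [hcard, h2])
    rw [← mem_nbrs, ← this] at hy
    simpa using hy
  have hin : ∀ i ∈ S, ∀ y, H.Adj (c i) y → y = c (i + 1) ∨ y = c (i - 1) ∨ y = mt (c i) :=
    fun i hi y hy => by
    have h3 : (nbrs H (c i)).card = 3 := by
      have := hdeg i
      have := (hSmem i).1 hi
      rcases hs _ (hcU i) with h | h | h <;> omega
    have hsub : insert (mt (c i)) ({c (i + 1), c (i - 1)} : Finset V) ⊆ nbrs H (c i) :=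
      Finset.insert_subset (mem_nbrs.2 (hla i hi)) (hpair i)
    have := Finset.eq_of_subset_of_card_le hsub (by
      rw [Finset.card_insert_of_notMem (by simp [hlc i hi]), hcard, h3])
    rw [← mem_nbrs, ← this] at hy
    simp only [Finset.mem_insert, Finset.mem_singleton] at hy
    tauto
  -- The degree conditions close the sun's vertex set under adjacency, so by connectedness it is
  -- everything.
  have hA : sunVerts c (mt ∘ c) S = U := by
    by_contra hne
    obtain ⟨a, ha, b, hb, hab⟩ := hH.cut (sunVerts c (mt ∘ c) S) (fun x hx => by
      rcases mem_sunVerts.1 hx with ⟨i, rfl⟩ | ⟨i, hi, rfl⟩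
      · exact hcU i
      · exact hH.supp _ _ (hla i hi).symm) ⟨c 0, mem_sunVerts.2 (Or.inl ⟨0, rfl⟩)⟩ hne
    apply hb
    rw [mem_sunVerts]
    rcases mem_sunVerts.1 ha with ⟨i, rfl⟩ | ⟨i, hi, rfl⟩
    · by_cases hi : i ∈ S
      · rcases hin i hi b hab with h | h | h
        · exact Or.inl ⟨_, h⟩
        · exact Or.inl ⟨_, h⟩
        · exact Or.inr ⟨i, hi, h⟩
      · rcases hout i hi b hab with h | h
        · exact Or.inl ⟨_, h⟩
        · exact Or.inl ⟨_, h⟩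
    · exact Or.inl ⟨i, (hleaf i hi b).1 hab⟩
  refine ⟨S, hlc, ?_, hA.symm, hout⟩
  ext x y
  rw [sunGraph_adj hc]
  constructor
  · intro hxy
    have hx := hH.supp x y hxy
    rw [← hA, mem_sunVerts] at hx
    rcases hx with ⟨i, rfl⟩ | ⟨i, hi, rfl⟩
    · have : (y = c (i + 1) ∨ y = c (i - 1)) ∨ (i ∈ S ∧ y = mt (c i)) := by
        by_cases hi : i ∈ S
        · have := hin i hi y hxy
          tauto
        · exact Or.inl (hout i hi y hxy)
      rcases this with (h | h) | ⟨hi, h⟩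
      · exact Or.inl ⟨i, _, rfl, h, (cycleGraph_four_adj _ _).2 (Or.inr rfl)⟩
      · exact Or.inl ⟨i, _, rfl, h, (cycleGraph_four_adj _ _).2 (Or.inl (sub_add_cancel i 1).symm)⟩
      · exact Or.inr ⟨i, hi, Or.inl ⟨rfl, h⟩, hxy.ne⟩
    · exact Or.inr ⟨i, hi, Or.inr ⟨rfl, (hleaf i hi y).1 hxy⟩, hxy.ne⟩
  · rintro (⟨i, k, rfl, rfl, h⟩ | ⟨i, hi, ⟨rfl, rfl⟩ | ⟨rfl, rfl⟩, -⟩)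
    · rcases (cycleGraph_four_adj _ _).1 h with rfl | rfl
      · exact (hadj k).symm
      · exact hadj i
    · exact hla i hi
    · exact (hla i hi).symm

lemma exists_adjacent_or_opposite : ∀ S : Finset (Fin 4), 2 ≤ S.card →
    (∃ i, i ∈ S ∧ i + 1 ∈ S) ∨ ∃ i, i ∉ S ∧ i + 1 ∈ S ∧ i - 1 ∈ S ∧ S.card = 2 := by
  decide

/-- The sun has at most eight vertices and must contain `2 * m` matched ones, so `m` is `3` or `4`.
For `m = 4` all cycle vertices carry leaves. For `m = 3` at least two do, and two adjacent ones must
exist. -/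
lemma IsUnicyclicOn.hasExtremalBound_of_fourCycle {H : SimpleGraph V} {U : Finset V}
    (hH : IsUnicyclicOn H U)
    {mt : V → V} (hm : IsMatchingMap H mt) (hs : IsSunLike H U mt) {c : Fin 4 → V}
    (hc : Function.Injective c) (hadj : ∀ i, H.Adj (c i) (c (i + 1))) {m : ℕ}
    (hcard : (Finset.univ.filter fun v => mt v ≠ v).card = 2 * m) (h3 : 3 ≤ m) :
    HasExtremalBound H U m := by
  have hmi : Function.Injective mt := (show Function.Involutive mt from hm.invol).injective
  obtain ⟨S, hlc, hHS, hUS, hout⟩ := hH.eq_sunGraph hm hs hc hadj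
  have hU := card_sunVerts hc (hmi.comp hc) hlc
  rw [← hUS] at hU
  have hsub : (Finset.univ.filter fun v => mt v ≠ v) ⊆ U := fun v hv =>
    hH.supp _ _ (hm.adj v (Finset.mem_filter.1 hv).2)
  have hle := Finset.card_le_card hsub
  have hS4 := Finset.card_le_univ S
  rw [Fintype.card_fin] at hS4
  obtain rfl | rfl : m = 3 ∨ m = 4 := by omega
  · have hpair : ∃ i, i ∈ S ∧ i + 1 ∈ S := by
      rcases exists_adjacent_or_opposite S (by omega) with h | ⟨i, hi, h1, h2, h3⟩
      · exact h
      · exfalso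
        -- With leaves at just two opposite vertices the six vertices would all be matched, but the
        -- neighbours of a leafless cycle vertex already have leaves as partners.
        have hall := Finset.eq_of_subset_of_card_le hsub (by omega)
        have hci : c i ∈ U := hH.supp _ _ (hadj i)
        rw [← hall, Finset.mem_filter] at hci
        rcases hout i hi _ (hm.adj _ hci.2) with h | h
        · exact hlc _ h1 i (by rw [← h, hm.invol])
        · exact hlc _ h2 i (by rw [← h, hm.invol])
    obtain ⟨i, hi, hi1⟩ := hpair
    -- The cycle is rotated so that the adjacent leafed vertices get the indices `0` and `1` of the
    -- base profile.
    have hc' : Function.Injective fun k => c (k + i) := hc.comp (add_left_injective i)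
    obtain ⟨S', hlc', hHS', hUS', hout'⟩ := hH.eq_sunGraph hm hs hc' fun k => by
      rw [add_right_comm]; exact hadj _
    have hU' := card_sunVerts hc' (hmi.comp hc') hlc'
    have hmem : ∀ k, k + i ∈ S → k ∈ S' := fun k hk => by
      by_contra hk'
      have h2 : H.Adj (c (k + i)) (mt (c (k + i))) := hm.adj _ (hlc _ hk _)
      rcases hout' k hk' _ h2 with h | h
      · exact hlc _ hk _ h
      · exact hlc _ hk _ h
    obtain ⟨k, hk, hd⟩ := dominates_sunGraph_two hc' (hmi.comp hc') hlc'
      (hmem 0 (by rwa [zero_add])) (hmem 1 (by rwa [add_comm]))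
    rw [← hHS', ← hUS'] at hd
    rw [← hUS'] at hU'
    exact ⟨k, by omega, _, hd, Or.inr (Or.inl ⟨0, rfl, rfl⟩)⟩
  · obtain rfl : S = Finset.univ := (Finset.card_eq_iff_eq_univ S).1 (by rw [Fintype.card_fin]; omega)
    have hd := dominates_sunGraph_univ hc (hmi.comp hc) fun i => hlc i (Finset.mem_univ _)
    rw [← hHS, ← hUS] at hd
    exact ⟨0, by omega, _, hd, Or.inr (Or.inr ⟨0, rfl, rfl⟩)⟩

end Sun

/-! ### Restricting matchings, and the bound by the bare four-cycle. -/

section Induction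

variable {V : Type*} {H : SimpleGraph V} {U : Finset V}

/-- Restrict a matching to the complement of `p` and `v`. -/
noncomputable def unmatch (mt : V → V) (p v : V) (z : V) : V := if z = p ∨ z = v then z else mt z

lemma IsMatchingMap.unmatch {H' : SimpleGraph V} {mt : V → V} (hm : IsMatchingMap H mt) {p v : V}
    (hvp : mt v = p) (hH : ∀ x y, H.Adj x y → x ≠ p → x ≠ v → y ≠ p → y ≠ v → H'.Adj x y) :
    IsMatchingMap H' (unmatch mt p v) := by
  have hpv : mt p = v := by rw [← hvp, hm.invol]
  have key : ∀ z, z ≠ p → z ≠ v → mt z ≠ p ∧ mt z ≠ v := fun z h1 h2 =>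
    ⟨fun e => h2 (by rw [← hm.invol z, e, hpv]), fun e => h1 (by rw [← hm.invol z, e, hvp])⟩
  refine ⟨fun z => ?_, fun z hz => ?_⟩
  · by_cases h : z = p ∨ z = v
    · simp [_root_.unmatch, h]
    · have h' := not_or.1 h
      have := key z h'.1 h'.2
      simp [_root_.unmatch, h, this, hm.invol]
  · by_cases h : z = p ∨ z = v
    · simp [_root_.unmatch, h] at hz
    · have h' := not_or.1 h
      simp only [_root_.unmatch, h, if_false] at hz ⊢
      exact hH _ _ (hm.adj z hz) h'.1 h'.2 (key z h'.1 h'.2).1 (key z h'.1 h'.2).2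

lemma isMatchingMap_id (H : SimpleGraph V) : IsMatchingMap H id :=
  ⟨fun _ => rfl, fun _ h => absurd rfl h⟩

lemma fourCycle_vec {v a z b : V} (hva : H.Adj v a) (haz : H.Adj a z) (hzb : H.Adj z b)
    (hbv : H.Adj b v) (hab : a ≠ b) (hvz : v ≠ z) :
    Function.Injective ![v, a, z, b] ∧
      ∀ i : Fin 4, H.Adj (![v, a, z, b] i) (![v, a, z, b] (i + 1)) := by
  have h1 := hva.ne
  have h2 := haz.ne
  have h3 := hzb.ne
  have h4 := hbv.ne
  constructor
  · intro i j
    fin_cases i <;> fin_cases j <;> simp <;> grind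
  · intro i
    fin_cases i <;> simp [hva, haz, hzb, hbv]

variable [Fintype V]

lemma card_unmatch {mt : V → V} (hm : IsMatchingMap H mt) {p v : V}
    (hvp : mt v = p) (hne : v ≠ p) {m : ℕ}
    (hcard : (Finset.univ.filter fun z => mt z ≠ z).card = 2 * (m + 1)) :
    (Finset.univ.filter fun z => unmatch mt p v z ≠ z).card = 2 * m := by
  have hpv : mt p = v := by rw [← hvp, hm.invol]
  have : (Finset.univ.filter fun z => mt z ≠ z) =
      insert p (insert v (Finset.univ.filter fun z => unmatch mt p v z ≠ z)) := by
    ext z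
    simp only [Finset.mem_filter, Finset.mem_univ, true_and, Finset.mem_insert, unmatch]
    by_cases h1 : z = p
    · subst h1; simp [hpv, hne]
    · by_cases h2 : z = v
      · subst h2; simp [hvp, hne.symm]
      · simp [h1, h2]
  rw [this, Finset.card_insert_of_notMem, Finset.card_insert_of_notMem] at hcard
  · omega
  · simp [unmatch]
  · simp [unmatch, hne.symm]

lemma adj_iff_of_card_eq_two {v : V} (h : (nbrs H v).card = 2) :
    ∃ a b, a ≠ b ∧ ∀ j, H.Adj v j ↔ j = a ∨ j = b := by
  obtain ⟨a, b, hab, hw⟩ := Finset.card_eq_two.1 h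
  exact ⟨a, b, hab, fun j => by rw [← mem_nbrs, hw]; simp⟩

lemma exists_other_of_card_eq_two {v a : V} (h : (nbrs H v).card = 2) (ha : H.Adj v a) :
    ∃ b, a ≠ b ∧ ∀ j, H.Adj v j ↔ j = a ∨ j = b := by
  obtain ⟨x, y, hxy, hj⟩ := adj_iff_of_card_eq_two h
  rcases (hj a).1 ha with rfl | rfl
  · exact ⟨y, hxy, hj⟩
  · exact ⟨x, hxy.symm, fun j => by rw [hj, or_comm]⟩

lemma exists_other_of_card_eq_three {v l : V} (h : (nbrs H v).card = 3) (hl : H.Adj v l) :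
    ∃ a b, a ≠ b ∧ a ≠ l ∧ b ≠ l ∧ ∀ j, H.Adj v j ↔ j = l ∨ j = a ∨ j = b := by
  have h2 : ((nbrs H v).erase l).card = 2 := by
    rw [Finset.card_erase_of_mem (mem_nbrs.2 hl), h]
  obtain ⟨a, b, hab, hw⟩ := Finset.card_eq_two.1 h2
  have ha : a ∈ (nbrs H v).erase l := by simp [hw]
  have hb : b ∈ (nbrs H v).erase l := by simp [hw]
  refine ⟨a, b, hab, Finset.ne_of_mem_erase ha, Finset.ne_of_mem_erase hb, fun j => ?_⟩
  rw [← mem_nbrs, ← Finset.insert_erase (mem_nbrs.2 hl), hw]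
  simp

lemma IsUnicyclicOn.hasLeafBound (hH : IsUnicyclicOn H U) {u v : V} (h : ∀ j, H.Adj v j ↔ j = u)
    {p : ℤ[X] × ℤ[X]} (hd : Dominates (removeVertex H v) (U.erase v) p.1 p.2) :
    Dominates H U (addLeaf p).1 (addLeaf p).2 := by
  have huv : H.Adj v u := (h u).2 rfl
  have := hd.leaf huv.ne.symm (Finset.mem_erase.2 ⟨huv.ne.symm, hH.supp u v huv.symm⟩)
    not_removeVertex_adj
  rwa [removeVertex_sup_leaf h, Finset.insert_erase (hH.supp v u huv)] at this

lemma IsUnicyclicOn.hasSmoothBound (hH : IsUnicyclicOn H U) {a b v : V}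
    (h : ∀ j, H.Adj v j ↔ j = a ∨ j = b) (hab : a ≠ b) {p : ℤ[X] × ℤ[X]}
    (hd : Dominates (removeVertex H v ⊔ SimpleGraph.edge a b) (U.erase v) p.1 p.2) :
    Dominates H U (addLeaf p).1 (addLeaf p).2 := by
  have hva : H.Adj v a := (h a).2 (Or.inl rfl)
  have hvb : H.Adj v b := (h b).2 (Or.inr rfl)
  have := hd.smooth not_removeVertex_adj (fun e => hH.tri a v b hva.symm hvb e.1) hva.ne.symm
    hvb.ne.symm hab (Finset.mem_erase.2 ⟨hva.ne.symm, hH.supp a v hva.symm⟩)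
  rwa [removeVertex_sup_two h, Finset.insert_erase (hH.supp v a hva)] at this

/-- Every unicyclic graph dominates the profile of a four-cycle with leaves at one vertex. -/
lemma IsUnicyclicOn.cycle_bound (n : ℕ) : ∀ (H : SimpleGraph V) (U : Finset V), U.card = n →
    IsUnicyclicOn H U → U.Nonempty → ∃ k, n = k + 4 ∧
      Dominates H U (addLeaf^[k] cycleProfile).1 (addLeaf^[k] cycleProfile).2 := by
  induction n with
  | zero => intro H U h1 _ h2; rw [Finset.card_eq_zero] at h1; exact absurd h1 h2.ne_empty
  | succ n ih =>
    intro H U hU hH hne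
    have ih' : ∀ (H' : SimpleGraph V) (v u : V), v ∈ U → u ∈ U → u ≠ v →
        IsUnicyclicOn H' (U.erase v) → (∀ p : ℤ[X] × ℤ[X], Dominates H' (U.erase v) p.1 p.2 →
          Dominates H U (addLeaf p).1 (addLeaf p).2) → ∃ k, n + 1 = k + 4 ∧
      Dominates H U (addLeaf^[k] cycleProfile).1 (addLeaf^[k] cycleProfile).2 := by
      intro H' v u hv hu huv h1 h2
      obtain ⟨k, hk, hd⟩ := ih H' (U.erase v) (by rw [Finset.card_erase_of_mem hv, hU]; rfl) h1
        ⟨u, Finset.mem_erase.2 ⟨huv, hu⟩⟩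
      refine ⟨k + 1, by omega, ?_⟩
      rw [Function.iterate_succ_apply']
      exact h2 _ hd
    by_cases hl : ∃ v, (nbrs H v).card = 1
    · obtain ⟨v, hv⟩ := hl
      obtain ⟨u, hu⟩ := exists_adj_iff_of_card_eq_one hv
      have huv : H.Adj v u := (hu u).2 rfl
      exact ih' _ v u (hH.supp _ _ huv) (hH.supp _ _ huv.symm) huv.ne.symm (hH.removeLeaf hu)
        fun p => hH.hasLeafBound hu
    · push Not at hl
      -- Without leaves, the degree count for the empty matching says that every vertex has degree
      -- two. Smoothing then works unless the neighbours of `v` have a second common neighbour,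
      -- which gives a four-cycle.
      have hs := hH.degrees (isMatchingMap_id H) (fun v h => absurd h (hl v))
        (fun v p h => absurd h (hl v))
      obtain ⟨v, hv⟩ := hne
      have h2 : (nbrs H v).card = 2 := by
        rcases hs v hv with h | h | h
        · exact absurd h (hl v)
        · exact h.1
        · exact absurd h.2 (hl _)
      obtain ⟨a, b, hab, hj⟩ := adj_iff_of_card_eq_two h2
      have hva : H.Adj v a := (hj a).2 (Or.inl rfl)
      have hvb : H.Adj v b := (hj b).2 (Or.inr rfl)
      by_cases hz : ∀ z, H.Adj z a → H.Adj z b → z = v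
      · exact ih' _ v a hv (hH.supp _ _ hva.symm) hva.ne.symm (hH.smooth hj hab hz)
          fun p => hH.hasSmoothBound hj hab
      · push Not at hz
        obtain ⟨z, hza, hzb, hzv⟩ := hz
        obtain ⟨hc, hadj⟩ := fourCycle_vec hva hza.symm hzb hvb.symm hab hzv.symm
        obtain ⟨S, hlc, hHS, hUS, -⟩ := hH.eq_sunGraph (isMatchingMap_id H) hs hc hadj
        obtain rfl : S = ∅ := Finset.eq_empty_of_forall_notMem fun i hi => hlc i hi i rfl
        have hd := dominates_cycle hc (isFourCycle_cycleOn hc)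
        rw [sunGraph_empty] at hHS
        rw [sunVerts_empty] at hUS
        rw [← hHS, ← hUS] at hd
        have h4 := Finset.card_image_of_injective Finset.univ hc
        rw [← hUS, hU, Finset.card_univ, Fintype.card_fin] at h4
        exact ⟨0, by omega, hd⟩

end Induction

/-! ### The inductive lower bound. -/

section Main

variable {V : Type*} [Fintype V] {H : SimpleGraph V} {U : Finset V}

/-- The claim of `IsUnicyclicOn.hasExtremalBound` for graphs on fewer than `n` vertices. -/
def ExtremalBoundBelow (V : Type*) [Fintype V] (n : ℕ) : Prop :=
  ∀ (H : SimpleGraph V) (U : Finset V) (mt : V → V) (m : ℕ), U.card < n → IsUnicyclicOn H U →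
    IsMatchingMap H mt → (Finset.univ.filter fun v => mt v ≠ v).card = 2 * m → 2 ≤ m →
    HasExtremalBound H U m

/-- Deleting the pendent path removes two vertices and one matching edge, so the number of leaves in
the profile stays the same. -/
lemma IsUnicyclicOn.pendentPath_bound (hH : IsUnicyclicOn H U) {mt : V → V}
    (hm : IsMatchingMap H mt) {m : ℕ}
    (hcard : (Finset.univ.filter fun v => mt v ≠ v).card = 2 * (m + 1)) (h2 : 2 ≤ m)
    (ih : ExtremalBoundBelow V U.card)
    {v p : V} (hv : ∀ j, H.Adj v j ↔ j = p) (hmv : mt v = p) (hp : (nbrs H p).card = 2) :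
    HasExtremalBound H U (m + 1) := by
  have hvp : H.Adj v p := (hv p).2 rfl
  obtain ⟨u, hvu, hpj⟩ := exists_other_of_card_eq_two hp hvp.symm
  have hpu : H.Adj p u := (hpj u).2 (Or.inr rfl)
  have hvU := hH.supp _ _ hvp
  have hpU := hH.supp _ _ hvp.symm
  have huU := hH.supp _ _ hpu.symm
  have hp1 : ∀ j, (removeVertex H v).Adj p j ↔ j = u := fun j => by
    rw [removeVertex_adj, hpj]
    constructor
    · rintro ⟨h | h, -, h1⟩
      · exact absurd h h1
      · exact h
    · rintro rfl
      exact ⟨Or.inr rfl, hvp.ne.symm, hvu.symm⟩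
  have h1 := hH.removeLeaf hv
  have h3 := h1.removeLeaf hp1
  have huU2 : u ∈ (U.erase v).erase p :=
    Finset.mem_erase.2 ⟨hpu.ne.symm, Finset.mem_erase.2 ⟨hvu.symm, huU⟩⟩
  obtain ⟨y, hy⟩ := h3.exists_adj huU2
  have hc1 := Finset.card_erase_of_mem hvU
  have hc2 := Finset.card_erase_of_mem (Finset.mem_erase.2 ⟨hvp.ne.symm, hpU⟩)
  have hpos := Finset.card_pos.2 ⟨u, huU2⟩
  refine HasExtremalBound.path (ih _ _ _ m (by omega) h3 (hm.unmatch hmv fun x y h e1 e2 e3 e4 =>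
    ⟨⟨h, e2, e4⟩, e1, e3⟩) (card_unmatch hm hmv hvp.ne hcard) h2) (by omega) fun q hq => ?_
  have := hq.pendentPath hpu.ne.symm hvu.symm hvp.ne.symm huU2 not_removeVertex_adj
    (fun j hj => not_removeVertex_adj j hj.1) hy
  rw [removeVertex_sup_leaf hp1, removeVertex_sup_leaf hv,
    Finset.insert_erase (Finset.mem_erase.2 ⟨hvp.ne.symm, hpU⟩), Finset.insert_erase hvU] at this
  exact this

/-- The leaf `l` is deleted and `v` is smoothed, which removes the matching edge `vl` alone. The
neighbour `y` provides the attachment required by `Dominates.smoothLeafed`. -/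
lemma IsUnicyclicOn.leafed_bound (hH : IsUnicyclicOn H U) {mt : V → V}
    (hm : IsMatchingMap H mt) {m : ℕ}
    (hcard : (Finset.univ.filter fun v => mt v ≠ v).card = 2 * (m + 1)) (h2 : 2 ≤ m)
    (ih : ExtremalBoundBelow V U.card)
    {v l a b y : V} (hmv : mt v = l) (hl : ∀ j, H.Adj l j ↔ j = v) (hab : a ≠ b) (hal : a ≠ l)
    (hbl : b ≠ l) (hv : ∀ j, H.Adj v j ↔ j = l ∨ j = a ∨ j = b)
    (hz : ∀ z, H.Adj z a → H.Adj z b → z = v) (hy : H.Adj a y) (hyv : y ≠ v) :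
    HasExtremalBound H U (m + 1) := by
  have hva : H.Adj v a := (hv a).2 (Or.inr (Or.inl rfl))
  have hvb : H.Adj v b := (hv b).2 (Or.inr (Or.inr rfl))
  have hlv : H.Adj l v := (hl v).2 rfl
  have hvU := hH.supp _ _ hva
  have hlU := hH.supp _ _ hlv
  have haU := hH.supp _ _ hva.symm
  have hv1 : ∀ j, (removeVertex H l).Adj v j ↔ j = a ∨ j = b := fun j => by
    rw [removeVertex_adj, hv]
    have := hlv.ne
    grind
  have h1 := hH.removeLeaf hl
  have h3 := h1.smooth hv1 hab fun z hza hzb => hz z hza.1 hzb.1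
  have haU2 : a ∈ (U.erase l).erase v :=
    Finset.mem_erase.2 ⟨hva.ne.symm, Finset.mem_erase.2 ⟨hal, haU⟩⟩
  have hvU1 := Finset.mem_erase.2 ⟨hlv.ne.symm, hvU⟩
  have hc1 := Finset.card_erase_of_mem hlU
  have hc2 := Finset.card_erase_of_mem hvU1
  have hpos := Finset.card_pos.2 ⟨a, haU2⟩
  have hyl : y ≠ l := by
    rintro rfl
    exact hva.ne.symm ((hl a).1 hy.symm)
  refine HasExtremalBound.path (ih _ _ _ m (by omega) h3 (hm.unmatch hmv fun x y h e1 e2 e3 e4 =>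
    Or.inl ⟨⟨h, e1, e3⟩, e2, e4⟩) (card_unmatch hm hmv hlv.ne.symm hcard) h2) (by omega) fun q hq => ?_
  have := hq.smoothLeafed (v := v) (w := l) (y := y) not_removeVertex_adj
    (fun j hj => not_removeVertex_adj j hj.1) (fun e => hH.tri a v b hva.symm hvb e.1.1)
    hva.ne.symm hvb.ne.symm hab hal hbl hlv.ne.symm haU2 ⟨⟨hy, hal, hyl⟩, hva.ne.symm, hyv⟩
  rw [removeVertex_sup_two hv1, removeVertex_sup_leaf hl, Finset.insert_comm,
    Finset.insert_erase hvU1, Finset.insert_erase hlU] at this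
  exact this

/-- Two smoothings in a row, at `v` and then at `w`. The first creates no triangle since `a` and `b`
are not adjacent, the second since they have no common neighbour. -/
lemma IsUnicyclicOn.matchedPath_bound (hH : IsUnicyclicOn H U) {mt : V → V}
    (hm : IsMatchingMap H mt) {m : ℕ}
    (hcard : (Finset.univ.filter fun v => mt v ≠ v).card = 2 * (m + 1)) (h2 : 2 ≤ m)
    (ih : ExtremalBoundBelow V U.card)
    {v w a b : V} (hmv : mt v = w) (hv : ∀ j, H.Adj v j ↔ j = w ∨ j = a) (hwa : w ≠ a)
    (hw : ∀ j, H.Adj w j ↔ j = v ∨ j = b) (hvb : v ≠ b) (nab : ¬ H.Adj a b)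
    (hz : ∀ z, H.Adj z a → ¬ H.Adj z b) :
    HasExtremalBound H U (m + 1) := by
  have hva : H.Adj v a := (hv a).2 (Or.inr rfl)
  have hvw : H.Adj v w := (hv w).2 (Or.inl rfl)
  have hwb : H.Adj w b := (hw b).2 (Or.inr rfl)
  have hab : a ≠ b := by
    rintro rfl
    exact hH.tri v w a hvw hwb hva
  have hvU := hH.supp _ _ hva
  have hwU := hH.supp _ _ hvw.symm
  have haU := hH.supp _ _ hva.symm
  have hbU := hH.supp _ _ hwb.symm
  have h1 := hH.smooth hv hwa fun z hzw hza => by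
    rcases (hw z).1 hzw.symm with h | h
    · exact h
    · exact absurd (h ▸ hza).symm nab
  have hw1 : ∀ j, (removeVertex H v ⊔ SimpleGraph.edge w a).Adj w j ↔ j = a ∨ j = b := fun j => by
    rw [SimpleGraph.sup_adj, removeVertex_adj, SimpleGraph.edge_adj, hw]
    have := hvw.ne
    grind
  have hne := hva.ne
  have hne' := hvw.ne
  have hne'' := hwb.ne
  have h3 := h1.smooth hw1 hab fun z hza hzb => by
    rw [SimpleGraph.sup_adj, removeVertex_adj, SimpleGraph.edge_adj] at hza hzb
    have := hz z
    have := H.adj_comm a b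
    grind
  have hG : removeVertex (removeVertex H v ⊔ SimpleGraph.edge w a) w =
      removeVertex (removeVertex H v) w := by
    ext x y
    simp only [removeVertex_adj, SimpleGraph.sup_adj, SimpleGraph.edge_adj]
    grind
  rw [hG] at h3
  have haU2 : a ∈ (U.erase v).erase w :=
    Finset.mem_erase.2 ⟨hwa.symm, Finset.mem_erase.2 ⟨hne.symm, haU⟩⟩
  have hbU2 : b ∈ (U.erase v).erase w :=
    Finset.mem_erase.2 ⟨hne''.symm, Finset.mem_erase.2 ⟨hvb.symm, hbU⟩⟩
  have hwU1 := Finset.mem_erase.2 ⟨hne'.symm, hwU⟩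
  have hc1 := Finset.card_erase_of_mem hvU
  have hc2 := Finset.card_erase_of_mem hwU1
  have hpos := Finset.card_pos.2 ⟨a, haU2⟩
  refine HasExtremalBound.path (ih _ _ _ m (by omega) h3 (hm.unmatch hmv fun x y h e1 e2 e3 e4 =>
    Or.inl ⟨⟨h, e2, e4⟩, e1, e3⟩) (card_unmatch hm hmv hne' hcard) h2) (by omega) fun q hq => ?_
  have := hq.smoothTwo (v := v) (w := w) (fun j hj => not_removeVertex_adj j hj.1)
    not_removeVertex_adj (fun e => nab e.1.1)
    hne.symm hvb.symm hab hwa.symm hne''.symm hne' haU2 hbU2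
  have hH' : ((removeVertex (removeVertex H v) w ⊔ SimpleGraph.edge b w) ⊔
      SimpleGraph.edge a v) ⊔ SimpleGraph.edge v w = H := by
    ext x y
    simp only [removeVertex_adj, SimpleGraph.sup_adj, SimpleGraph.edge_adj]
    have e1 := hv x
    have e2 := hv y
    have e3 := hw x
    have e4 := hw y
    have e5 := H.adj_comm x y
    have e6 := hv w
    have e7 := H.irrefl (v := x)
    grind
  rw [hH', Finset.insert_erase hwU1, Finset.insert_erase hvU] at this
  exact this

/-- A triangle-free unicyclic graph with a matching of `m ≥ 2` edges dominates one of the three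
extremal profiles. -/
theorem IsUnicyclicOn.hasExtremalBound (n : ℕ) : ∀ (H : SimpleGraph V) (U : Finset V) (mt : V → V)
    (m : ℕ), U.card = n → IsUnicyclicOn H U → IsMatchingMap H mt →
    (Finset.univ.filter fun v => mt v ≠ v).card = 2 * m → 2 ≤ m → HasExtremalBound H U m := by
  induction n using Nat.strong_induction_on with
  | _ n IH =>
  intro H U mt m hU hH hm hcard h2
  have ih : ExtremalBoundBelow V U.card := fun H' U' mt' m' h1 => IH _ (hU ▸ h1) H' U' mt' m' rfl
  clear IH
  have hsub : (Finset.univ.filter fun v => mt v ≠ v) ⊆ U := fun v hv =>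
    hH.supp _ _ (hm.adj v (Finset.mem_filter.1 hv).2)
  have hle := Finset.card_le_card hsub
  have hne : U.Nonempty := Finset.card_pos.1 (by omega)
  -- For `m = 2` the bare cycle bound is enough. Otherwise a matching edge may be removed and at
  -- least two are left.
  obtain rfl | ⟨k, rfl, hk⟩ : m = 2 ∨ ∃ k, m = k + 1 ∧ 2 ≤ k := by
    rcases Nat.eq_or_lt_of_le h2 with h | h
    · exact Or.inl h.symm
    · exact Or.inr ⟨m - 1, by omega, by omega⟩
  · obtain ⟨k, hk, hd⟩ := IsUnicyclicOn.cycle_bound _ H U rfl hH hne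
    exact ⟨k, by omega, _, hd, Or.inl ⟨0, rfl, rfl⟩⟩
  have hpos : ∀ v ∈ U, 1 ≤ U.card := fun v hv => Finset.card_pos.2 ⟨v, hv⟩
  by_cases hl : ∀ v, (nbrs H v).card = 1 → mt v ≠ v
  swap
  -- An unmatched leaf can be deleted without changing the matching. The matching is never assumed
  -- to be maximum, so nothing has to be checked about the matching number of the smaller graph.
  · push Not at hl
    obtain ⟨v, hv, hmv⟩ := hl
    obtain ⟨u, hu⟩ := exists_adj_iff_of_card_eq_one hv
    have hvU := hH.supp _ _ ((hu u).2 rfl)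
    have hc := Finset.card_erase_of_mem hvU
    have := hpos v hvU
    refine HasExtremalBound.leaf (ih _ _ mt _ (by omega) (hH.removeLeaf hu) ⟨hm.invol, fun z hz =>
      ⟨hm.adj z hz, fun e => hz (e ▸ hmv), fun e => hz ?_⟩⟩ hcard h2) (by omega)
      fun p => hH.hasLeafBound hu
    rw [← hm.invol z, e, hmv, hmv]
  by_cases hp : ∀ v p, (nbrs H v).card = 1 → H.Adj v p → (nbrs H p).card ≠ 2
  swap
  · push Not at hp
    obtain ⟨v, p, hv, hvp, hp⟩ := hp
    have hj := adj_iff_of_card_eq_one hv hvp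
    exact hH.pendentPath_bound hm hcard hk ih hj ((hj _).1 (hm.adj v (hl v hv))) hp
  have hs : IsSunLike H U mt := hH.degrees hm hl hp
  have hbase : ∀ {v a z b : V}, H.Adj v a → H.Adj a z → H.Adj z b → H.Adj b v → a ≠ b → v ≠ z →
      HasExtremalBound H U (k + 1) := fun h1 h2 h3 h4 h5 h6 => by
    obtain ⟨hc, hadj⟩ := fourCycle_vec h1 h2 h3 h4 h5 h6
    exact hH.hasExtremalBound_of_fourCycle hm hs hc hadj hcard (by omega)
  by_cases h3 : ∃ v ∈ U, (nbrs H v).card = 3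
  · obtain ⟨v, hvU, hv3⟩ := h3
    have hmv1 : (nbrs H (mt v)).card = 1 := by
      rcases hs v hvU with h | h | h
      · omega
      · omega
      · exact h.2
    have hmv : mt v ≠ v := fun e => by rw [e] at hmv1; omega
    have hvl := hm.adj v hmv
    have hlj := adj_iff_of_card_eq_one hmv1 hvl.symm
    obtain ⟨a, b, hab, hal, hbl, hj⟩ := exists_other_of_card_eq_three hv3 hvl
    have hva : H.Adj v a := (hj a).2 (Or.inr (Or.inl rfl))
    have hvb : H.Adj v b := (hj b).2 (Or.inr (Or.inr rfl))
    by_cases hz : ∀ z, H.Adj z a → H.Adj z b → z = v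
    -- If `v` were the only neighbour of `a`, then `a` would be a leaf matched to `v`, hence equal
    -- to the partner of `v`.
    · have hy : ∃ y, H.Adj a y ∧ y ≠ v := by
        by_contra hcon
        push Not at hcon
        have haj : ∀ j, H.Adj a j ↔ j = v := fun j => ⟨hcon j, fun e => e ▸ hva.symm⟩
        have := hl a (card_nbrs_eq_one haj)
        exact hal (by rw [← (haj _).1 (hm.adj a this), hm.invol])
      obtain ⟨y, hy, hyv⟩ := hy
      exact hH.leafed_bound hm hcard hk ih rfl hlj hab hal hbl hj hz hy hyv
    · push Not at hz
      obtain ⟨z, hza, hzb, hzv⟩ := hz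
      exact hbase hva hza.symm hzb hvb.symm hab hzv.symm
  push Not at h3
  -- A leaf would be matched to a vertex of degree three, and there are none: the graph is a bare
  -- cycle.
  have hdeg : ∀ v ∈ U, (nbrs H v).card = 2 := by
    intro v hv
    rcases hs v hv with h | h | h
    · exfalso
      have hmv := hl v h
      have hadj := hm.adj v hmv
      have hU' := hH.supp _ _ hadj.symm
      rcases hs _ hU' with h' | h' | h'
      · exact hH.leaf_nbr h hadj h'
      · rw [hm.invol] at h'
        exact h'.2 h
      · exact h3 _ hU' h'.1
    · exact h.1
    · exact absurd h.1 (h3 v hv)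
  by_cases hu : ∃ v ∈ U, mt v = v
  · obtain ⟨v, hvU, hmv⟩ := hu
    obtain ⟨a, b, hab, hj⟩ := adj_iff_of_card_eq_two (hdeg v hvU)
    have hva : H.Adj v a := (hj a).2 (Or.inl rfl)
    have hvb : H.Adj v b := (hj b).2 (Or.inr rfl)
    by_cases hz : ∀ z, H.Adj z a → H.Adj z b → z = v
    · have hc := Finset.card_erase_of_mem hvU
      have := hpos v hvU
      refine HasExtremalBound.leaf (ih _ _ mt _ (by omega) (hH.smooth hj hab hz)
        ⟨hm.invol, fun z hz => Or.inl
        ⟨hm.adj z hz, fun e => hz (e ▸ hmv), fun e => hz ?_⟩⟩ hcard h2) (by omega)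
        fun p => hH.hasSmoothBound hj hab
      rw [← hm.invol z, e, hmv, hmv]
    · push Not at hz
      obtain ⟨z, hza, hzb, hzv⟩ := hz
      exact hbase hva hza.symm hzb hvb.symm hab hzv.symm
  · push Not at hu
    obtain ⟨v, hvU⟩ := hne
    have hvw := hm.adj v (hu v hvU)
    have hwU := hH.supp _ _ hvw.symm
    obtain ⟨a, hwa, hv⟩ := exists_other_of_card_eq_two (hdeg v hvU) hvw
    obtain ⟨b, hvb, hw⟩ := exists_other_of_card_eq_two (hdeg _ hwU) hvw.symm
    have hva : H.Adj v a := (hv a).2 (Or.inr rfl)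
    have hwb : H.Adj (mt v) b := (hw b).2 (Or.inr rfl)
    by_cases nab : H.Adj a b
    · exact hbase hvw hwb nab.symm hva.symm hwa hvb
    refine hH.matchedPath_bound hm hcard hk ih rfl hv hwa hw hvb nab fun z hza hzb => ?_
    have haU := hH.supp _ _ hza.symm
    have hbU := hH.supp _ _ hzb.symm
    -- On the fully matched cycle, a vertex not matched to one neighbour is matched to the other. A
    -- common neighbour `z` of `a` and `b` would be the partner of both, forcing `a = b` and a
    -- triangle: a five-cycle has no perfect matching.
    have hmul : ∀ x y, x ∈ U → H.Adj x y → mt x ≠ y → ∀ z, H.Adj x z → z ≠ y → mt x = z := by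
      intro x y hx hxy hne z hxz hzy
      obtain ⟨t, -, ht⟩ := exists_other_of_card_eq_two (hdeg x hx) hxy
      have h1 := (ht _).1 (hm.adj x (hu x hx))
      have h2 := (ht _).1 hxz
      grind
    have hzv : z ≠ v := by
      rintro rfl
      rcases (hv b).1 hzb with h | h
      · exact hwb.ne h.symm
      · rw [h] at hwb
        exact hH.tri _ _ _ hvw hwb hva
    have hzw : z ≠ mt v := by
      rintro rfl
      exact hH.tri _ _ _ hvw hza hva
    have ha := hmul a v haU hva.symm (fun e => hwa (by rw [← e, hm.invol])) z hza.symm hzv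
    have hb := hmul b (mt v) hbU hwb.symm (fun e => hvb (by
      rw [← hm.invol v, ← e, hm.invol])) z hzb.symm hzw
    have hab : a = b := by rw [← hm.invol a, ha, ← hb, hm.invol]
    rw [← hab] at hwb
    exact hH.tri _ _ _ hvw hwb hva

end Main

/-! ### Comparing the three extremal profiles. -/

section Comparison

/-- Allows an explicit difference to be certified by its list of coefficients, constant term first.
-/
lemma CoeffNonneg.horner (l : List ℕ) :
    CoeffNonneg (l.foldr (fun c p => (c : ℤ[X]) + Polynomial.X * p) 0) := by
  induction l with
  | nil => exact .zero
  | cons c l ih => exact .add (.natCast c) (.mul .X ih)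

lemma CoeffNonneg.trans {f g h : ℤ[X]} (h1 : CoeffNonneg (g - f)) (h2 : CoeffNonneg (h - g)) :
    CoeffNonneg (h - f) :=
  (h1.add h2).of_eq (by ring)

/-- Both polynomials of the profile `p` are bounded by those of `q`. -/
def ProfileLE (p q : ℤ[X] × ℤ[X]) : Prop := CoeffNonneg (q.1 - p.1) ∧ CoeffNonneg (q.2 - p.2)

lemma ProfileLE.addLeaf {p q : ℤ[X] × ℤ[X]} (h : ProfileLE p q) :
    ProfileLE (addLeaf p) (addLeaf q) :=
  ⟨((coeffNonneg_one_add_X.mul h.1).add (CoeffNonneg.X.mul h.2)).of_eq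
    (by simp only [_root_.addLeaf]; ring),
    (coeffNonneg_one_add_X.mul h.2).of_eq (by simp only [_root_.addLeaf]; ring)⟩

lemma ProfileLE.addPath {p q : ℤ[X] × ℤ[X]} (h : ProfileLE p q) :
    ProfileLE (addPath p) (addPath q) :=
  ⟨((coeffNonneg_pathFactor.mul h.1).add (coeffNonneg_pathRoot.mul h.2)).of_eq
    (by simp only [_root_.addPath]; ring),
    (coeffNonneg_pathFactor.mul h.2).of_eq (by simp only [_root_.addPath]; ring)⟩

lemma ProfileLE.iterate_addLeaf {p q : ℤ[X] × ℤ[X]} (h : ProfileLE p q) (k : ℕ) :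
    ProfileLE (_root_.addLeaf^[k] p) (_root_.addLeaf^[k] q) := by
  induction k with
  | zero => exact h
  | succ k ih => simpa only [Function.iterate_succ_apply'] using ih.addLeaf

lemma ProfileLE.iterate_addPath {p q : ℤ[X] × ℤ[X]} (h : ProfileLE p q) (k : ℕ) :
    ProfileLE (_root_.addPath^[k] p) (_root_.addPath^[k] q) := by
  induction k with
  | zero => exact h
  | succ k ih => simpa only [Function.iterate_succ_apply'] using ih.addPath

/-- This eliminates the cycle profile as soon as `m ≥ 3`. -/
lemma twoLeafProfile_le_addPath_cycleProfile : ProfileLE twoLeafProfile (addPath cycleProfile) := by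
  constructor
  · refine (CoeffNonneg.horner [0, 0, 1, 6, 9]).of_eq ?_
    simp [addPath, cycleProfile, twoLeafProfile]
    ring
  · refine (CoeffNonneg.horner [0, 0, 1, 3, 1]).of_eq ?_
    simp [addPath, cycleProfile, twoLeafProfile]
    ring

/-- With the two lemmas that follow, these are the minimal numbers of leaves and paths, `(3, 0)`,
`(1, 1)` and `(0, 2)`, for which the two-leaf profile is below the four-leaf one in both components.
-/
lemma addLeaf_three_twoLeafProfile_le :
    ProfileLE (addLeaf^[3] (addPath^[0] (addPath twoLeafProfile)))
      (addLeaf^[3] (addPath^[0] fourLeafProfile)) := by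
  constructor
  · refine (CoeffNonneg.horner [0, 0, 3, 28, 99, 172, 157, 72, 13]).of_eq ?_
    simp [addPath, addLeaf, fourLeafProfile, twoLeafProfile]
    ring
  · refine (CoeffNonneg.horner [0, 1, 11, 49, 117, 166, 145, 77, 23, 3]).of_eq ?_
    simp [addPath, addLeaf, fourLeafProfile, twoLeafProfile]
    ring

lemma addLeaf_addPath_twoLeafProfile_le :
    ProfileLE (addLeaf^[1] (addPath^[1] (addPath twoLeafProfile)))
      (addLeaf^[1] (addPath^[1] fourLeafProfile)) := by
  constructor
  · refine (CoeffNonneg.horner [0, 0, 2, 20, 75, 132, 111, 40, 4]).of_eq ?_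
    simp [addPath, addLeaf, fourLeafProfile, twoLeafProfile]
    ring
  · refine (CoeffNonneg.horner [0, 1, 12, 58, 147, 214, 185, 94, 26, 3]).of_eq ?_
    simp [addPath, addLeaf, fourLeafProfile, twoLeafProfile]
    ring

lemma addPath_three_twoLeafProfile_le :
    ProfileLE (addLeaf^[0] (addPath^[2] (addPath twoLeafProfile)))
      (addLeaf^[0] (addPath^[2] fourLeafProfile)) := by
  constructor
  · refine (CoeffNonneg.horner [0, 0, 2, 24, 114, 274, 355, 250, 99, 24, 3]).of_eq ?_
    simp [addPath, fourLeafProfile, twoLeafProfile]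
    ring
  · refine (CoeffNonneg.horner [0, 1, 14, 81, 252, 461, 513, 350, 143, 32, 3]).of_eq ?_
    simp [addPath, fourLeafProfile, twoLeafProfile]
    ring

/-- Order eight goes the other way, but only for the unrooted polynomials: the rooted ones compare
oppositely already in degree one (`12` against `13`), so the inequality cannot be propagated by
further attachments. -/
lemma fourLeafProfile_fst_le :
    CoeffNonneg ((addPath twoLeafProfile).1 - fourLeafProfile.1) := by
  refine (CoeffNonneg.horner [0, 0, 0, 2, 12, 20, 9]).of_eq ?_
  simp [addPath, fourLeafProfile, twoLeafProfile]
  ring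

lemma ProfileLE.iterate_add {p q : ℤ[X] × ℤ[X]} {i l : ℕ}
    (h : ProfileLE (_root_.addLeaf^[i] (_root_.addPath^[l] p))
      (_root_.addLeaf^[i] (_root_.addPath^[l] q))) (k j : ℕ) :
    ProfileLE (_root_.addLeaf^[k + i] (_root_.addPath^[j + l] p))
      (_root_.addLeaf^[k + i] (_root_.addPath^[j + l] q)) := by
  have comm := fun p => (commute_addLeaf_addPath.iterate_iterate i j) p
  rw [Function.iterate_add_apply, Function.iterate_add_apply, Function.iterate_add_apply,
    Function.iterate_add_apply, comm, comm]
  exact (h.iterate_addPath j).iterate_addLeaf k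

/-- Every admissible pair lies above one of the three minimal pairs, and both operations are
monotone on profiles. -/
lemma twoLeafProfile_iterate_le_of_large {k j : ℕ} (h : 3 ≤ k + 2 * j) :
    ProfileLE (addLeaf^[k] (addPath^[j] (addPath twoLeafProfile)))
      (addLeaf^[k] (addPath^[j] fourLeafProfile)) := by
  obtain hk | ⟨hk, hj⟩ | hj : 3 ≤ k ∨ (1 ≤ k ∧ 1 ≤ j) ∨ 2 ≤ j := by omega
  · obtain ⟨k, rfl⟩ := Nat.exists_eq_add_of_le' hk
    exact addLeaf_three_twoLeafProfile_le.iterate_add k j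
  · obtain ⟨k, rfl⟩ := Nat.exists_eq_add_of_le' hk
    obtain ⟨j, rfl⟩ := Nat.exists_eq_add_of_le' hj
    exact addLeaf_addPath_twoLeafProfile_le.iterate_add k j
  · obtain ⟨j, rfl⟩ := Nat.exists_eq_add_of_le' hj
    exact addPath_three_twoLeafProfile_le.iterate_add k j

lemma coeff_foldr (l : List ℤ) (i : ℕ) :
    (l.foldr (fun c p => C c + X * p) (0 : ℤ[X])).coeff i = l.getD i 0 := by
  induction l generalizing i with
  | nil => simp
  | cons c l ih =>
    cases i with
    | zero => simp
    | succ i =>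
      rw [List.foldr_cons, coeff_add, coeff_C_succ, coeff_X_mul, zero_add, List.getD_cons_succ]
      exact ih i

/-- The differences of two polynomials with coefficients of both signs. -/
lemma exists_coeff_lt_of_sub_eq {f g : ℤ[X]} {l : List ℤ} {i j : ℕ}
    (h : g - f = l.foldr (fun c p => C c + X * p) 0) (hi : 0 < l.getD i 0) (hj : l.getD j 0 < 0) :
    f.coeff i < g.coeff i ∧ g.coeff j < f.coeff j := by
  rw [← coeff_foldr, ← h, coeff_sub] at hi hj
  constructor <;> linarith

/-- For orders nine and ten the two remaining profiles are incomparable. -/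
lemma extremalProfiles_incomparable {k j : ℕ}
    (h : (k = 1 ∧ j = 0) ∨ (k = 2 ∧ j = 0) ∨ (k = 0 ∧ j = 1)) :
    ∃ i ≤ 7, ∃ i' ≤ 7, (addLeaf^[k] (addPath^[j] (addPath twoLeafProfile))).1.coeff i <
        (addLeaf^[k] (addPath^[j] fourLeafProfile)).1.coeff i ∧
      (addLeaf^[k] (addPath^[j] fourLeafProfile)).1.coeff i' <
        (addLeaf^[k] (addPath^[j] (addPath twoLeafProfile))).1.coeff i' := by
  rcases h with ⟨rfl, rfl⟩ | ⟨rfl, rfl⟩ | ⟨rfl, rfl⟩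
  · refine ⟨2, by norm_num, 6, by norm_num,
      exists_coeff_lt_of_sub_eq (l := [0, 0, 1, 6, 8, -6, -15, -6]) ?_ (by simp) (by simp)⟩
    simp [addPath, addLeaf, fourLeafProfile, twoLeafProfile]
    ring
  · refine ⟨2, by norm_num, 7, by norm_num,
      exists_coeff_lt_of_sub_eq (l := [0, 0, 2, 16, 44, 50, 19, -4, -3]) ?_ (by simp) (by simp)⟩
    simp [addPath, addLeaf, fourLeafProfile, twoLeafProfile]
    ring
  · refine ⟨2, by norm_num, 6, by norm_num,
      exists_coeff_lt_of_sub_eq (l := [0, 0, 1, 8, 20, 12, -15, -16, -3]) ?_ (by simp) (by simp)⟩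
    simp [addPath, fourLeafProfile, twoLeafProfile]
    ring

variable {V : Type*} [Fintype V] {H : SimpleGraph V} {U : Finset V} {m : ℕ}

lemma Dominates.mono {p q : ℤ[X] × ℤ[X]} (h : ProfileLE p q) (hd : Dominates H U q.1 q.2) :
    Dominates H U p.1 p.2 :=
  ⟨h.1.trans hd.poly, fun w hw => h.2.trans (hd.rooted w hw)⟩

lemma HasExtremalBound.lapPoly_two (h : HasExtremalBound H U 2) :
    CoeffNonneg (lapPoly H - (addLeaf^[U.card - 4] cycleProfile).1) := by
  obtain ⟨k, hk, p, hd, ⟨j, hj, rfl⟩ | ⟨j, hj, -⟩ | ⟨j, hj, -⟩⟩ := h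
  · obtain rfl : j = 0 := by omega
    rw [show U.card - 4 = k by omega]
    exact hd.poly
  all_goals omega

/-- The cycle alternative has `j + 1` paths, one of which is traded for the two leaves. -/
lemma HasExtremalBound.lapPoly_or {j : ℕ} (h : HasExtremalBound H U (j + 3)) :
    CoeffNonneg (lapPoly H -
      (addLeaf^[U.card - 2 * (j + 3)] (addPath^[j] twoLeafProfile)).1) ∨
    ∃ i, j = i + 1 ∧ CoeffNonneg (lapPoly H -
      (addLeaf^[U.card - 2 * (j + 3)] (addPath^[i] fourLeafProfile)).1) := by
  obtain ⟨k, hk, p, hd, ⟨i, hj, rfl⟩ | ⟨i, hj, rfl⟩ | ⟨i, hj, rfl⟩⟩ := h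
  · obtain rfl : i = j + 1 := by omega
    left
    rw [show U.card - 2 * (j + 3) = k by omega]
    have := (twoLeafProfile_le_addPath_cycleProfile.iterate_addPath j).iterate_addLeaf k
    rw [Function.iterate_succ_apply] at hd
    exact (hd.mono this).poly
  · obtain rfl : i = j := by omega
    left
    rw [show U.card - 2 * (i + 3) = k by omega]
    exact hd.poly
  · right
    rw [show U.card - 2 * (j + 3) = k by omega]
    exact ⟨i, by omega, hd.poly⟩

end Comparison

/-! ### From signless Laplacian coefficients and matching numbers to the combinatorial setting. -/

section Bridge

variable {V : Type*} {G : SimpleGraph V}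

lemma not_adj_of_colouring {col : V → Bool} (hcol : ∀ x y, G.Adj x y → col x ≠ col y) (a b c : V)
    (hab : G.Adj a b) (hbc : G.Adj b c) : ¬ G.Adj a c := fun hac => by
  have h1 := hcol _ _ hab
  have h2 := hcol _ _ hbc
  have h3 := hcol _ _ hac
  revert h1 h2 h3
  cases col a <;> cases col b <;> cases col c <;> simp

lemma even_girth_of_colouring {col : V → Bool} (hcol : ∀ x y, G.Adj x y → col x ≠ col y) :
    Even G.girth := by
  by_cases hac : G.IsAcyclic
  · rw [SimpleGraph.girth_eq_zero.2 hac]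
    exact Even.zero
  · obtain ⟨a, w, hw, hlen⟩ := SimpleGraph.exists_girth_eq_length.2 hac
    rw [hlen]
    let c : G.Coloring Bool := SimpleGraph.Coloring.mk col fun {x y} h => hcol x y h
    exact (c.even_length_iff_congr w).2 Iff.rfl

variable [Fintype V]

lemma graphMatrix_apply_self (G : SimpleGraph V) (i : V) :
    graphMatrix G i i = 1 + X * (G.degree i : ℤ[X]) := by
  simp only [graphMatrix, Pi.add_apply, Pi.smul_apply, Finset.sum_apply, smul_eq_mul, unitRow_self]
  congr 2
  rw [← SimpleGraph.card_neighborFinset_eq_degree, SimpleGraph.neighborFinset_eq_filter,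
    Finset.card_filter, Nat.cast_sum]
  refine Finset.sum_congr rfl fun y _ => ?_
  split_ifs with h
  · rw [Pi.sub_apply, unitRow_self, unitRow_ne h.ne, sub_zero, Nat.cast_one]
  · simp

lemma graphMatrix_apply_ne (G : SimpleGraph V) {i j : V} (h : i ≠ j) :
    graphMatrix G i j = if G.Adj i j then -X else 0 := by
  simp only [graphMatrix, Pi.add_apply, Pi.smul_apply, Finset.sum_apply, smul_eq_mul,
    unitRow_ne h.symm, zero_add]
  rw [Finset.sum_eq_single j]
  · split_ifs <;> simp [unitRow_ne h.symm, unitRow_self]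
  · intro y _ hy
    split_ifs
    · simp [unitRow_ne h.symm, unitRow_ne hy.symm]
    · rfl
  · simp

/-- The sign of a colour. -/
noncomputable def colourSign (b : Bool) : ℤ[X] := if b then 1 else -1

lemma colourSign_mul_self (b : Bool) : colourSign b * colourSign b = 1 := by
  cases b <;> simp [colourSign]

lemma colourSign_mul_of_ne {a b : Bool} (h : a ≠ b) : colourSign a * colourSign b = -1 := by
  cases a <;> cases b <;> simp_all [colourSign]

/-- Adjacent vertices have opposite signs, so conjugation negates exactly the adjacency part of the
matrix. -/
lemma graphMatrix_eq_conj {col : V → Bool} (hcol : ∀ x y, G.Adj x y → col x ≠ col y) :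
    graphMatrix G = Matrix.diagonal (fun i => colourSign (col i)) *
      (1 + (X : ℤ[X]) • (signlessLaplacian G).map C) *
      Matrix.diagonal (fun i => colourSign (col i)) := by
  ext1 i j
  rw [Matrix.mul_diagonal, Matrix.diagonal_mul]
  by_cases h : i = j
  · subst h
    rw [graphMatrix_apply_self, mul_right_comm, colourSign_mul_self, one_mul]
    simp [signlessLaplacian, SimpleGraph.degMatrix]
  · rw [graphMatrix_apply_ne G h]
    simp only [signlessLaplacian, SimpleGraph.degMatrix, Matrix.add_apply, Matrix.one_apply_ne h,
      Matrix.smul_apply, Matrix.map_apply, Matrix.diagonal_apply_ne _ h, zero_add,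
      SimpleGraph.adjMatrix_apply, smul_eq_mul]
    split_ifs with hadj
    · rw [mul_right_comm, colourSign_mul_of_ne (hcol i j hadj)]
      simp
    · simp

/-- The signless Laplacian coefficients of a bipartite graph are those of `det (1 + X L)`. -/
lemma signlessCoeff_eq_coeff_lapPoly {col : V → Bool} (hcol : ∀ x y, G.Adj x y → col x ≠ col y)
    {i : ℕ} (hi : i ≤ Fintype.card V) : signlessCoeff G i = (lapPoly G).coeff i := by
  -- The reversed characteristic polynomial is `det (1 - X Q)`. Substituting `-X` produces the sign
  -- `(-1) ^ i`, and the reversal produces the index `n - i`.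
  have h1 : lapPoly G = ((signlessLaplacian G).charpolyRev).comp (-X) := by
    rw [lapPoly, graphMatrix_eq_conj hcol, Matrix.det_mul, Matrix.det_mul, mul_right_comm,
      Matrix.det_diagonal, ← Finset.prod_mul_distrib,
      Finset.prod_congr rfl fun i _ => colourSign_mul_self (col i), Finset.prod_const_one, one_mul,
      Matrix.charpolyRev, ← coe_compRingHom_apply, RingHom.map_det]
    congr 1
    ext1 x y
    by_cases hxy : x = y
    · subst hxy; simp
    · simp [Matrix.one_apply_ne hxy]
  rw [h1, show (-X : ℤ[X]) = C (-1) * X by simp, comp_C_mul_X_coeff, ← Matrix.reverse_charpoly,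
    coeff_reverse, Matrix.charpoly_natDegree_eq_dim,
    revAt_le hi,
    signlessCoeff, mul_comm]

lemma IsUnicyclic.isUnicyclicOn (h : IsUnicyclic G)
    (htri : ∀ a b c, G.Adj a b → G.Adj b c → ¬ G.Adj a c) : IsUnicyclicOn G Finset.univ where
  supp _ _ _ := Finset.mem_univ _
  cut A _ hA hne := by
    obtain ⟨a, ha⟩ := hA
    obtain ⟨b, hb⟩ : ∃ b, b ∉ A := by
      by_contra hcon
      push Not at hcon
      exact hne (Finset.eq_univ_iff_forall.2 hcon)
    obtain ⟨p⟩ := h.1.preconnected a b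
    obtain ⟨d, -, h1, h2⟩ := p.exists_boundary_dart (A : Set V) ha hb
    exact ⟨d.fst, h1, d.snd, h2, d.adj⟩
  edges := h.2
  tri := htri

lemma IsUnicyclicOn.isUnicyclic [Nonempty V] (h : IsUnicyclicOn G Finset.univ) : IsUnicyclic G := by
  refine ⟨⟨fun x y => ?_⟩, h.edges⟩
  have : (Finset.univ.filter fun z => G.Reachable x z) = Finset.univ := by
    by_contra hne
    obtain ⟨a, ha, b, hb, hab⟩ := h.cut _ (Finset.subset_univ _)
      ⟨x, Finset.mem_filter.2 ⟨Finset.mem_univ _, .rfl⟩⟩ hne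
    rw [Finset.mem_filter] at ha hb
    exact hb ⟨Finset.mem_univ _, ha.2.trans hab.reachable⟩
  have hy := Finset.mem_univ y
  rw [← this, Finset.mem_filter] at hy
  exact hy.2

/-- A unicyclic graph of even girth is bipartite. -/
lemma IsUnicyclic.exists_colouring (h : IsUnicyclic G) (hg : Even G.girth) :
    ∃ col : V → Bool, ∀ x y, G.Adj x y → col x ≠ col y := by
  have hac : ¬ G.IsAcyclic := fun hac => by
    have h1 := (SimpleGraph.isTree_iff_connected_and_card.1 ⟨h.1, hac⟩).2
    have h2 := h.2
    rw [← Nat.card_coe_set_eq] at h2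
    rw [Nat.card_eq_fintype_card (α := V)] at h1
    omega
  obtain ⟨a, w, hw, hlen⟩ := SimpleGraph.exists_girth_eq_length.2 hac
  rw [hlen] at hg
  cases w with
  | nil => exact absurd rfl hw.ne_nil
  | @cons _ v _ hadj p =>
    have hpe := (SimpleGraph.Walk.cons_isCycle_iff p hadj).1 hw
    have hb : ¬ G.IsBridge s(a, v) := fun hb =>
      SimpleGraph.isBridge_iff_forall_cycle_notMem (G.mem_edgeSet.2 hadj) |>.1 hb _ hw (by simp)
    -- Deleting an edge of a shortest cycle leaves a tree, which is 2-colourable. The rest of the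
    -- cycle is a path of odd length in it, so the ends of the deleted edge have different colours
    -- as well.
    have hconn := h.1.connected_delete_edge_of_not_isBridge hb
    have htree : (G.deleteEdges {s(a, v)}).IsTree := by
      rw [SimpleGraph.isTree_iff_connected_and_card]
      refine ⟨hconn, ?_⟩
      rw [Nat.card_coe_set_eq, SimpleGraph.edgeSet_deleteEdges,
        Set.ncard_sdiff_singleton_add_one (G.mem_edgeSet.2 hadj), h.2, Nat.card_eq_fintype_card]
    obtain ⟨c⟩ := htree.isBipartite
    let c' : (G.deleteEdges {s(a, v)}).Coloring Bool :=
      SimpleGraph.recolorOfEquiv _ finTwoEquiv c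
    have hc' : c' v ≠ c' a := by
      have := c'.odd_length_iff_not_congr (p.toDeleteEdge s(a, v) hpe.2)
      have hl : Odd (p.toDeleteEdge s(a, v) hpe.2).length := by
        rw [SimpleGraph.Walk.length_cons, Nat.even_add_one, Nat.not_even_iff_odd] at hg
        simpa [SimpleGraph.Walk.toDeleteEdge, SimpleGraph.Walk.toDeleteEdges] using hg
      have := this.1 hl
      grind
    refine ⟨c', fun x y hxy => ?_⟩
    by_cases he : s(x, y) = s(a, v)
    · rcases Sym2.eq_iff.1 he with ⟨rfl, rfl⟩ | ⟨rfl, rfl⟩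
      · exact hc'.symm
      · exact hc'
    · exact c'.valid (by rw [SimpleGraph.deleteEdges_adj]; exact ⟨hxy, by simpa using he⟩)

/-- The handshake identity for the matching regarded as a spanning graph: the degrees are one on its
vertices and zero elsewhere. -/
lemma two_mul_ncard_edgeSet_of_isMatching {M : G.Subgraph} (hM : M.IsMatching) :
    2 * M.edgeSet.ncard = M.verts.ncard := by
  have h := sum_card_nbrs M.spanningCoe
  rw [SimpleGraph.Subgraph.edgeSet_spanningCoe] at h
  rw [← h, Set.ncard_eq_toFinset_card', ← Finset.sum_subset (Finset.subset_univ M.verts.toFinset),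
    Finset.card_eq_sum_ones]
  · refine Finset.sum_congr rfl fun v hv => ?_
    obtain ⟨w, hw, hw'⟩ := hM (Set.mem_toFinset.1 hv)
    exact card_nbrs_eq_one (u := w) fun j => ⟨hw' j, fun e => e ▸ hw⟩
  · intro v _ hv
    rw [Finset.card_eq_zero, Finset.eq_empty_iff_forall_notMem]
    exact fun j hj => hv (Set.mem_toFinset.2 (M.edge_vert (mem_nbrs.1 hj)))

lemma exists_isMatchingMap_of_isMatching {M : G.Subgraph} (hM : M.IsMatching) :
    ∃ mt, IsMatchingMap G mt ∧
      (Finset.univ.filter fun v => mt v ≠ v).card = 2 * M.edgeSet.ncard := by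
  have hex : ∀ v, ∃ w, (v ∈ M.verts → M.Adj v w) ∧ (v ∉ M.verts → w = v) := fun v => by
    by_cases hv : v ∈ M.verts
    · obtain ⟨w, hw, -⟩ := hM hv
      exact ⟨w, fun _ => hw, fun h => absurd hv h⟩
    · exact ⟨v, fun h => absurd h hv, fun _ => rfl⟩
  choose mt h1 h2 using hex
  refine ⟨mt, ⟨fun v => ?_, fun v hv => ?_⟩, ?_⟩
  · by_cases hv : v ∈ M.verts
    · have ha := (h1 v hv).symm
      exact (hM (M.edge_vert ha)).unique (h1 _ (M.edge_vert ha)) ha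
    · rw [h2 v hv, h2 v hv]
  · by_cases hv' : v ∈ M.verts
    · exact (h1 v hv').adj_sub
    · exact absurd (h2 v hv') hv
  · rw [two_mul_ncard_edgeSet_of_isMatching hM, Set.ncard_eq_toFinset_card']
    congr 1
    ext v
    rw [Finset.mem_filter, Set.mem_toFinset]
    refine ⟨fun h => ?_, fun h => ⟨Finset.mem_univ _, (h1 v h).ne.symm⟩⟩
    by_contra hv
    exact h.2 (h2 v hv)

lemma IsMatchingMap.exists_isMatching {mt : V → V} (hm : IsMatchingMap G mt) {m : ℕ}
    (hcard : (Finset.univ.filter fun v => mt v ≠ v).card = 2 * m) :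
    ∃ M : G.Subgraph, M.IsMatching ∧ M.edgeSet.ncard = m := by
  let M : G.Subgraph :=
    { verts := {v | mt v ≠ v}
      Adj := fun v w => mt v = w ∧ v ≠ w
      adj_sub := fun {v w} h => h.1 ▸ hm.adj v fun e => h.2 (e ▸ h.1)
      edge_vert := fun {v w} h e => h.2 (e.symm.trans h.1)
      symm := ⟨fun v w h => ⟨by rw [← h.1, hm.invol], h.2.symm⟩⟩ }
  have hM : M.IsMatching := fun v hv => ⟨mt v, ⟨rfl, Ne.symm hv⟩, fun w hw => hw.1.symm⟩
  refine ⟨M, hM, ?_⟩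
  have h1 := two_mul_ncard_edgeSet_of_isMatching hM
  have h2 : M.verts.ncard = 2 * m := by
    rw [← hcard, Set.ncard_eq_toFinset_card']
    congr 1
    ext v
    simp [M]
  omega

/-- A matching and a vertex cover of the same size determine the matching number. -/
lemma IsMatchingMap.hasMatchingNumber {mt : V → V} (hm : IsMatchingMap G mt) {m : ℕ}
    (hcard : (Finset.univ.filter fun v => mt v ≠ v).card = 2 * m) {K : Finset V}
    (hK : K.card = m) (hcover : ∀ x y, G.Adj x y → x ∈ K ∨ y ∈ K) : HasMatchingNumber G m := by
  refine ⟨hm.exists_isMatching hcard, ?_⟩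
  rintro k ⟨M, hM, rfl⟩
  obtain ⟨mt', hm', hc'⟩ := exists_isMatchingMap_of_isMatching hM
  -- Each edge of the other matching meets the cover, so its matched vertices are cover vertices or
  -- partners of such.
  have hsub : (Finset.univ.filter fun v => mt' v ≠ v) ⊆ K ∪ K.image mt' := fun v hv => by
    rw [Finset.mem_union, Finset.mem_image]
    rcases hcover _ _ (hm'.adj v (Finset.mem_filter.1 hv).2) with h | h
    · exact Or.inl h
    · exact Or.inr ⟨_, h, hm'.invol v⟩
  have h1 := (Finset.card_le_card hsub).trans (Finset.card_union_le _ _)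
  have h2 := Finset.card_image_le (s := K) (f := mt')
  omega

end Bridge

/-! ### Graphs that attain a profile exactly. -/

section Models

variable {V : Type*} {H : SimpleGraph V} {U : Finset V}

/-- `H` has a matching that covers exactly the vertices of `A`. -/
def HasMatchingOn (H : SimpleGraph V) (A : Finset V) : Prop :=
  ∃ mt, IsMatchingMap H mt ∧ ∀ x, mt x ≠ x ↔ x ∈ A

lemma hasMatchingOn_empty (H : SimpleGraph V) : HasMatchingOn H ∅ :=
  ⟨id, ⟨fun _ => rfl, fun _ h => absurd rfl h⟩, by simp⟩

lemma HasMatchingOn.mono {H' : SimpleGraph V} {A : Finset V} (h : HasMatchingOn H A)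
    (hle : H ≤ H') : HasMatchingOn H' A := by
  obtain ⟨mt, hm, hA⟩ := h
  exact ⟨mt, ⟨hm.invol, fun v hv => hle (hm.adj v hv)⟩, hA⟩

lemma HasMatchingOn.insert {A : Finset V} (h : HasMatchingOn H A) {a b : V} (hab : H.Adj a b)
    (ha : a ∉ A) (hb : b ∉ A) : HasMatchingOn H (insert a (insert b A)) := by
  obtain ⟨mt, hm, hA⟩ := h
  have hma : mt a = a := by by_contra h; exact ha ((hA a).1 h)
  have hmb : mt b = b := by by_contra h; exact hb ((hA b).1 h)
  have hne := hab.ne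
  have key : ∀ x, x ≠ a → x ≠ b → mt x ≠ a ∧ mt x ≠ b := fun x h1 h2 =>
    ⟨fun e => h1 (by rw [← hm.invol x, e, hma]), fun e => h2 (by rw [← hm.invol x, e, hmb])⟩
  refine ⟨fun x => if x = a then b else if x = b then a else mt x, ⟨fun x => ?_, fun x hx => ?_⟩,
    fun x => ?_⟩
  · by_cases h1 : x = a
    · simp [h1, hne.symm]
    · by_cases h2 : x = b
      · simp [h2, hne.symm]
      · have := key x h1 h2
        simp [h1, h2, this, hm.invol]
  · by_cases h1 : x = a
    · simpa [h1] using hab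
    · by_cases h2 : x = b
      · simpa [h2, hne.symm] using hab.symm
      · simp only [h1, h2, if_false] at hx ⊢
        exact hm.adj x hx
  · by_cases h1 : x = a
    · simp [h1, hne.symm]
    · by_cases h2 : x = b
      · simp [h2, hne.symm, hne]
      · simp [h1, h2, hA]

lemma IsUnicyclicOn.not_adj (hH : IsUnicyclicOn H U) {v : V} (hv : v ∉ U) (j : V) : ¬ H.Adj v j :=
  fun h => hv (hH.supp v j h)

lemma exists_colouring_sup_leaf {u v : V} (huv : u ≠ v) (hv : ∀ j, ¬ H.Adj v j)
    (h : ∃ col : V → Bool, ∀ x y, H.Adj x y → col x ≠ col y) :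
    ∃ col : V → Bool, ∀ x y, (H ⊔ SimpleGraph.edge u v).Adj x y → col x ≠ col y := by
  obtain ⟨col, hcol⟩ := h
  refine ⟨Function.update col v (!col u), fun x y hxy => ?_⟩
  rw [SimpleGraph.sup_adj, SimpleGraph.edge_adj] at hxy
  rcases hxy with hxy | ⟨⟨rfl, rfl⟩ | ⟨rfl, rfl⟩, -⟩
  · have hx : x ≠ v := fun e => hv y (e ▸ hxy)
    have hy : y ≠ v := fun e => hv x (e ▸ hxy.symm)
    rw [Function.update_of_ne hx, Function.update_of_ne hy]
    exact hcol x y hxy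
  · simp [huv]
  · simp [huv]

variable [Fintype V]

lemma IsUnicyclicOn.sup_leaf (hH : IsUnicyclicOn H U) {u v : V} (hu : u ∈ U) (hv : v ∉ U) :
    IsUnicyclicOn (H ⊔ SimpleGraph.edge u v) (insert v U) := by
  have huv : u ≠ v := fun e => hv (e ▸ hu)
  have hi := hH.not_adj hv
  refine ⟨fun x y hxy => ?_, fun A hA hne hAU => ?_, ?_, fun a b c h1 h2 h3 => ?_⟩
  · rw [SimpleGraph.sup_adj, SimpleGraph.edge_adj] at hxy
    rcases hxy with hxy | ⟨⟨rfl, -⟩ | ⟨rfl, -⟩, -⟩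
    · exact Finset.mem_insert_of_mem (hH.supp _ _ hxy)
    · exact Finset.mem_insert_of_mem hu
    · exact Finset.mem_insert_self ..
  · simp only [SimpleGraph.sup_adj, SimpleGraph.edge_adj]
    have hA' : A.erase v ⊆ U := fun x hx =>
      (Finset.mem_insert.1 (hA (Finset.mem_of_mem_erase hx))).resolve_left (Finset.ne_of_mem_erase hx)
    by_cases h0 : (A.erase v).Nonempty
    · by_cases h1 : A.erase v = U
      · have hvA : v ∉ A := fun hvA => hAU (by rw [← h1, Finset.insert_erase hvA])
        rw [Finset.erase_eq_of_notMem hvA] at h1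
        exact ⟨u, h1 ▸ hu, v, hvA, Or.inr ⟨Or.inl ⟨rfl, rfl⟩, huv⟩⟩
      · obtain ⟨a, ha, b, hb, hab⟩ := hH.cut _ hA' h0 h1
        refine ⟨a, Finset.mem_of_mem_erase ha, b, fun hbA => hb (Finset.mem_erase.2 ⟨?_, hbA⟩),
          Or.inl hab⟩
        rintro rfl
        exact hi a hab.symm
    · have hAv : A = {v} := by
        rw [Finset.not_nonempty_iff_eq_empty, Finset.erase_eq_empty_iff] at h0
        exact h0.resolve_left hne.ne_empty
      exact ⟨v, by simp [hAv], u, by simp [hAv, huv], Or.inr ⟨Or.inr ⟨rfl, rfl⟩, huv.symm⟩⟩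
  · rw [ncard_edgeSet_sup_edge huv fun h => hi u h.symm, hH.edges, Finset.card_insert_of_notMem hv]
  · rw [SimpleGraph.sup_adj, SimpleGraph.edge_adj] at h1 h2 h3
    have := hH.tri a b c
    have := H.adj_comm a b
    have := H.adj_comm b c
    have := H.adj_comm a c
    have := H.irrefl (v := a)
    have := H.irrefl (v := b)
    have := hi a
    have := hi b
    have := hi c
    grind

/-- A bipartite unicyclic graph with matching number `m` whose polynomials form the profile `p`
at the root `u`. -/
structure IsModel (H : SimpleGraph V) (U : Finset V) (u : V) (m : ℕ) (p : ℤ[X] × ℤ[X]) : Prop where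
  lap : lapPoly H = p.1
  root : rootPoly H u = p.2
  uni : IsUnicyclicOn H U
  mem : u ∈ U
  colour : ∃ col : V → Bool, ∀ x y, H.Adj x y → col x ≠ col y
  matching : ∃ A ⊆ U, A.card = 2 * m ∧ HasMatchingOn H A
  cover : ∃ K ⊆ U, K.card = m ∧ u ∈ K ∧ ∀ x y, H.Adj x y → x ∈ K ∨ y ∈ K

variable {u : V} {m : ℕ} {p : ℤ[X] × ℤ[X]}

/-- Attachment at the distinguished vertex follows the leaf recursion with equality. Since `u` is in
the cover, the new edge is covered and the matching number does not grow. -/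
lemma IsModel.leaf (h : IsModel H U u m p) {v : V} (hv : v ∉ U) :
    IsModel (H ⊔ SimpleGraph.edge u v) (insert v U) u m (addLeaf p) := by
  have huv : u ≠ v := fun e => hv (e ▸ h.mem)
  have hi := isIsolated_graphMatrix (h.uni.not_adj hv)
  have hm := graphMatrix_sup_edge huv fun e => h.uni.not_adj hv u e.symm
  refine ⟨?_, ?_, h.uni.sup_leaf h.mem hv, Finset.mem_insert_of_mem h.mem,
    exists_colouring_sup_leaf huv (h.uni.not_adj hv) h.colour, ?_, ?_⟩
  · rw [lapPoly, hm, det_addEdge_leaf huv hi, ← lapPoly, ← rootPoly, h.lap, h.root, addLeaf]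
  · rw [rootPoly, hm, det_root_addEdge_leaf_left huv hi, ← rootPoly, h.root, addLeaf]
  · obtain ⟨A, hA, hc, hmat⟩ := h.matching
    exact ⟨A, hA.trans (Finset.subset_insert ..), hc, hmat.mono le_sup_left⟩
  · obtain ⟨K, hKU, hK, huK, hcov⟩ := h.cover
    refine ⟨K, hKU.trans (Finset.subset_insert ..), hK, huK, fun x y hxy => ?_⟩
    rw [SimpleGraph.sup_adj, SimpleGraph.edge_adj] at hxy
    rcases hxy with hxy | ⟨⟨rfl, -⟩ | ⟨-, rfl⟩, -⟩
    · exact hcov x y hxy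
    · exact Or.inl huK
    · exact Or.inr huK

/-- The edge `qv` joins the matching and `q` joins the cover, so both certificates grow by one. -/
lemma IsModel.path (h : IsModel H U u m p) {q v : V} (hq : q ∉ U) (hv : v ∉ U) (hqv : q ≠ v) :
    IsModel ((H ⊔ SimpleGraph.edge u q) ⊔ SimpleGraph.edge q v) (insert v (insert q U)) u (m + 1)
      (addPath p) := by
  have huq : u ≠ q := fun e => hq (e ▸ h.mem)
  have huv : u ≠ v := fun e => hv (e ▸ h.mem)
  have hv' : v ∉ insert q U := by simp [hqv.symm, hv]
  have h1 := h.uni.sup_leaf h.mem hq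
  have h2 := h1.sup_leaf (Finset.mem_insert_self ..) hv'
  have hi := isIsolated_graphMatrix (h.uni.not_adj hq)
  have hi' := isIsolated_graphMatrix (h1.not_adj hv')
  have hm := graphMatrix_sup_edge huq fun e => h.uni.not_adj hq u e.symm
  have hm' := graphMatrix_sup_edge hqv fun e => h1.not_adj hv' q e.symm
  refine ⟨?_, ?_, h2, Finset.mem_insert_of_mem (Finset.mem_insert_of_mem h.mem),
    exists_colouring_sup_leaf hqv (h1.not_adj hv')
      (exists_colouring_sup_leaf huq (h.uni.not_adj hq) h.colour), ?_, ?_⟩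
  · rw [lapPoly, hm', det_addEdge_leaf hqv hi', hm, det_addEdge_leaf huq hi,
      det_root_addEdge_leaf_right huq hi, ← lapPoly, ← rootPoly, h.lap, h.root, addPath]
    ring
  · rw [rootPoly, hm', det_root_addEdge_leaf_ne hqv huq huv hi', hm,
      det_root_addEdge_leaf_left huq hi, root_root_addEdge huq,
      root_of_row_eq (hi.root huq.symm).row, ← rootPoly, h.root, addPath]
    ring
  · obtain ⟨A, hA, hc, hmat⟩ := h.matching
    have hvA : v ∉ A := fun e => hv (hA e)
    have hqA : q ∉ A := fun e => hq (hA e)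
    refine ⟨insert v (insert q A), Finset.insert_subset_insert _ (Finset.insert_subset_insert _ hA),
      ?_, (hmat.mono (le_sup_left.trans le_sup_left)).insert ?_ hvA hqA⟩
    · rw [Finset.card_insert_of_notMem (by simp [hqv.symm, hvA]), Finset.card_insert_of_notMem hqA,
        hc]
      ring
    · exact Or.inr ((SimpleGraph.edge_adj ..).2 ⟨Or.inr ⟨rfl, rfl⟩, hqv.symm⟩)
  · obtain ⟨K, hKU, hK, huK, hcov⟩ := h.cover
    refine ⟨insert q K, (Finset.insert_subset_insert q hKU).trans (Finset.subset_insert ..), ?_,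
      Finset.mem_insert_of_mem huK, fun x y hxy => ?_⟩
    · rw [Finset.card_insert_of_notMem fun e => hq (hKU e), hK]
    · simp only [SimpleGraph.sup_adj, SimpleGraph.edge_adj] at hxy
      simp only [Finset.mem_insert]
      have := hcov x y
      grind

lemma IsModel.leaves (h : IsModel H U u m p) {ι : Type*} {f : ι → V} (hf : Function.Injective f)
    (S : Finset ι) (hfU : ∀ i ∈ S, f i ∉ U) :
    IsModel (H ⊔ ⨆ i ∈ S, SimpleGraph.edge u (f i)) (S.image f ∪ U) u m (addLeaf^[S.card] p) := by
  induction S using Finset.induction_on with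
  | empty => simpa using h
  | insert k S hk ih =>
    have h1 := ih fun i hi => hfU i (Finset.mem_insert_of_mem hi)
    rw [Finset.iSup_insert, sup_comm (SimpleGraph.edge _ _), ← sup_assoc, Finset.image_insert,
      Finset.insert_union, Finset.card_insert_of_notMem hk, Function.iterate_succ_apply']
    refine h1.leaf ?_
    rw [Finset.mem_union, Finset.mem_image, not_or]
    exact ⟨fun ⟨i, hi, e⟩ => hk (hf e ▸ hi), hfU k (Finset.mem_insert_self ..)⟩

lemma IsModel.paths (h : IsModel H U u m p) {ι : Type*} {f g : ι → V} (hf : Function.Injective f)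
    (hg : Function.Injective g) (hfg : ∀ i j, f i ≠ g j) (S : Finset ι) (hfU : ∀ i ∈ S, f i ∉ U)
    (hgU : ∀ i ∈ S, g i ∉ U) :
    IsModel (H ⊔ ⨆ i ∈ S, (SimpleGraph.edge u (f i) ⊔ SimpleGraph.edge (f i) (g i)))
      (S.image g ∪ S.image f ∪ U) u (m + S.card) (addPath^[S.card] p) := by
  induction S using Finset.induction_on with
  | empty => simpa using h
  | insert k S hk ih =>
    have h1 := ih (fun i hi => hfU i (Finset.mem_insert_of_mem hi))
      fun i hi => hgU i (Finset.mem_insert_of_mem hi)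
    rw [Finset.iSup_insert, sup_comm (_ ⊔ SimpleGraph.edge _ _), ← sup_assoc, ← sup_assoc,
      Finset.image_insert, Finset.image_insert, Finset.insert_union, Finset.union_insert,
      Finset.insert_union, Finset.insert_union, Finset.card_insert_of_notMem hk,
      Function.iterate_succ_apply', ← add_assoc]
    refine h1.path ?_ ?_ (hfg k k)
    · simp only [Finset.mem_union, Finset.mem_image, not_or]
      exact ⟨⟨fun ⟨i, hi, e⟩ => hfg _ _ e.symm, fun ⟨i, hi, e⟩ => hk (hf e ▸ hi)⟩,
        hfU k (Finset.mem_insert_self ..)⟩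
    · simp only [Finset.mem_union, Finset.mem_image, not_or]
      exact ⟨⟨fun ⟨i, hi, e⟩ => hk (hg e ▸ hi), fun ⟨i, hi, e⟩ => hfg _ _ e⟩,
        hgU k (Finset.mem_insert_self ..)⟩

lemma IsModel.isEvenUnicyclic (h : IsModel H Finset.univ u m p) {n : ℕ}
    (hn : Fintype.card V = n) : IsEvenUnicyclic n m H where
  card_eq := hn
  unicyclic := by
    have : Nonempty V := ⟨u⟩
    exact h.uni.isUnicyclic
  matching := by
    obtain ⟨A, -, hA, mt, hm, hmA⟩ := h.matching
    obtain ⟨K, -, hK, -, hcov⟩ := h.cover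
    refine hm.hasMatchingNumber ?_ hK hcov
    rw [← hA]
    congr 1
    ext x
    simp [hmA]
  even_girth := by
    obtain ⟨col, hcol⟩ := h.colour
    exact even_girth_of_colouring hcol

lemma IsModel.signlessCoeff_eq (h : IsModel H Finset.univ u m p) {i : ℕ}
    (hi : i ≤ Fintype.card V) : signlessCoeff H i = p.1.coeff i := by
  obtain ⟨col, hcol⟩ := h.colour
  rw [signlessCoeff_eq_coeff_lapPoly hcol hi, h.lap]

end Models

/-! ### The three base graphs as models. -/

section BaseModels

variable {V : Type*} {H : SimpleGraph V} {c : Fin 4 → V}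

lemma IsFourCycle.adj_iff (hc : Function.Injective c) (h : IsFourCycle H c) (i k : Fin 4) :
    H.Adj (c i) (c k) ↔ i = k + 1 ∨ k = i + 1 := by
  rw [h, ← cycleGraph_four_adj]
  constructor
  · rintro ⟨i', k', e1, e2, e3⟩
    rwa [hc e1, hc e2]
  · exact fun e => ⟨i, k, rfl, rfl, e⟩

lemma IsFourCycle.exists_colouring (hc : Function.Injective c) (h : IsFourCycle H c) :
    ∃ col : V → Bool, ∀ x y, H.Adj x y → col x ≠ col y := by
  refine ⟨fun x => decide (x = c 0 ∨ x = c 2), fun x y hxy => ?_⟩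
  obtain ⟨i, k, rfl, rfl, hik⟩ := (h x y).1 hxy
  rw [cycleGraph_four_adj] at hik
  simp only [hc.eq_iff, ne_eq, decide_eq_decide]
  clear hxy
  revert i k
  decide

variable [Fintype V]

lemma IsFourCycle.isUnicyclicOn (hc : Function.Injective c) (h : IsFourCycle H c) :
    IsUnicyclicOn H (Finset.univ.image c) where
  supp x y hxy := by
    obtain ⟨i, -, rfl, -⟩ := (h x y).1 hxy
    exact Finset.mem_image_of_mem c (Finset.mem_univ i)
  cut A hA hne hAU := by
    have key : ∀ B : Finset (Fin 4), B.Nonempty → B ≠ Finset.univ → ∃ i ∈ B, i + 1 ∉ B := by decide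
    obtain ⟨i, hi, hi'⟩ := key (Finset.univ.filter fun i => c i ∈ A) (by
      obtain ⟨a, ha⟩ := hne
      obtain ⟨i, -, rfl⟩ := Finset.mem_image.1 (hA ha)
      exact ⟨i, by simpa using ha⟩) fun e => hAU (Finset.Subset.antisymm hA fun x hx => by
        obtain ⟨i, -, rfl⟩ := Finset.mem_image.1 hx
        have := Finset.mem_univ i
        rw [← e] at this
        exact (Finset.mem_filter.1 this).2)
    simp only [Finset.mem_filter, Finset.mem_univ, true_and] at hi hi'
    exact ⟨c i, hi, c (i + 1), hi', (h.adj_iff hc _ _).2 (Or.inr rfl)⟩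
  edges := by
    have h1 := sum_card_nbrs H
    have h2 : ∀ i, (nbrs H (c i)).card = 2 := fun i => by
      refine Finset.card_eq_two.2 ⟨c (i + 1), c (i - 1), hc.ne ?_, ?_⟩
      · revert i; decide
      · ext y
        rw [mem_nbrs, Finset.mem_insert, Finset.mem_singleton]
        constructor
        · intro hy
          obtain ⟨i', k, e, rfl, hk⟩ := (h _ _).1 hy
          obtain rfl := hc e
          rcases (cycleGraph_four_adj _ _).1 hk with rfl | rfl
          · right; rw [add_sub_cancel_right]
          · exact Or.inl rfl
        · rintro (rfl | rfl)
          · exact (h.adj_iff hc _ _).2 (Or.inr rfl)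
          · exact (h.adj_iff hc _ _).2 (Or.inl (sub_add_cancel i 1).symm)
    rw [← Finset.sum_subset (Finset.subset_univ (Finset.univ.image c)), Finset.sum_image
      fun _ _ _ _ e => hc e, Finset.sum_congr rfl fun i _ => h2 i] at h1
    · rw [Finset.card_image_of_injective _ hc]
      simp at h1 ⊢
      omega
    · intro v _ hv
      rw [Finset.card_eq_zero, Finset.eq_empty_iff_forall_notMem]
      exact fun j hj => h.not_adj (fun k e => hv (by
        rw [e]; exact Finset.mem_image_of_mem c (Finset.mem_univ k))) j (mem_nbrs.1 hj)
  tri := by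
    obtain ⟨col, hcol⟩ := h.exists_colouring hc
    exact not_adj_of_colouring hcol

lemma IsFourCycle.isModel (hc : Function.Injective c) (h : IsFourCycle H c) :
    IsModel H (Finset.univ.image c) (c 0) 2 cycleProfile := by
  have hmem : ∀ k, c k ∈ Finset.univ.image c := fun k =>
    Finset.mem_image_of_mem c (Finset.mem_univ k)
  have hne : ∀ i k, i ≠ k → c i ≠ c k := fun i k => hc.ne
  refine ⟨(rootedPoly_cycle hc h).1, (rootedPoly_cycle hc h).2 0, h.isUnicyclicOn hc, hmem 0,
    h.exists_colouring hc, ?_, ?_⟩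
  · refine ⟨_, Finset.insert_subset (hmem 0) (Finset.insert_subset (hmem 1)
      (Finset.insert_subset (hmem 2) (Finset.insert_subset (hmem 3) (Finset.empty_subset _)))), ?_,
      ((hasMatchingOn_empty H).insert (a := c 2) (b := c 3) ((h.adj_iff hc _ _).2 (by decide))
        (by simp) (by simp)).insert (a := c 0) (b := c 1) ((h.adj_iff hc _ _).2 (by decide)) ?_ ?_⟩
    · rw [Finset.card_insert_of_notMem, Finset.card_insert_of_notMem, Finset.card_insert_of_notMem,
        Finset.card_insert_of_notMem] <;> simp [hc.eq_iff]
    all_goals simp [hc.eq_iff]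
  · refine ⟨{c 0, c 2}, by simp [Finset.insert_subset_iff], Finset.card_pair (hne _ _ (by decide)),
      by simp, fun x y hxy => ?_⟩
    obtain ⟨i, k, rfl, rfl, hik⟩ := (h x y).1 hxy
    rw [cycleGraph_four_adj] at hik
    simp only [Finset.mem_insert, Finset.mem_singleton, hc.eq_iff]
    clear hxy
    revert i k
    decide

/-- The matching consists of both pendent edges and the opposite cycle edge; the cover of the same
size is `c 0`, `c 1`, `c 2`. -/
lemma IsFourCycle.isModel_twoLeaf (hc : Function.Injective c) (h : IsFourCycle H c) {l₀ l₁ : V}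
    (h0 : ∀ k, l₀ ≠ c k) (h1 : ∀ k, l₁ ≠ c k) (h01 : l₀ ≠ l₁) :
    IsModel ((H ⊔ SimpleGraph.edge (c 0) l₀) ⊔ SimpleGraph.edge (c 1) l₁)
      (insert l₁ (insert l₀ (Finset.univ.image c))) (c 0) 3 twoLeafProfile := by
  have hmem : ∀ k, c k ∈ Finset.univ.image c := fun k =>
    Finset.mem_image_of_mem c (Finset.mem_univ k)
  have hmem' : ∀ k, c k ∈ insert l₁ (insert l₀ (Finset.univ.image c)) := fun k =>
    Finset.mem_insert_of_mem (Finset.mem_insert_of_mem (hmem k))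
  have hl0 : l₀ ∉ Finset.univ.image c := by simpa [eq_comm] using h0
  have hl1 : l₁ ∉ insert l₀ (Finset.univ.image c) := by
    rw [Finset.mem_insert, not_or]
    exact ⟨h01.symm, by simpa [eq_comm] using h1⟩
  have hu0 := h.isUnicyclicOn hc
  have hu1 := hu0.sup_leaf (hmem 0) hl0
  refine ⟨(rootedPoly_twoLeaf_values hc h h0 h1 h01).1, (rootedPoly_twoLeaf_values hc h h0 h1 h01).2.1,
    hu1.sup_leaf (Finset.mem_insert_of_mem (hmem 1)) hl1, hmem' 0,
    exists_colouring_sup_leaf (h1 1).symm (hu1.not_adj hl1)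
      (exists_colouring_sup_leaf (h0 0).symm (hu0.not_adj hl0) (h.exists_colouring hc)), ?_, ?_⟩
  · refine ⟨_, Finset.insert_subset (hmem' 0) (Finset.insert_subset (Finset.mem_insert_of_mem
      (Finset.mem_insert_self ..)) (Finset.insert_subset (hmem' 1)
      (Finset.insert_subset (Finset.mem_insert_self ..) (Finset.insert_subset (hmem' 2)
      (Finset.insert_subset (hmem' 3) (Finset.empty_subset _)))))), ?_,
      (((hasMatchingOn_empty _).insert (a := c 2) (b := c 3)
        (Or.inl (Or.inl ((h.adj_iff hc _ _).2 (by decide)))) (by simp) (by simp)).insert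
        (a := c 1) (b := l₁) (Or.inr ((SimpleGraph.edge_adj ..).2 ⟨Or.inl ⟨rfl, rfl⟩, (h1 1).symm⟩))
        ?_ ?_).insert (a := c 0) (b := l₀) (Or.inl (Or.inr ((SimpleGraph.edge_adj ..).2
          ⟨Or.inl ⟨rfl, rfl⟩, (h0 0).symm⟩))) ?_ ?_⟩
    · rw [Finset.card_insert_of_notMem, Finset.card_insert_of_notMem, Finset.card_insert_of_notMem,
        Finset.card_insert_of_notMem, Finset.card_insert_of_notMem,
        Finset.card_insert_of_notMem] <;> simp [hc.eq_iff, h0, h1, h01, (h0 _).symm, (h1 _).symm]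
    all_goals simp [hc.eq_iff, h0, h1, h01, (h1 _).symm]
  · refine ⟨{c 0, c 1, c 2}, by simp [Finset.insert_subset_iff], ?_, by simp, fun x y hxy => ?_⟩
    · rw [Finset.card_insert_of_notMem, Finset.card_insert_of_notMem, Finset.card_singleton] <;>
        simp [hc.eq_iff]
    · simp only [SimpleGraph.sup_adj, SimpleGraph.edge_adj] at hxy
      rcases hxy with (hxy | hxy) | hxy
      · obtain ⟨i, k, rfl, rfl, hik⟩ := (h x y).1 hxy
        rw [cycleGraph_four_adj] at hik
        simp only [Finset.mem_insert, Finset.mem_singleton, hc.eq_iff]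
        clear hxy
        revert i k
        decide
      · simp only [Finset.mem_insert, Finset.mem_singleton]
        tauto
      · simp only [Finset.mem_insert, Finset.mem_singleton]
        tauto

lemma IsFourCycle.isModel_fourLeaf (hc : Function.Injective c) (h : IsFourCycle H c)
    {l : Fin 4 → V} (hl : Function.Injective l) (hcl : ∀ i k, l i ≠ c k) :
    IsModel (attachLeaves H c l) (insert (l 3) (insert (l 2) (insert (l 1) (insert (l 0)
      (Finset.univ.image c))))) (c 0) 4 fourLeafProfile := by
  have hmem : ∀ k, c k ∈ Finset.univ.image c := fun k =>
    Finset.mem_image_of_mem c (Finset.mem_univ k)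
  have hl0 : l 0 ∉ Finset.univ.image c := by simp [(hcl _ _).symm]
  have hl1 : l 1 ∉ insert (l 0) (Finset.univ.image c) := by simp [(hcl _ _).symm, hl.eq_iff]
  have hl2 : l 2 ∉ insert (l 1) (insert (l 0) (Finset.univ.image c)) := by
    simp [(hcl _ _).symm, hl.eq_iff]
  have hl3 : l 3 ∉ insert (l 2) (insert (l 1) (insert (l 0) (Finset.univ.image c))) := by
    simp [(hcl _ _).symm, hl.eq_iff]
  have hu0 := h.isUnicyclicOn hc
  have hu1 := hu0.sup_leaf (hmem 0) hl0
  have hu2 := hu1.sup_leaf (u := c 1) (by simp) hl1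
  have hu3 := hu2.sup_leaf (u := c 2) (by simp) hl2
  have hu4 := hu3.sup_leaf (u := c 3) (by simp) hl3
  have hadj : ∀ i, (attachLeaves H c l).Adj (c i) (l i) := fun i =>
    ((attachLeaves_adj_leaf h hl hcl i (c i)).2 rfl).symm
  have hlc : ∀ i k, c k ≠ l i := fun i k => (hcl i k).symm
  refine ⟨(rootedPoly_fourLeaf_values hc h hl hcl).1, (rootedPoly_fourLeaf_values hc h hl hcl).2 0,
    hu4, by simp,
    exists_colouring_sup_leaf (hlc 3 3) (hu3.not_adj hl3)
      (exists_colouring_sup_leaf (hlc 2 2) (hu2.not_adj hl2)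
      (exists_colouring_sup_leaf (hlc 1 1) (hu1.not_adj hl1)
      (exists_colouring_sup_leaf (hlc 0 0) (hu0.not_adj hl0) (h.exists_colouring hc)))), ?_, ?_⟩
  · refine ⟨_, ?_, ?_, ((((hasMatchingOn_empty _).insert (hadj 3) ?_ ?_).insert (hadj 2) ?_ ?_).insert
      (hadj 1) ?_ ?_).insert (hadj 0) ?_ ?_⟩
    · simp [Finset.insert_subset_iff]
    · rw [Finset.card_insert_of_notMem, Finset.card_insert_of_notMem, Finset.card_insert_of_notMem,
        Finset.card_insert_of_notMem, Finset.card_insert_of_notMem, Finset.card_insert_of_notMem,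
        Finset.card_insert_of_notMem, Finset.card_insert_of_notMem] <;>
        simp [hc.eq_iff, hl.eq_iff, hcl, hlc]
    all_goals simp [hc.eq_iff, hl.eq_iff, hcl, hlc]
  · refine ⟨Finset.univ.image c, fun x hx => Finset.mem_insert_of_mem
      (Finset.mem_insert_of_mem (Finset.mem_insert_of_mem (Finset.mem_insert_of_mem hx))),
      Finset.card_image_of_injective _ hc, hmem 0, fun x y hxy => ?_⟩
    simp only [attachLeaves, SimpleGraph.sup_adj, SimpleGraph.edge_adj] at hxy
    rcases hxy with (((hxy | hxy) | hxy) | hxy) | hxy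
    · exact Or.inl (hu0.supp x y hxy)
    all_goals
      rcases hxy with ⟨⟨rfl, -⟩ | ⟨-, rfl⟩, -⟩
      · exact Or.inl (hmem _)
      · exact Or.inr (hmem _)

end BaseModels

/-! ### Pendent graphs as completed base models. -/

section PendentGraphs

variable {s t : Fin 4 → ℕ}

/-- The cycle of a pendent graph, listed backwards. -/
def coreVertex (s t : Fin 4 → ℕ) (i : Fin 4) : PendentVertex 4 s t := .inl (3 - i)

/-- The inner vertex of a pendent path. -/
def innerVertex (x : (i : Fin 4) × Fin (s i)) : PendentVertex 4 s t := .inr (.inl ⟨x.1, x.2, 0⟩)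

/-- The end of a pendent path. -/
def outerVertex (x : (i : Fin 4) × Fin (s i)) : PendentVertex 4 s t := .inr (.inl ⟨x.1, x.2, 1⟩)

/-- The end of a pendent edge. -/
def leafVertex (y : (i : Fin 4) × Fin (t i)) : PendentVertex 4 s t := .inr (.inr y)

lemma coreVertex_injective : Function.Injective (coreVertex s t) := fun i k h => by
  have := Sum.inl_injective h
  clear h
  revert i k
  decide

lemma innerVertex_injective :
    Function.Injective (innerVertex : _ → PendentVertex 4 s t) := fun x y h => by
  rcases x with ⟨i, a⟩
  rcases y with ⟨j, b⟩
  simp only [innerVertex, Sum.inr.injEq, Sum.inl.injEq, Sigma.mk.injEq] at h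
  obtain ⟨rfl, h⟩ := h
  simpa using h

lemma outerVertex_injective :
    Function.Injective (outerVertex : _ → PendentVertex 4 s t) := fun x y h => by
  rcases x with ⟨i, a⟩
  rcases y with ⟨j, b⟩
  simp only [outerVertex, Sum.inr.injEq, Sum.inl.injEq, Sigma.mk.injEq] at h
  obtain ⟨rfl, h⟩ := h
  simpa using h

lemma leafVertex_injective :
    Function.Injective (leafVertex : _ → PendentVertex 4 s t) := fun x y h => by
  simpa [leafVertex] using h

lemma innerVertex_ne_outerVertex (x y : (i : Fin 4) × Fin (s i)) :
    (innerVertex x : PendentVertex 4 s t) ≠ outerVertex y := fun h => by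
  rcases x with ⟨i, a⟩
  rcases y with ⟨j, b⟩
  simp only [innerVertex, outerVertex, Sum.inr.injEq, Sum.inl.injEq, Sigma.mk.injEq] at h
  obtain ⟨rfl, h⟩ := h
  simp at h

/-- Splits the graph into a base with the pendent edges in `S` and the attachments at `u₄`. In the
backward listing of the cycle this vertex becomes `c 0`, the root of the base models, and `u₃`
becomes `c 1`. -/
lemma pendentGraph_eq (S : Finset ((i : Fin 4) × Fin (t i))) (hs : ∀ i, i ≠ 3 → s i = 0)
    (hS : ∀ y ∉ S, y.1 = 3) :
    pendentGraph 4 s t =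
      ((cycleOn (coreVertex s t) ⊔ ⨆ y ∈ S, SimpleGraph.edge (.inl y.1) (leafVertex y)) ⊔
        ⨆ x ∈ (Finset.univ : Finset ((i : Fin 4) × Fin (s i))),
          (SimpleGraph.edge (coreVertex s t 0) (innerVertex x) ⊔
            SimpleGraph.edge (innerVertex x) (outerVertex x))) ⊔
      ⨆ y ∈ Finset.univ \ S, SimpleGraph.edge (coreVertex s t 0) (leafVertex y) := by
  have hs' : ∀ x : (i : Fin 4) × Fin (s i), x.1 = 3 := fun x => by
    by_contra h
    have := x.2.pos
    rw [hs _ h] at this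
    exact this.false
  apply le_antisymm
  · have key : ∀ x y : PendentVertex 4 s t, pendentRel 4 s t x y → x ≠ y →
      (((cycleOn (coreVertex s t) ⊔ ⨆ y ∈ S, SimpleGraph.edge (.inl y.1) (leafVertex y)) ⊔
        ⨆ x ∈ (Finset.univ : Finset ((i : Fin 4) × Fin (s i))),
          (SimpleGraph.edge (coreVertex s t 0) (innerVertex x) ⊔
            SimpleGraph.edge (innerVertex x) (outerVertex x))) ⊔
      ⨆ y ∈ Finset.univ \ S, SimpleGraph.edge (coreVertex s t 0) (leafVertex y)).Adj x y := by
      intro x y hxy hne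
      rcases x with i | ⟨i, a, k⟩ | ⟨i, a⟩ <;> rcases y with j | ⟨j, b, l⟩ | ⟨j, b⟩
      · refine Or.inl (Or.inl (Or.inl ?_))
        rw [isFourCycle_cycleOn coreVertex_injective]
        refine ⟨3 - i, 3 - j, by simp [coreVertex], by simp [coreVertex], ?_⟩
        have hxy : (SimpleGraph.cycleGraph 4).Adj i j := hxy
        clear * - hxy
        revert i j
        decide
      · obtain ⟨rfl, rfl⟩ : i = j ∧ l = 0 := hxy
        refine Or.inl (Or.inr ?_)
        simp only [SimpleGraph.iSup_adj]
        obtain rfl : i = 3 := hs' ⟨i, b⟩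
        exact ⟨⟨3, b⟩, Finset.mem_univ _,
          Or.inl ((SimpleGraph.edge_adj ..).2 ⟨Or.inl ⟨rfl, rfl⟩, hne⟩)⟩
      · obtain rfl : i = j := hxy
        by_cases hb : (⟨i, b⟩ : (i : Fin 4) × Fin (t i)) ∈ S
        · refine Or.inl (Or.inl (Or.inr ?_))
          simp only [SimpleGraph.iSup_adj]
          exact ⟨⟨i, b⟩, hb, (SimpleGraph.edge_adj ..).2 ⟨Or.inl ⟨rfl, rfl⟩, hne⟩⟩
        · obtain rfl : i = 3 := hS ⟨i, b⟩ hb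
          refine Or.inr ?_
          simp only [SimpleGraph.iSup_adj]
          exact ⟨⟨3, b⟩, by simpa using hb, (SimpleGraph.edge_adj ..).2 ⟨Or.inl ⟨rfl, rfl⟩, hne⟩⟩
      · exact hxy.elim
      · obtain ⟨rfl, hab, rfl, rfl⟩ : i = j ∧ a.val = b.val ∧ k = 0 ∧ l = 1 := hxy
        obtain rfl : a = b := Fin.ext hab
        refine Or.inl (Or.inr ?_)
        simp only [SimpleGraph.iSup_adj]
        exact ⟨⟨i, a⟩, Finset.mem_univ _,
          Or.inr ((SimpleGraph.edge_adj ..).2 ⟨Or.inl ⟨rfl, rfl⟩, hne⟩)⟩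
      all_goals exact hxy.elim
    intro x y hxy
    obtain ⟨hne, h | h⟩ := (SimpleGraph.fromRel_adj ..).1 hxy
    · exact key x y h hne
    · exact (key y x h hne.symm).symm
  · have hadj : ∀ x y : PendentVertex 4 s t, x ≠ y → pendentRel 4 s t x y →
        (pendentGraph 4 s t).Adj x y := fun x y h1 h2 => (SimpleGraph.fromRel_adj ..).2 ⟨h1, Or.inl h2⟩
    refine sup_le (sup_le (sup_le ?_ ?_) ?_) ?_
    · intro x y hxy
      obtain ⟨i, k, rfl, rfl, hik⟩ := (isFourCycle_cycleOn coreVertex_injective x y).1 hxy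
      refine hadj _ _ hxy.ne ?_
      change (SimpleGraph.cycleGraph 4).Adj (3 - i) (3 - k)
      clear hxy
      revert i k
      decide
    · refine iSup₂_le fun y _ => (SimpleGraph.edge_le_iff _).2 (Or.inr (hadj _ _ Sum.inl_ne_inr rfl))
    · refine iSup₂_le fun x _ => sup_le ((SimpleGraph.edge_le_iff _).2 (Or.inr ?_))
        ((SimpleGraph.edge_le_iff _).2 (Or.inr ?_))
      · exact hadj _ _ Sum.inl_ne_inr ⟨(hs' x).symm, rfl⟩
      · exact hadj _ _ (innerVertex_ne_outerVertex x x) ⟨rfl, rfl, rfl, rfl⟩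
    · refine iSup₂_le fun y hy => (SimpleGraph.edge_le_iff _).2 (Or.inr (hadj _ _ Sum.inl_ne_inr ?_))
      exact (hS y (Finset.mem_sdiff.1 hy).2).symm

/-- Completing a core with pendent paths and edges at one vertex. -/
lemma isModel_pendentGraph (S : Finset ((i : Fin 4) × Fin (t i))) (hs : ∀ i, i ≠ 3 → s i = 0)
    (hS : ∀ y ∉ S, y.1 = 3) {m : ℕ} {p : ℤ[X] × ℤ[X]} {K : SimpleGraph (PendentVertex 4 s t)}
    {U : Finset (PendentVertex 4 s t)}
    (hK : K = cycleOn (coreVertex s t) ⊔ ⨆ y ∈ S, SimpleGraph.edge (.inl y.1) (leafVertex y))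
    (hU : ∀ x, x ∈ U ↔ (∃ y ∈ S, x = leafVertex y) ∨ ∃ i, x = coreVertex s t i)
    (hcore : IsModel K U (coreVertex s t 0) m p) :
    IsModel (pendentGraph 4 s t) Finset.univ (coreVertex s t 0) (m + s 3)
      (addLeaf^[∑ i, t i - S.card] (addPath^[s 3] p)) := by
  have hcs : (Finset.univ : Finset ((i : Fin 4) × Fin (s i))).card = s 3 := by
    rw [Finset.card_univ, Fintype.card_sigma]
    simp only [Fintype.card_fin]
    exact Finset.sum_eq_single 3 (fun i _ hi => hs i hi) (by simp)
  have hct : (Finset.univ \ S).card = ∑ i, t i - S.card := by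
    rw [Finset.card_sdiff_of_subset (Finset.subset_univ S), Finset.card_univ, Fintype.card_sigma]
    simp only [Fintype.card_fin]
  have h1 := hcore.paths (f := innerVertex) (g := outerVertex) innerVertex_injective
    outerVertex_injective innerVertex_ne_outerVertex Finset.univ
    (fun i _ h => by simp [hU, innerVertex, leafVertex, coreVertex] at h)
    (fun i _ h => by simp [hU, outerVertex, leafVertex, coreVertex] at h)
  have h2 := h1.leaves (f := leafVertex) leafVertex_injective (Finset.univ \ S) (fun y hy h => by
    simp only [Finset.mem_union, Finset.mem_image, hU, leafVertex_injective.eq_iff] at h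
    simp [innerVertex, outerVertex, leafVertex, coreVertex] at h hy
    exact hy h)
  subst hK
  rw [← pendentGraph_eq S hs hS, hcs, hct] at h2
  convert h2
  symm
  rw [Finset.eq_univ_iff_forall]
  intro x
  simp only [Finset.mem_union, Finset.mem_image, Finset.mem_univ, true_and, Finset.mem_sdiff, hU]
  rcases x with i | ⟨i, a, k⟩ | y
  · exact Or.inr (Or.inr (Or.inr ⟨3 - i, by simp [coreVertex]⟩))
  · fin_cases k
    · exact Or.inr (Or.inl (Or.inr ⟨⟨i, a⟩, rfl⟩))
    · exact Or.inr (Or.inl (Or.inl ⟨⟨i, a⟩, rfl⟩))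
  · by_cases hy : y ∈ S
    · exact Or.inr (Or.inr (Or.inl ⟨y, hy, rfl⟩))
    · exact Or.inl ⟨y, hy, rfl⟩

lemma leafVertex_ne_coreVertex (y : (i : Fin 4) × Fin (t i)) (k : Fin 4) :
    leafVertex y ≠ coreVertex s t k := Sum.inr_ne_inl

lemma sup_iSup_insert {V ι : Type*} [DecidableEq ι] (G : SimpleGraph V) (f : ι → SimpleGraph V)
    (S : Finset ι) (a : ι) :
    G ⊔ ⨆ y ∈ insert a S, f y = (G ⊔ ⨆ y ∈ S, f y) ⊔ f a := by
  rw [Finset.iSup_insert, sup_comm (f a), sup_assoc]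

lemma isModel_pendentGraph_cycle (hs : ∀ i, i ≠ 3 → s i = 0) (ht : ∀ i, i ≠ 3 → t i = 0) :
    IsModel (pendentGraph 4 s t) Finset.univ (coreVertex s t 0) (2 + s 3)
      (addLeaf^[t 3] (addPath^[s 3] cycleProfile)) := by
  have h := isModel_pendentGraph ∅ hs (fun y _ => by
    by_contra h
    have := y.2.pos
    rw [ht _ h] at this
    exact this.false) (by simp) (fun x => by simp [eq_comm])
    ((isFourCycle_cycleOn (coreVertex_injective (s := s) (t := t))).isModel coreVertex_injective)
  rwa [Finset.card_empty, Nat.sub_zero, Finset.sum_eq_single 3 (fun i _ hi => ht i hi) (by simp)] at h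

lemma isModel_pendentGraph_twoLeaf (hs : ∀ i, i ≠ 3 → s i = 0) (ht0 : t 0 = 0) (ht1 : t 1 = 0)
    (ht2 : t 2 = 1) {k : ℕ} (ht3 : t 3 = k + 1) :
    IsModel (pendentGraph 4 s t) Finset.univ (coreVertex s t 0) (3 + s 3)
      (addLeaf^[k] (addPath^[s 3] twoLeafProfile)) := by
  -- The base takes the only pendent edge at `u₃` and one of the `k + 1` pendent edges at `u₄`; the
  -- remaining `k` are added as leaves.
  let y2 : (i : Fin 4) × Fin (t i) := ⟨2, ⟨0, by omega⟩⟩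
  let y3 : (i : Fin 4) × Fin (t i) := ⟨3, ⟨0, by omega⟩⟩
  have hne : y3 ≠ y2 := fun h => by simpa [y2, y3] using congrArg Sigma.fst h
  have h := isModel_pendentGraph (insert y2 (insert y3 ∅)) hs (fun y hy => by
      rcases y with ⟨i, a⟩
      have ha := a.2
      have h0 : i ≠ 0 := by rintro rfl; omega
      have h1 : i ≠ 1 := by rintro rfl; omega
      have h2 : i ≠ 2 := by
        rintro rfl
        have ha0 : a = ⟨0, by omega⟩ := Fin.ext (by simp only; omega)
        rw [ha0] at hy
        exact hy (Finset.mem_insert_self ..)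
      simp only
      omega) (by
        rw [sup_iSup_insert, sup_iSup_insert]
        simp only [Finset.notMem_empty, iSup_false, iSup_bot, sup_bot_eq]
        rfl) (fun x => by simp [eq_comm, or_assoc])
      ((isFourCycle_cycleOn (coreVertex_injective (s := s) (t := t))).isModel_twoLeaf
        coreVertex_injective (leafVertex_ne_coreVertex y3) (leafVertex_ne_coreVertex y2)
        (leafVertex_injective.ne hne))
  have hc : ∑ i, t i - (insert y2 (insert y3 ∅) : Finset ((i : Fin 4) × Fin (t i))).card = k := by
    rw [Finset.card_insert_of_notMem (by simpa using hne.symm),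
      Finset.card_insert_of_notMem (by simp), Fin.sum_univ_four, Finset.card_empty]
    omega
  rwa [hc] at h

lemma isModel_pendentGraph_fourLeaf (hs : ∀ i, i ≠ 3 → s i = 0) (ht : ∀ i, i ≠ 3 → t i = 1)
    {k : ℕ} (ht3 : t 3 = k + 1) :
    IsModel (pendentGraph 4 s t) Finset.univ (coreVertex s t 0) (4 + s 3)
      (addLeaf^[k] (addPath^[s 3] fourLeafProfile)) := by
  have hpos : ∀ i, 0 < t i := fun i => by
    by_cases hi : i = 3
    · rw [hi]; omega
    · rw [ht i hi]; exact one_pos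
  obtain ⟨y, hy1, hy2⟩ : ∃ y : Fin 4 → (i : Fin 4) × Fin (t i), (∀ i, (y i).1 = 3 - i) ∧
      ∀ z : (i : Fin 4) × Fin (t i), z.1 ≠ 3 → z = y (3 - z.1) := by
    refine ⟨fun i => ⟨3 - i, ⟨0, hpos _⟩⟩, fun i => rfl, fun z hz => ?_⟩
    rcases z with ⟨i, a⟩
    have ha : a.val = 0 := by
      have h1 := a.2
      have h2 := ht i hz
      omega
    have key : ∀ (i j : Fin 4) (_ : i = j) (a : Fin (t i)) (_ : a.val = 0),
        (⟨i, a⟩ : (i : Fin 4) × Fin (t i)) = ⟨j, ⟨0, hpos j⟩⟩ := by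
      rintro i _ rfl a ha
      congr 1
      exact Fin.ext ha
    exact key _ _ (sub_sub_cancel 3 i).symm a ha
  have hy : Function.Injective y := fun i k h => by
    have := congrArg Sigma.fst h
    rw [hy1, hy1] at this
    exact sub_right_injective this
  have hedge : ∀ i, SimpleGraph.edge (coreVertex s t i) (leafVertex (y i)) =
      SimpleGraph.edge (.inl (y i).1) (leafVertex (y i)) := fun i => by
    rw [hy1, coreVertex]
  have h := isModel_pendentGraph (insert (y 3) (insert (y 2) (insert (y 1) (insert (y 0) ∅)))) hs
    (fun z hz => by
      by_contra h3
      apply hz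
      rw [hy2 z h3]
      generalize 3 - z.1 = i
      fin_cases i <;> simp) (by
        rw [sup_iSup_insert, sup_iSup_insert, sup_iSup_insert, sup_iSup_insert, ← hedge, ← hedge,
          ← hedge, ← hedge]
        simp only [Finset.notMem_empty, iSup_false, iSup_bot, sup_bot_eq]
        rfl) (fun x => by
        simp only [Finset.mem_insert, Finset.mem_image, Finset.mem_univ, true_and,
          Finset.notMem_empty, or_false, exists_eq_or_imp, exists_eq_left, Function.comp_apply,
          or_assoc, eq_comm])
      ((isFourCycle_cycleOn (coreVertex_injective (s := s) (t := t))).isModel_fourLeaf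
        coreVertex_injective (l := leafVertex ∘ y) (leafVertex_injective.comp hy)
        fun i => leafVertex_ne_coreVertex _)
  have hc : ∑ i, t i - (insert (y 3) (insert (y 2) (insert (y 1)
    (insert (y 0) ∅))) : Finset ((i : Fin 4) × Fin (t i))).card = k := by
    rw [Finset.card_insert_of_notMem (by simp [hy.eq_iff]),
      Finset.card_insert_of_notMem (by simp [hy.eq_iff]),
      Finset.card_insert_of_notMem (by simp [hy.eq_iff]),
      Finset.card_insert_of_notMem (by simp), Fin.sum_univ_four, Finset.card_empty, ht3,
      ht 0 (by decide), ht 1 (by decide), ht 2 (by decide)]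
    omega
  rwa [hc] at h

end PendentGraphs

/-! ### The extremal graphs and the comparison of coefficients. -/

section Comparisons

lemma fin_four_cases {P : Fin 4 → Prop} (h0 : P 0) (h1 : P 1) (h2 : P 2) : ∀ i, i ≠ 3 → P i := by
  intro i hi
  fin_cases i
  · exact h0
  · exact h1
  · exact h2
  · exact absurd rfl hi

lemma card_pendentVertex (s t : Fin 4 → ℕ) :
    Fintype.card (PendentVertex 4 s t) = 4 + ((∑ i, s i * 2) + ∑ i, t i) := by
  simp [PendentVertex, Fintype.card_sigma]

/-- Writing `n = 2 * (m + 2) + k` makes the truncated subtractions in the definition of the graph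
exact; the same device serves `G_4^2` and `G_4^4`. -/
lemma isModel_graphG41 (k m : ℕ) :
    IsModel (graphG41 (2 * (m + 2) + k) (m + 2)) Finset.univ (coreVertex _ _ 0) (2 + m)
      (addLeaf^[k] (addPath^[m] cycleProfile)) := by
  have h := isModel_pendentGraph_cycle (s := ![0, 0, 0, m + 2 - 2])
    (t := ![0, 0, 0, 2 * (m + 2) + k - 2 * (m + 2)]) (fin_four_cases rfl rfl rfl)
    (fin_four_cases rfl rfl rfl)
  have e1 : (![0, 0, 0, m + 2 - 2] : Fin 4 → ℕ) 3 = m := by simp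
  have e2 : (![0, 0, 0, 2 * (m + 2) + k - 2 * (m + 2)] : Fin 4 → ℕ) 3 = k := by simp
  rwa [e1, e2] at h

lemma isModel_graphG42 (k m : ℕ) :
    IsModel (graphG42 (2 * (m + 3) + k) (m + 3)) Finset.univ (coreVertex _ _ 0) (3 + m)
      (addLeaf^[k] (addPath^[m] twoLeafProfile)) := by
  have h := isModel_pendentGraph_twoLeaf (s := ![0, 0, 0, m + 3 - 3])
    (t := ![0, 0, 1, 2 * (m + 3) + k - 2 * (m + 3) + 1]) (fin_four_cases rfl rfl rfl)
    rfl rfl rfl (k := k) (by simp)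
  have e1 : (![0, 0, 0, m + 3 - 3] : Fin 4 → ℕ) 3 = m := by simp
  rwa [e1] at h

lemma isModel_graphG44 (k m : ℕ) :
    IsModel (graphG44 (2 * (m + 4) + k) (m + 4)) Finset.univ (coreVertex _ _ 0) (4 + m)
      (addLeaf^[k] (addPath^[m] fourLeafProfile)) := by
  have h := isModel_pendentGraph_fourLeaf (s := ![0, 0, 0, m + 4 - 4])
    (t := ![1, 1, 1, 2 * (m + 4) + k - 2 * (m + 4) + 1]) (fin_four_cases rfl rfl rfl)
    (fin_four_cases rfl rfl rfl) (k := k) (by simp)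
  have e1 : (![0, 0, 0, m + 4 - 4] : Fin 4 → ℕ) 3 = m := by simp
  rwa [e1] at h

lemma card_graphG41 (k m : ℕ) :
    Fintype.card (PendentVertex 4 ![0, 0, 0, m + 2 - 2]
      ![0, 0, 0, 2 * (m + 2) + k - 2 * (m + 2)]) = 2 * (m + 2) + k := by
  rw [card_pendentVertex, Fin.sum_univ_four, Fin.sum_univ_four]
  simp
  omega

lemma card_graphG42 (k m : ℕ) :
    Fintype.card (PendentVertex 4 ![0, 0, 0, m + 3 - 3]
      ![0, 0, 1, 2 * (m + 3) + k - 2 * (m + 3) + 1]) = 2 * (m + 3) + k := by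
  rw [card_pendentVertex, Fin.sum_univ_four, Fin.sum_univ_four]
  simp
  omega

lemma card_graphG44 (k m : ℕ) :
    Fintype.card (PendentVertex 4 ![0, 0, 0, m + 4 - 4]
      ![1, 1, 1, 2 * (m + 4) + k - 2 * (m + 4) + 1]) = 2 * (m + 4) + k := by
  rw [card_pendentVertex, Fin.sum_univ_four, Fin.sum_univ_four]
  simp
  omega

variable {W : Type*} [Fintype W] {H : SimpleGraph W}

/-- The lower bound for the polynomial of a unicyclic graph of even girth. -/
lemma IsEvenUnicyclic.hasExtremalBound {n m : ℕ} (h : IsEvenUnicyclic n m H) (hm : 2 ≤ m) :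
    HasExtremalBound H Finset.univ m ∧
      ∀ i ≤ n, signlessCoeff H i = (lapPoly H).coeff i := by
  obtain ⟨col, hcol⟩ := h.unicyclic.exists_colouring h.even_girth
  obtain ⟨M, hM, hMm⟩ := h.matching.1
  obtain ⟨mt, hmt, hc⟩ := exists_isMatchingMap_of_isMatching hM
  rw [hMm] at hc
  exact ⟨IsUnicyclicOn.hasExtremalBound _ H Finset.univ mt m rfl
    (h.unicyclic.isUnicyclicOn (not_adj_of_colouring hcol)) hmt hc hm,
    fun i hi => signlessCoeff_eq_coeff_lapPoly hcol (by rwa [h.card_eq])⟩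

lemma IsModel.signlessCoeffLE {V : Type*} [Fintype V] {G : SimpleGraph V} {u : V} {m n l : ℕ}
    {p : ℤ[X] × ℤ[X]} (h : IsModel G Finset.univ u m p) (hn : Fintype.card V = n)
    (hH : IsEvenUnicyclic n l H) (hl : 2 ≤ l) (hp : CoeffNonneg (lapPoly H - p.1)) :
    SignlessCoeffLE n G H := fun i hi => by
  rw [h.signlessCoeff_eq (by rwa [hn]), (hH.hasExtremalBound hl).2 i hi]
  have := hp i
  rw [coeff_sub] at this
  linarith

lemma IsModel.not_signlessCoeffLE {V : Type*} [Fintype V] {G : SimpleGraph V}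
    {u : V} {w : W} {m l n i : ℕ} {p q : ℤ[X] × ℤ[X]} (h : IsModel G Finset.univ u m p)
    (hn : Fintype.card V = n) (h' : IsModel H Finset.univ w l q) (hn' : Fintype.card W = n)
    (hi : i ≤ n) (hlt : q.1.coeff i < p.1.coeff i) : ¬ SignlessCoeffLE n G H := fun hle => by
  have := hle i hi
  rw [h.signlessCoeff_eq (by rwa [hn]), h'.signlessCoeff_eq (by rwa [hn'])] at this
  exact absurd hlt (not_lt.2 this)

lemma IsEvenUnicyclic.graphG41_le {k : ℕ} (h : IsEvenUnicyclic (2 * (0 + 2) + k) (0 + 2) H) :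
    SignlessCoeffLE (2 * (0 + 2) + k) (graphG41 (2 * (0 + 2) + k) (0 + 2)) H := by
  refine (isModel_graphG41 k 0).signlessCoeffLE (card_graphG41 k 0) h le_rfl ?_
  have := (h.hasExtremalBound le_rfl).1.lapPoly_two
  rwa [Finset.card_univ, h.card_eq, show 2 * (0 + 2) + k - 4 = k by omega] at this

lemma IsEvenUnicyclic.graphG42_le_or {k j : ℕ}
    (h : IsEvenUnicyclic (2 * (j + 3) + k) (j + 3) H) :
    SignlessCoeffLE (2 * (j + 3) + k) (graphG42 (2 * (j + 3) + k) (j + 3)) H ∨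
      ∃ i, j = i + 1 ∧
        CoeffNonneg (lapPoly H - (addLeaf^[k] (addPath^[i] fourLeafProfile)).1) := by
  have h1 := (h.hasExtremalBound (by omega)).1.lapPoly_or
  rw [Finset.card_univ, h.card_eq, Nat.add_sub_cancel_left] at h1
  exact h1.imp_left fun h2 =>
    (isModel_graphG42 k j).signlessCoeffLE (card_graphG42 k j) h (by omega) h2

lemma IsEvenUnicyclic.graphG42_le_or_graphG44_le {k j : ℕ}
    (h : IsEvenUnicyclic (2 * (j + 4) + k) (j + 4) H) :
    SignlessCoeffLE (2 * (j + 4) + k) (graphG42 (2 * (j + 4) + k) (j + 4)) H ∨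
      SignlessCoeffLE (2 * (j + 4) + k) (graphG44 (2 * (j + 4) + k) (j + 4)) H := by
  refine (IsEvenUnicyclic.graphG42_le_or (j := j + 1) h).imp_right ?_
  rintro ⟨i, hi, h2⟩
  obtain rfl : i = j := by omega
  exact (isModel_graphG44 k i).signlessCoeffLE (card_graphG44 k i) h (by omega) h2

/-- Whichever bound `H` satisfies, the two-leaf one follows: with this many attachments it lies
below the four-leaf profile. -/
lemma IsEvenUnicyclic.graphG42_le_of_large {k j : ℕ} (hkj : 3 ≤ k + 2 * j)
    (h : IsEvenUnicyclic (2 * (j + 4) + k) (j + 4) H) :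
    SignlessCoeffLE (2 * (j + 4) + k) (graphG42 (2 * (j + 4) + k) (j + 4)) H := by
  rcases IsEvenUnicyclic.graphG42_le_or (j := j + 1) h with h1 | ⟨i, hi, h2⟩
  · exact h1
  · obtain rfl : i = j := by omega
    have h3 := (twoLeafProfile_iterate_le_of_large hkj).1.trans h2
    rw [← Function.iterate_succ_apply] at h3
    exact (isModel_graphG42 k (i + 1)).signlessCoeffLE (card_graphG42 k (i + 1)) h (by omega) h3

lemma IsEvenUnicyclic.graphG44_le_of_eight
    (h : IsEvenUnicyclic (2 * (0 + 4) + 0) (0 + 4) H) :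
    SignlessCoeffLE (2 * (0 + 4) + 0) (graphG44 (2 * (0 + 4) + 0) (0 + 4)) H := by
  refine (isModel_graphG44 0 0).signlessCoeffLE (card_graphG44 0 0) h (by omega) ?_
  have h1 := (IsEvenUnicyclic.hasExtremalBound h (by omega)).1.lapPoly_or (j := 0 + 1)
  rw [Finset.card_univ, h.card_eq] at h1
  rcases h1 with h1 | ⟨i, hi, h1⟩
  · exact fourLeafProfile_fst_le.trans h1
  · obtain rfl : i = 0 := by omega
    exact h1

end Comparisons
end

/-! ### The five cases. -/

theorem theorem4p2 (n m : ℕ) (hnm : 2 * m ≤ n) :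
    (m = 2 → MinimisesSignlessCoeffs.{u, 0} n m (graphG41 n m)) ∧
    (m = 3 → MinimisesSignlessCoeffs.{u, 0} n m (graphG42 n m)) ∧
    (4 ≤ m → n = 8 → MinimisesSignlessCoeffs.{u, 0} n m (graphG44 n m)) ∧
    ((4 ≤ m ∧ 11 ≤ n ∧ m + 7 ≤ n) ∨ (5 ≤ m ∧ 11 ≤ n ∧ m + 6 ≤ n) ∨
        (7 ≤ m ∧ 11 ≤ n ∧ m + 5 ≤ n) →
      MinimisesSignlessCoeffs.{u, 0} n m (graphG42 n m)) ∧
    (4 ≤ m → n ≠ 8 →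
        ¬ ((4 ≤ m ∧ 11 ≤ n ∧ m + 7 ≤ n) ∨ (5 ≤ m ∧ 11 ≤ n ∧ m + 6 ≤ n) ∨
          (7 ≤ m ∧ 11 ≤ n ∧ m + 5 ≤ n)) →
      IsEvenUnicyclic n m (graphG42 n m) ∧
      IsEvenUnicyclic n m (graphG44 n m) ∧
      (∀ (W : Type u) [Fintype W] (H : SimpleGraph W), IsEvenUnicyclic n m H →
        SignlessCoeffLE n (graphG42 n m) H ∨ SignlessCoeffLE n (graphG44 n m) H) ∧
      ¬ SignlessCoeffLE n (graphG42 n m) (graphG44 n m) ∧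
      ¬ SignlessCoeffLE n (graphG44 n m) (graphG42 n m)) := by
  refine ⟨?_, ?_, ?_, ?_, ?_⟩
  · rintro rfl
    obtain ⟨k, rfl⟩ := Nat.exists_eq_add_of_le hnm
    exact ⟨(isModel_graphG41 k 0).isEvenUnicyclic (card_graphG41 k 0),
      fun W _ H hH => hH.graphG41_le⟩
  · rintro rfl
    obtain ⟨k, rfl⟩ := Nat.exists_eq_add_of_le hnm
    refine ⟨(isModel_graphG42 k 0).isEvenUnicyclic (card_graphG42 k 0), fun W _ H hH => ?_⟩
    rcases IsEvenUnicyclic.graphG42_le_or (j := 0) hH with h | ⟨i, hi, -⟩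
    · exact h
    · omega
  · intro hm hn
    obtain rfl : m = 4 := by omega
    obtain rfl : n = 8 := hn
    exact ⟨(isModel_graphG44 0 0).isEvenUnicyclic (card_graphG44 0 0),
      fun W _ H hH => IsEvenUnicyclic.graphG44_le_of_eight hH⟩
  · intro h
    obtain ⟨j, rfl⟩ : ∃ j, m = j + 4 := ⟨m - 4, by omega⟩
    obtain ⟨k, rfl⟩ := Nat.exists_eq_add_of_le hnm
    -- With `n = 2 * (j + 4) + k`, the bound `n ≥ 11` common to the three alternatives already gives
    -- `3 ≤ k + 2 * j`.
    refine ⟨?_, fun W _ H hH => hH.graphG42_le_of_large (by omega)⟩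
    have h1 := (isModel_graphG42 k (j + 1)).isEvenUnicyclic (card_graphG42 k (j + 1))
    rwa [show 3 + (j + 1) = j + 4 by omega] at h1
  · intro hm hn h
    obtain ⟨j, rfl⟩ : ∃ j, m = j + 4 := ⟨m - 4, by omega⟩
    obtain ⟨k, rfl⟩ := Nat.exists_eq_add_of_le hnm
    have h2 := isModel_graphG42 k (j + 1)
    have h4 := isModel_graphG44 k j
    rw [show 3 + (j + 1) = j + 4 by omega] at h2
    rw [show 4 + j = j + 4 by omega] at h4
    have c2 := card_graphG42 k (j + 1)
    have c4 := card_graphG44 k j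
    -- The excluded ranges leave only `(n, m) = (9, 4), (10, 4), (10, 5)`, that is `(k, j) = (1, 0),
    -- (2, 0), (0, 1)`.
    obtain ⟨i, hi, i', hi', hlt, hlt'⟩ := extremalProfiles_incomparable (k := k) (j := j) (by omega)
    rw [← Function.iterate_succ_apply] at hlt hlt'
    exact ⟨h2.isEvenUnicyclic c2, h4.isEvenUnicyclic c4,
      fun W _ H hH => hH.graphG42_le_or_graphG44_le,
      h2.not_signlessCoeffLE c2 h4 c4 (by omega) hlt',
      h4.not_signlessCoeffLE c4 h2 c2 (by omega) hlt⟩
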